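/- Let $u_0(x)=\tanh(x/\sqrt2)$, $x\in\mathbb R$. For $\psi\in H^2_{\rm loc}(\mathbb R,\mathbb C)$ put $$E(\psi)=\int_{\mathbb R}\Bigl(|\psi_x|^2+\tfrac12(1-|\psi|^2)^2\Bigr)dx,$$ $$S(\psi)=\int_{\mathbb R}\Bigl(|\psi_{xx}|^2+3|\psi|^2|\psi_x|^2+\tfrac12(\bar\psi\psi_x+\psi\bar\psi_x)^2+(1-|\psi|^2)^2\bigl(1+\tfrac12|\psi|^2\bigr)\Bigr)dx,$$ and $\Lambda(\psi)=S(\psi)-2E(\psi)$. For $R\ge1$ let $$d_R(\psi,u_0)=\|(\psi-u_0)_x\|_{H^1(\mathbb R)}+\||\psi|^2-u_0^2\|_{L^2(\mathbb R)}+\|\psi-u_0\|_{L^2(-R,R)}\in[0,\infty].$$ Write $\psi=u_0+u+iv$ with $u,v$ real-valued, $\eta=|\psi|^2-u_0^2=2u_0u+u^2+v^2$, and $$\rho^2=\int_{\mathbb R}(u_{xx}^2+v_{xx}^2+u_x^2+v_x^2)\,dx+\int_{|x|\le R}(u^2+R^{-2}v^2)\,dx+\int_{|x|\ge R}(\eta_x^2+\eta^2)\,dx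 .$$ All derivatives of $\psi,u,v,\eta$ are weak derivatives, and $\langle f,g\rangle=\int_{\mathbb R}fg\,dx$. (a) There are constants $R_0\ge1$ and $K\ge0$ such that for every $R\ge R_0$ there is $C_2>0$ (which may depend on $R$) with the following property: for every $\psi=u_0+u+iv\in H^2_{\rm loc}(\mathbb R,\mathbb C)$ with $d_R(\psi,u_0)\le1$ and $\langle u_0',u\rangle=\langle u_0'',v\rangle=0$, the integrals $S(\psi)$ and $E(\psi)$ converge, $\rho<\infty$, and $$\Lambda(\psi)-\Lambda(u_0)\ \ge\ C_2\,\rho^2-K R^3\rho^3 .$$ (b) For every $R\ge1$ there are $\epsilon_1\in(0,1)$ and $C_4\ge1$ such that for every $\psi=u_0+u+iv\in H^2_{\rm loc}(\mathbb R,\mathbb C)$ with $d_R(\psi,u_0)\le\epsilon_1$ and $\langle u_0',u\rangle=\langle u_0'',v\rangle=0$, the integrals $S(\psi)$ and $E(\psi)$ converge and $$C_4^{-1}\,d_R(\psi,u_0)^2\ \le\ \Lambda(\psi)-\Lambda(u_0)\ \le\ C_4\,d_R(\psi,u_0)^2 .$$ -/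

import Mathlib

open MeasureTheory Set
open scoped ENNReal ContDiff

noncomputable section

namespace BlackSoliton

/-- `g` is the weak derivative of `f` on `ℝ`: both are locally integrable and
`∫ φ' f = - ∫ φ g` for every test function `φ ∈ C_c^∞(ℝ)`. -/
def HasWeakDeriv {E : Type*} [NormedAddCommGroup E] [NormedSpace ℝ E] (f g : ℝ → E) : Prop :=
  LocallyIntegrable f volume ∧ LocallyIntegrable g volume ∧
    ∀ φ : ℝ → ℝ, ContDiff ℝ ∞ φ → HasCompactSupport φ →
      ∫ x, deriv φ x • f x = - ∫ x, φ x • g x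

open Classical in
/-- The weak derivative of `f`, which is unique up to equality almost everywhere
(the value is `0` if `f` has no weak derivative). -/
def weakDeriv {E : Type*} [NormedAddCommGroup E] [NormedSpace ℝ E] (f : ℝ → E) : ℝ → E :=
  if h : ∃ g, HasWeakDeriv f g then h.choose else 0

/-- Local square integrability on `ℝ`. -/
def MemL2loc {E : Type*} [NormedAddCommGroup E] (f : ℝ → E) : Prop :=
  ∀ K : Set ℝ, IsCompact K → MemLp f 2 (volume.restrict K)

/-- The local Sobolev space `H²_loc(ℝ)`: `f` has weak derivatives of orders one and two, and
`f`, `f'`, `f''` are locally square integrable. -/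
def MemH2loc {E : Type*} [NormedAddCommGroup E] [NormedSpace ℝ E] (f : ℝ → E) : Prop :=
  ∃ f₁ f₂ : ℝ → E, HasWeakDeriv f f₁ ∧ HasWeakDeriv f₁ f₂ ∧
    MemL2loc f ∧ MemL2loc f₁ ∧ MemL2loc f₂

/-- The norm `(‖f‖²_{L²} + ‖f'‖²_{L²})^{1/2}` of `H¹(ℝ)`, for a weakly differentiable `f`;
it takes values in `[0, ∞]`. -/
def eH1Norm {E : Type*} [NormedAddCommGroup E] [NormedSpace ℝ E] (f : ℝ → E) : ℝ≥0∞ :=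
  (eLpNorm f 2 volume ^ 2 + eLpNorm (weakDeriv f) 2 volume ^ 2) ^ (1 / 2 : ℝ)

/-- The distance `d_R(ψ₁, ψ₂) = ‖(ψ₁ - ψ₂)_x‖_{H¹(ℝ)} + ‖|ψ₁|² - |ψ₂|²‖_{L²(ℝ)}
+ ‖ψ₁ - ψ₂‖_{L²(-R,R)}`, with values in `[0, ∞]`, for functions in `H²_loc(ℝ)`. -/
def eDist (R : ℝ) (ψ₁ ψ₂ : ℝ → ℂ) : ℝ≥0∞ :=
  eH1Norm (weakDeriv (fun x => ψ₁ x - ψ₂ x))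
    + eLpNorm (fun x => ‖ψ₁ x‖ ^ 2 - ‖ψ₂ x‖ ^ 2) 2 volume
    + eLpNorm (fun x => ψ₁ x - ψ₂ x) 2 (volume.restrict (Ioo (-R) R))

/-- The soliton profile `u₀(x) = tanh (x / √2)`. -/
def u₀ (x : ℝ) : ℝ := Real.tanh (x / Real.sqrt 2)

/-- The soliton profile as a complex-valued function. -/
def solitonC (x : ℝ) : ℂ := (u₀ x : ℂ)

/-- The perturbed profile `ψ = u₀ + u + i v`. -/
def perturbed (u v : ℝ → ℝ) (x : ℝ) : ℂ := (u₀ x : ℂ) + (u x : ℂ) + Complex.I * (v x : ℂ)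

/-- The integrand `|ψ_x|² + ½ (1 - |ψ|²)²` of the energy. -/
def energyDensity (ψ : ℝ → ℂ) (x : ℝ) : ℝ :=
  ‖weakDeriv ψ x‖ ^ 2 + 1 / 2 * (1 - ‖ψ x‖ ^ 2) ^ 2

/-- The energy `E(ψ)`. -/
def energy (ψ : ℝ → ℂ) : ℝ := ∫ x, energyDensity ψ x

/-- The integrand `|ψ_xx|² + 3 |ψ|² |ψ_x|² + ½ (ψ̄ ψ_x + ψ ψ̄_x)² + (1 - |ψ|²)² (1 + ½ |ψ|²)`
of the higher-order functional; the real number `ψ̄ ψ_x + ψ ψ̄_x` is written as `2 Re (ψ̄ ψ_x)`. -/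
def higherDensity (ψ : ℝ → ℂ) (x : ℝ) : ℝ :=
  ‖weakDeriv (weakDeriv ψ) x‖ ^ 2 + 3 * ‖ψ x‖ ^ 2 * ‖weakDeriv ψ x‖ ^ 2
    + 1 / 2 * (2 * (star (ψ x) * weakDeriv ψ x).re) ^ 2
    + (1 - ‖ψ x‖ ^ 2) ^ 2 * (1 + 1 / 2 * ‖ψ x‖ ^ 2)

/-- The higher-order functional `S(ψ)`. -/
def higherEnergy (ψ : ℝ → ℂ) : ℝ := ∫ x, higherDensity ψ x

/-- The functional `Λ(ψ) = S(ψ) - 2 E(ψ)`. -/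
def Lam (ψ : ℝ → ℂ) : ℝ := higherEnergy ψ - 2 * energy ψ

/-- The orthogonality conditions `⟨u₀', u⟩ = 0` and `⟨u₀'', v⟩ = 0`. -/
def Orthogonality (u v : ℝ → ℝ) : Prop :=
  ∫ x, deriv u₀ x * u x = 0 ∧ ∫ x, deriv (deriv u₀) x * v x = 0

/-- The variable `η = |u₀ + u + i v|² - |u₀|²`. -/
def eta (u v : ℝ → ℝ) (x : ℝ) : ℝ := ‖perturbed u v x‖ ^ 2 - u₀ x ^ 2

/-- The quantity `ρ(u, v, η)²`, with values in `[0, ∞]`: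
`∫_ℝ (u_xx² + v_xx² + u_x² + v_x²) + ∫_{|x| ≤ R} (u² + R⁻² v²) + ∫_{|x| ≥ R} (η_x² + η²)`. -/
def eRhoSq (R : ℝ) (u v : ℝ → ℝ) : ℝ≥0∞ :=
  (∫⁻ x, ENNReal.ofReal (weakDeriv (weakDeriv u) x ^ 2 + weakDeriv (weakDeriv v) x ^ 2
      + weakDeriv u x ^ 2 + weakDeriv v x ^ 2))
    + (∫⁻ x in {x : ℝ | |x| ≤ R}, ENNReal.ofReal (u x ^ 2 + (R ^ 2)⁻¹ * v x ^ 2))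
    + ∫⁻ x in {x : ℝ | R ≤ |x|},
        ENNReal.ofReal (weakDeriv (eta u v) x ^ 2 + eta u v x ^ 2)

/-- The quantity `ρ(u, v, η)`, meaningful when `eRhoSq R u v` is finite. -/
def rho (R : ℝ) (u v : ℝ → ℝ) : ℝ := Real.sqrt (eRhoSq R u v).toReal

end BlackSoliton

end

/-! The soliton is a critical point of Λ. Once an explicit exact derivative is discarded, Λ(ψ) −
Λ(u₀) is the integral of `lamDensity`, which consists of a quadratic form in v, a quadratic form in
(u, η) and terms cubic in the perturbation (`IsRep.Lam_eq`). It remains to prove coercivity of the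
two forms and to bound what is left by R³ρ³.

The v-form is, up to an exact derivative, a sum of two squares that vanish together only on
multiples of u₀ (`integral_vForm`). The equation y'' + (1 − u₀²) y = 0 has the explicit second
solution x u₀ − √2, so variation of constants recovers v from the two squares up to a multiple of
u₀, and ⟨u₀'', v⟩ = 0 controls that multiple (`exists_vForm_coercive`). Since v need not decay, it
is measured with an algebraic weight.

If η is replaced by its linear part 2u₀u, the form in u becomes, up to an exact derivative, the sum
of the squares of G = u' + √2 u₀ u and of G'. The kernel of G is spanned by u₀', which ⟨u₀', u⟩ = 0
excludes. However, u need not be square integrable and η cannot be linearised at infinity, so the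
form is split by a slowly varying algebraic `cutoff`. On the part weighted by the cutoff, η is
linearised: u² and v² grow at most linearly in |x|, with a factor ρ², and the decay of the cutoff
turns the linearisation error into a cubic one (`exists_uForm_coercive`, `abs_uFormErr_le`). On the
complementary part η stays an independent variable, and the form is pointwise positive except for
terms carrying the exponentially small 1 − u₀². These terms have size ε² and are absorbed by the
first part (`uEtaForm_ge`, `Controlled.lamDensity_ge`).

The parameter ε depends on absolute constants only, so K is independent of R. The radius enters the
coercivity constant only through the comparison of the weighted norm with ρ
(`SmallPair.exists_rhoSq_le`). Part (b) follows because d_R and ρ are equivalent up to constants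
depending on R: for small d_R the cubic term is at most half of the quadratic one, and the upper
bound is termwise. -/

namespace BlackSoliton

/-! ### Absolutely continuous functions on the line -/

section AbsolutelyContinuous

/-- `f` is absolutely continuous on every compact interval and has derivative `f'` almost
everywhere. -/
def IsAC (f f' : ℝ → ℝ) : Prop :=
  (∀ a b, AbsolutelyContinuousOnInterval f a b) ∧ ∀ᵐ x, HasDerivAt f (f' x) x

variable {f f' g g' : ℝ → ℝ}

theorem IsAC.add (hf : IsAC f f') (hg : IsAC g g') :
    IsAC (fun x => f x + g x) (fun x => f' x + g' x) :=
  ⟨fun a b => (hf.1 a b).fun_add (hg.1 a b), by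
    filter_upwards [hf.2, hg.2] with x h1 h2 using h1.add h2⟩

theorem IsAC.sub (hf : IsAC f f') (hg : IsAC g g') :
    IsAC (fun x => f x - g x) (fun x => f' x - g' x) :=
  ⟨fun a b => (hf.1 a b).fun_sub (hg.1 a b), by
    filter_upwards [hf.2, hg.2] with x h1 h2 using h1.sub h2⟩

theorem IsAC.mul (hf : IsAC f f') (hg : IsAC g g') :
    IsAC (fun x => f x * g x) (fun x => f' x * g x + f x * g' x) :=
  ⟨fun a b => (hf.1 a b).fun_mul (hg.1 a b), by
    filter_upwards [hf.2, hg.2] with x h1 h2 using h1.mul h2⟩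

theorem IsAC.const_mul (c : ℝ) (hf : IsAC f f') :
    IsAC (fun x => c * f x) (fun x => c * f' x) :=
  ⟨fun a b => (hf.1 a b).const_mul c, by
    filter_upwards [hf.2] with x h1 using h1.const_mul c⟩

theorem IsAC.neg (hf : IsAC f f') : IsAC (fun x => - f x) (fun x => - f' x) := by
  simpa using hf.const_mul (-1)

theorem IsAC.congr_deriv (hf : IsAC f f') (h : f' =ᵐ[volume] g') : IsAC f g' :=
  ⟨hf.1, by filter_upwards [hf.2, h] with x h1 h2 using h2 ▸ h1⟩

theorem IsAC.congr (hf : IsAC f f') (h : ∀ x, f x = g x) (h' : ∀ x, f' x = g' x) : IsAC g g' := by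
  rwa [← funext h, ← funext h']

theorem IsAC.of_hasDerivAt (h : ∀ x, HasDerivAt f (f' x) x) (hc : Continuous f') : IsAC f f' := by
  refine ⟨fun a b => ContDiffOn.absolutelyContinuousOnInterval ?_, .of_forall h⟩
  have : deriv f = f' := funext fun x => (h x).deriv
  exact (contDiff_one_iff_deriv.2 ⟨fun x => (h x).differentiableAt, this ▸ hc⟩).contDiffOn

theorem IsAC.continuous (hf : IsAC f f') : Continuous f := by
  rw [continuous_iff_continuousAt]
  intro x
  refine (hf.1 (x - 1) (x + 1)).continuousOn.continuousAt ?_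
  rw [uIcc_of_le (by linarith)]
  exact Icc_mem_nhds (by linarith) (by linarith)

theorem IsAC.deriv_ae (hf : IsAC f f') : deriv f =ᵐ[volume] f' := by
  filter_upwards [hf.2] with x h using h.deriv

theorem IsAC.intervalIntegrable (hf : IsAC f f') (a b : ℝ) : IntervalIntegrable f' volume a b :=
  (hf.1 a b).intervalIntegrable_deriv.congr_ae (ae_restrict_of_ae hf.deriv_ae)

theorem IsAC.integral_eq (hf : IsAC f f') (a b : ℝ) : ∫ x in a..b, f' x = f b - f a := by
  rw [← (hf.1 a b).integral_deriv_eq_sub]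
  refine intervalIntegral.integral_congr_ae ?_
  filter_upwards [hf.deriv_ae] with x h _ using h.symm

theorem locallyIntegrable_of_intervalIntegrable (h : ∀ a b, IntervalIntegrable f volume a b) :
    LocallyIntegrable f volume := by
  rw [locallyIntegrable_iff]
  intro k hk
  obtain ⟨r, hr⟩ := hk.isBounded.subset_closedBall 0
  rw [Real.closedBall_eq_Icc] at hr
  rcases le_or_gt (0 - r) (0 + r) with h' | h'
  · exact ((intervalIntegrable_iff_integrableOn_Icc_of_le h').1 (h _ _)).mono_set hr
  · rw [Icc_eq_empty (by linarith)] at hr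
    simp [subset_empty_iff.1 hr]

theorem IsAC.locallyIntegrable_deriv (hf : IsAC f f') : LocallyIntegrable f' volume :=
  locallyIntegrable_of_intervalIntegrable hf.intervalIntegrable

/-- This is Lebesgue differentiation; it supplies the representatives of weakly differentiable
functions. -/
theorem IsAC.of_integral (hg : LocallyIntegrable g volume) (c : ℝ) :
    IsAC (fun x => c + ∫ y in (0 : ℝ)..x, g y) g := by
  have hi : ∀ a b, IntervalIntegrable g volume a b := fun a b =>
    (hg.integrableOn_isCompact isCompact_uIcc).intervalIntegrable
  constructor
  · intro a b
    have h0 : AbsolutelyContinuousOnInterval (fun x => ∫ y in (0 : ℝ)..x, g y)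
        (min a 0 ⊓ b) (max a 0 ⊔ b) := by
      refine (hi _ _).absolutelyContinuousOnInterval_intervalIntegral ?_
      rw [uIcc_of_le (by simp)]
      constructor <;> simp
    have h1 := h0.mono (c := a) (d := b) (by
      rw [uIcc_of_le (by simp : (min a 0 ⊓ b) ≤ (max a 0 ⊔ b))]
      intro x hx
      rw [uIcc, mem_Icc] at hx
      constructor
      · exact le_trans (inf_le_inf_right _ (min_le_left _ _)) hx.1
      · exact le_trans hx.2 (sup_le_sup_right (le_max_left _ _) _))
    have h2 : AbsolutelyContinuousOnInterval (fun _ : ℝ => c) a b :=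
      contDiffOn_const.absolutelyContinuousOnInterval
    exact h2.fun_add h1
  · filter_upwards [_root_.LocallyIntegrable.ae_hasDerivAt_integral hg] with x hx
    exact (hx 0).const_add c

/-- Integrability of the derivative gives limits at both ends, and integrability of the function
forces these limits to be zero. Every integration by parts below is done in this form: an exact
derivative is exhibited and discarded. -/
theorem IsAC.integral_eq_zero (hf : IsAC f f') (hi : Integrable f volume)
    (hi' : Integrable f' volume) : ∫ x, f' x = 0 := by
  have h1 : Filter.Tendsto (fun x => f x - f 0) Filter.atTop (nhds (∫ x in Ioi (0 : ℝ), f' x)) := by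
    refine (intervalIntegral_tendsto_integral_Ioi 0 hi'.integrableOn Filter.tendsto_id).congr ?_
    intro x; rw [hf.integral_eq]; rfl
  have h2 : Filter.Tendsto (fun x => f 0 - f x) Filter.atBot (nhds (∫ x in Iic (0 : ℝ), f' x)) := by
    refine (intervalIntegral_tendsto_integral_Iic 0 hi'.integrableOn Filter.tendsto_id).congr ?_
    intro x; rw [hf.integral_eq]; rfl
  have e1 : f 0 + ∫ x in Ioi (0 : ℝ), f' x = 0 := by
    refine IntegrableAtFilter.eq_zero_of_tendsto (l := Filter.atTop) (f := f) (μ := volume)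
      ⟨univ, Filter.univ_mem, hi.integrableOn⟩ ?_ ?_
    · intro s hs
      obtain ⟨b, hb⟩ := Filter.mem_atTop_sets.1 hs
      exact measure_mono_top (fun x hx => hb x hx) (Real.volume_Ici (a := b))
    · simpa using h1.const_add (f 0)
  have e2 : f 0 - ∫ x in Iic (0 : ℝ), f' x = 0 := by
    refine IntegrableAtFilter.eq_zero_of_tendsto (l := Filter.atBot) (f := f) (μ := volume)
      ⟨univ, Filter.univ_mem, hi.integrableOn⟩ ?_ ?_
    · intro s hs
      obtain ⟨b, hb⟩ := Filter.mem_atBot_sets.1 hs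
      exact measure_mono_top (fun x hx => hb x hx) (Real.volume_Iic (a := b))
    · simpa using h2.const_sub (f 0)
  rw [← intervalIntegral.integral_Iic_add_Ioi hi'.integrableOn (b := 0) hi'.integrableOn]
  linarith

end AbsolutelyContinuous

/-! ### Weak derivatives and absolutely continuous representatives -/

section WeakDerivative

variable {E F : Type*} [NormedAddCommGroup E] [NormedSpace ℝ E] [NormedAddCommGroup F]
  [NormedSpace ℝ F]

theorem HasWeakDeriv.congr {f g f' g' : ℝ → E} (h : HasWeakDeriv f g) (hf : f =ᵐ[volume] f')
    (hg : g =ᵐ[volume] g') : HasWeakDeriv f' g' := by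
  refine ⟨h.1.congr hf, h.2.1.congr hg, fun φ h1 h2 => ?_⟩
  rw [← integral_congr_ae (f := fun x => deriv φ x • f x), h.2.2 φ h1 h2,
    integral_congr_ae (f := fun x => φ x • g x)]
  · filter_upwards [hg] with x hx using by simp only [hx]
  · filter_upwards [hf] with x hx using by simp only [hx]

theorem HasWeakDeriv.ae_unique [CompleteSpace E] {f g g' : ℝ → E} (h : HasWeakDeriv f g)
    (h' : HasWeakDeriv f g') : g =ᵐ[volume] g' := by
  refine ae_eq_of_integral_contDiff_smul_eq h.2.1 h'.2.1 fun φ h1 h2 => ?_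
  have := (h.2.2 φ h1 h2).symm.trans (h'.2.2 φ h1 h2)
  exact neg_injective this

theorem HasWeakDeriv.weakDeriv_ae [CompleteSpace E] {f g : ℝ → E} (h : HasWeakDeriv f g) :
    weakDeriv f =ᵐ[volume] g := by
  have hex : ∃ g, HasWeakDeriv f g := ⟨g, h⟩
  rw [weakDeriv, dif_pos hex]
  exact hex.choose_spec.ae_unique h

theorem HasWeakDeriv.integrable_deriv_smul {f : ℝ → E} (h : LocallyIntegrable f volume)
    {φ : ℝ → ℝ} (h1 : ContDiff ℝ ∞ φ) (h2 : HasCompactSupport φ) :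
    Integrable (fun x => deriv φ x • f x) volume :=
  h.integrable_smul_left_of_hasCompactSupport
    (h1.continuous_deriv (by simp)) h2.deriv

theorem HasWeakDeriv.add {f g f' g' : ℝ → E} (h : HasWeakDeriv f g) (h' : HasWeakDeriv f' g') :
    HasWeakDeriv (fun x => f x + f' x) (fun x => g x + g' x) := by
  refine ⟨h.1.add h'.1, h.2.1.add h'.2.1, fun φ h1 h2 => ?_⟩
  simp only [smul_add]
  rw [integral_add (integrable_deriv_smul h.1 h1 h2) (integrable_deriv_smul h'.1 h1 h2),
    integral_add (h.2.1.integrable_smul_left_of_hasCompactSupport h1.continuous h2)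
      (h'.2.1.integrable_smul_left_of_hasCompactSupport h1.continuous h2), h.2.2 φ h1 h2,
    h'.2.2 φ h1 h2, neg_add]

theorem locallyIntegrable_clm (L : E →L[ℝ] F) {f : ℝ → E} (h : LocallyIntegrable f volume) :
    LocallyIntegrable (fun x => L (f x)) volume := by
  rw [locallyIntegrable_iff] at h ⊢
  exact fun k hk => L.integrable_comp (h k hk)

theorem HasWeakDeriv.clm [CompleteSpace E] [CompleteSpace F] (L : E →L[ℝ] F) {f g : ℝ → E}
    (h : HasWeakDeriv f g) : HasWeakDeriv (fun x => L (f x)) (fun x => L (g x)) := by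
  refine ⟨locallyIntegrable_clm L h.1, locallyIntegrable_clm L h.2.1, fun φ h1 h2 => ?_⟩
  simp only [← map_smul]
  rw [L.integral_comp_comm (integrable_deriv_smul h.1 h1 h2),
    L.integral_comp_comm (h.2.1.integrable_smul_left_of_hasCompactSupport h1.continuous h2),
    h.2.2 φ h1 h2, map_neg]

theorem IsAC.hasWeakDeriv {f f' : ℝ → ℝ} (h : IsAC f f') : HasWeakDeriv f f' := by
  refine ⟨h.continuous.locallyIntegrable, h.locallyIntegrable_deriv, fun φ h1 h2 => ?_⟩
  have hφ : IsAC φ (deriv φ) := .of_hasDerivAt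
    (fun x => (h1.differentiable (by simp) x).hasDerivAt) (h1.continuous_deriv (by simp))
  have i1 : Integrable (fun x => deriv φ x * f x) volume :=
    HasWeakDeriv.integrable_deriv_smul h.continuous.locallyIntegrable h1 h2
  have i2 : Integrable (fun x => φ x * f' x) volume :=
    h.locallyIntegrable_deriv.integrable_smul_left_of_hasCompactSupport h1.continuous h2
  have i0 : Integrable (fun x => φ x * f x) volume :=
    h.continuous.locallyIntegrable.integrable_smul_left_of_hasCompactSupport h1.continuous h2
  have := (hφ.mul h).integral_eq_zero i0 (i1.add i2)
  rw [integral_add i1 i2] at this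
  simp only [smul_eq_mul]
  linarith

/-- A compactly supported smooth function of mean zero is the derivative of one. -/
theorem exists_antideriv_of_integral_eq_zero {φ : ℝ → ℝ} (h1 : ContDiff ℝ ∞ φ)
    (h2 : HasCompactSupport φ) (h0 : ∫ x, φ x = 0) :
    ∃ Φ : ℝ → ℝ, ContDiff ℝ ∞ Φ ∧ HasCompactSupport Φ ∧ deriv Φ = φ := by
  obtain ⟨r', hr'⟩ := h2.isCompact.isBounded.subset_closedBall 0
  rw [Real.closedBall_eq_Icc, zero_sub, zero_add] at hr'
  -- Enlarging the radius by one places the support strictly inside the open interval.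
  obtain ⟨r, rfl⟩ : ∃ r, r' = r - 1 := ⟨r' + 1, by ring⟩
  have hz : ∀ x, x ∉ Ioo (-r) r → φ x = 0 := fun x hx => by
    by_contra h
    have := hr' (subset_tsupport _ h)
    exact hx ⟨by linarith [this.1], by linarith [this.2]⟩
  have hd : ∀ x, HasDerivAt (fun x => ∫ y in (-r)..x, φ y) (φ x) x := fun x =>
    intervalIntegral.integral_hasDerivAt_right (h1.continuous.intervalIntegrable _ _)
      h1.continuous.stronglyMeasurable.stronglyMeasurableAtFilter h1.continuous.continuousAt
  have hd' : deriv (fun x => ∫ y in (-r)..x, φ y) = φ := funext fun x => (hd x).deriv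
  refine ⟨fun x => ∫ y in (-r)..x, φ y, ?_, ?_, hd'⟩
  · rw [contDiff_infty_iff_deriv, hd']
    exact ⟨fun x => (hd x).differentiableAt, h1⟩
  · refine HasCompactSupport.intro (K := Icc (-r) r) isCompact_Icc fun x hx => ?_
    rcases lt_or_ge x (-r) with h | h
    · refine intervalIntegral.integral_zero_ae (.of_forall fun y hy => hz y fun hy' => ?_)
      rw [uIoc_of_ge h.le] at hy
      linarith [hy.2, hy'.1]
    · have hx' : r < x := by
        by_contra h'
        exact hx ⟨h, not_lt.1 h'⟩
      rw [intervalIntegral.integral_eq_integral_of_support_subset, h0]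
      intro y hy
      by_contra h'
      exact hy (hz y fun hy' => h' ⟨hy'.1, by linarith [hy'.2]⟩)

/-- A function with vanishing weak derivative is almost everywhere constant. -/
theorem HasWeakDeriv.ae_const {f : ℝ → ℝ} (h : HasWeakDeriv f (fun _ => 0)) :
    ∃ c : ℝ, f =ᵐ[volume] fun _ => c := by
  obtain ⟨φ₀, s1, s2, s3⟩ : ∃ φ₀ : ℝ → ℝ, ContDiff ℝ ∞ φ₀ ∧ HasCompactSupport φ₀ ∧
      ∫ x, φ₀ x = 1 := by
    let b : ContDiffBump (0 : ℝ) := ⟨1, 2, by norm_num, by norm_num⟩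
    exact ⟨b.normed volume, b.contDiff_normed, b.hasCompactSupport_normed, b.integral_normed⟩
  refine ⟨∫ x, φ₀ x * f x, ae_eq_of_integral_contDiff_smul_eq h.1
    (continuous_const.locallyIntegrable) fun φ h1 h2 => ?_⟩
  have iφ : Integrable φ volume := h1.continuous.integrable_of_hasCompactSupport h2
  have iφ₀ : Integrable φ₀ volume := s1.continuous.integrable_of_hasCompactSupport s2
  have i1 : Integrable (fun x => φ x * f x) volume :=
    h.1.integrable_smul_left_of_hasCompactSupport h1.continuous h2
  have i2 : Integrable (fun x => φ₀ x * f x) volume :=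
    h.1.integrable_smul_left_of_hasCompactSupport s1.continuous s2
  -- Subtracting a multiple of the unit-mass bump gives any test function mean zero, so it becomes a
  -- derivative to which the hypothesis applies; the constant is the mean of f against the bump.
  obtain ⟨Φ, a1, a2, a3⟩ := exists_antideriv_of_integral_eq_zero
    (φ := fun x => φ x - (∫ y, φ y) * φ₀ x) (h1.sub (contDiff_const.mul s1))
    (h2.sub (s2.mul_left)) (by
      rw [integral_sub iφ (iφ₀.const_mul _), integral_const_mul, s3]; ring)
  have := h.2.2 Φ a1 a2
  simp only [a3, smul_eq_mul, mul_zero, integral_zero, neg_zero, sub_mul, mul_assoc] at this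
  rw [integral_sub i1 (i2.const_mul _), integral_const_mul] at this
  simp only [smul_eq_mul]
  rw [integral_mul_const]
  linarith

/-- A weakly differentiable real function has an absolutely continuous representative. -/
theorem HasWeakDeriv.exists_isAC {f g : ℝ → ℝ} (h : HasWeakDeriv f g) :
    ∃ F : ℝ → ℝ, f =ᵐ[volume] F ∧ IsAC F g := by
  have h0 := IsAC.of_integral h.2.1 0
  have h1 := h.add (h0.neg.hasWeakDeriv)
  simp only [add_neg_cancel] at h1
  obtain ⟨c, hc⟩ := h1.ae_const
  refine ⟨_, ?_, IsAC.of_integral h.2.1 c⟩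
  filter_upwards [hc] with x hx
  linarith

end WeakDerivative

/-! ### The soliton profile and the decay of 1 − u₀² -/

section Soliton

/-- The exponentially decaying weight `1 - u₀²`. -/
noncomputable def wt (x : ℝ) : ℝ := 1 - u₀ x ^ 2

theorem wt_eq (x : ℝ) : wt x = (Real.cosh (x / √2) ^ 2)⁻¹ := by
  have hc := Real.cosh_pos (x / √2)
  rw [wt, u₀, Real.tanh_eq_sinh_div_cosh]
  have := Real.cosh_sq (x / √2)
  field_simp
  linarith

theorem wt_pos (x : ℝ) : 0 < wt x := by
  rw [wt_eq]; have := Real.cosh_pos (x / √2); positivity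

theorem u₀_sq (x : ℝ) : u₀ x ^ 2 = 1 - wt x := by rw [wt]; ring

theorem u₀_sq_le (x : ℝ) : u₀ x ^ 2 ≤ 1 := by linarith [u₀_sq x, wt_pos x]

theorem wt_le_one (x : ℝ) : wt x ≤ 1 := by rw [wt]; linarith [sq_nonneg (u₀ x)]

theorem abs_u₀_le (x : ℝ) : |u₀ x| ≤ 1 := by
  rw [← sq_le_one_iff_abs_le_one]; exact u₀_sq_le x

theorem hasDerivAt_u₀ (x : ℝ) : HasDerivAt u₀ (wt x / √2) x := by
  have hc := Real.cosh_pos (x / √2)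
  have h1 : HasDerivAt (fun x : ℝ => x / √2) (1 / √2) x := (hasDerivAt_id x).div_const _
  have h2 := h1.sinh.fun_div h1.cosh hc.ne'
  have h3 : u₀ = fun x => Real.sinh (x / √2) / Real.cosh (x / √2) := by
    ext y; simp [u₀, Real.tanh_eq_sinh_div_cosh]
  rw [h3]
  refine h2.congr_deriv ?_
  rw [wt_eq]
  have := Real.cosh_sq (x / √2)
  field_simp
  linarith

theorem continuous_u₀ : Continuous u₀ :=
  continuous_iff_continuousAt.2 fun x => (hasDerivAt_u₀ x).continuousAt

theorem continuous_wt : Continuous wt := continuous_const.sub (continuous_u₀.pow 2)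

theorem deriv_u₀ : deriv u₀ = fun x => wt x / √2 := funext fun x => (hasDerivAt_u₀ x).deriv

theorem sqrt_two_sq : √(2 : ℝ) ^ 2 = 2 := Real.sq_sqrt (by norm_num)

theorem sqrt_two_pos : 0 < √(2 : ℝ) := by positivity

theorem wt_div_sqrt_two (x : ℝ) : wt x / √2 = √2 / 2 * wt x := by
  have := sqrt_two_sq
  have := sqrt_two_pos
  field_simp
  rw [sqrt_two_sq]

theorem hasDerivAt_u₀' (x : ℝ) : HasDerivAt u₀ (√2 / 2 * wt x) x :=
  wt_div_sqrt_two x ▸ hasDerivAt_u₀ x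

theorem isAC_u₀ : IsAC u₀ (fun x => √2 / 2 * wt x) :=
  .of_hasDerivAt hasDerivAt_u₀' (continuous_const.mul continuous_wt)

theorem hasDerivAt_wt (x : ℝ) : HasDerivAt wt (-(√2 * u₀ x * wt x)) x := by
  have := ((hasDerivAt_u₀' x).pow 2).const_sub 1
  refine (this.congr_deriv ?_)
  simp; ring

theorem isAC_wt : IsAC wt (fun x => -(√2 * u₀ x * wt x)) :=
  .of_hasDerivAt hasDerivAt_wt (((continuous_const.mul continuous_u₀).mul continuous_wt).neg)

theorem deriv_deriv_u₀ : deriv (deriv u₀) = fun x => -(wt x * u₀ x) := by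
  ext x
  rw [deriv_u₀]
  refine ((hasDerivAt_wt x).div_const √2).deriv.trans ?_
  have := sqrt_two_pos
  field_simp

/-- Exponential decay beats any polynomial: `wt` is at most 4 exp(−|x|), and (1 + |x|)^16 is at most
16! exp(1 + |x|). The power eight suffices for all the algebraic weights used later. -/
theorem exists_wt_mul_le : ∃ C : ℝ, 0 < C ∧ ∀ x, wt x * (1 + x ^ 2) ^ 8 ≤ C := by
  refine ⟨4 * ((16).factorial * Real.exp 1), by positivity, fun x => ?_⟩
  have h1 : wt x ≤ 4 * Real.exp (-|x|) := by
    rw [wt_eq, inv_le_comm₀ (by have := Real.cosh_pos (x / √2); positivity) (by positivity)]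
    have h : Real.exp (|x| / 2) / 2 ≤ Real.cosh (x / √2) := by
      rw [← Real.cosh_abs, Real.cosh_eq]
      have : |x| / 2 ≤ |x / √2| := by
        rw [abs_div, abs_of_pos sqrt_two_pos]
        refine div_le_div_of_nonneg_left (abs_nonneg _) sqrt_two_pos ?_
        nlinarith [sqrt_two_sq, sqrt_two_pos]
      have := Real.exp_le_exp.2 this
      have := Real.exp_pos (-|x / √2|)
      linarith
    have h' : Real.exp |x| = Real.exp (|x| / 2) ^ 2 := by
      rw [← Real.exp_nat_mul]; congr 1; push_cast; ring
    rw [mul_inv, ← Real.exp_neg, neg_neg, h']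
    have := Real.exp_pos (|x| / 2)
    nlinarith
  have h2 : (1 + x ^ 2) ^ 8 ≤ (16).factorial * Real.exp (1 + |x|) := by
    have h := Real.pow_div_factorial_le_exp (1 + |x|) (by positivity) 16
    rw [div_le_iff₀ (by positivity)] at h
    have h' : (1 + x ^ 2) ≤ (1 + |x|) ^ 2 := by nlinarith [sq_abs x, abs_nonneg x]
    calc (1 + x ^ 2) ^ 8 ≤ ((1 + |x|) ^ 2) ^ 8 := by gcongr
      _ = (1 + |x|) ^ 16 := by ring
      _ ≤ _ := by linarith
  calc wt x * (1 + x ^ 2) ^ 8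
      ≤ (4 * Real.exp (-|x|)) * ((16).factorial * Real.exp (1 + |x|)) := by
        gcongr
    _ = _ := by
        rw [show 1 = 1 + |x| + -|x| by ring]
        simp only [Real.exp_add]
        rw [Real.exp_neg]
        have := Real.exp_pos |x|
        field_simp

theorem wt_anti {x y : ℝ} (h : |y| ≤ |x|) : wt x ≤ wt y := by
  rw [wt_eq, wt_eq]
  have := Real.cosh_pos (y / √2)
  refine inv_anti₀ (by positivity) ?_
  gcongr
  rw [Real.cosh_le_cosh, abs_div, abs_div]
  gcongr

theorem u₀_mul_nonneg (x : ℝ) : 0 ≤ x * u₀ x := by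
  rw [u₀]
  rcases le_total 0 x with h | h
  · refine mul_nonneg h ?_
    rw [Real.tanh_eq_sinh_div_cosh]
    exact div_nonneg (Real.sinh_nonneg_iff.2 (by positivity)) (Real.cosh_pos _).le
  · refine mul_nonneg_of_nonpos_of_nonpos h ?_
    rw [Real.tanh_eq_sinh_div_cosh]
    exact div_nonpos_of_nonpos_of_nonneg (Real.sinh_nonpos_iff.2
      (div_nonpos_of_nonpos_of_nonneg h sqrt_two_pos.le)) (Real.cosh_pos _).le

end Soliton

/-! ### Translation of the statement to regular representatives -/

section Representatives

theorem HasWeakDeriv.complex {f f' g g' : ℝ → ℝ} (hf : HasWeakDeriv f f')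
    (hg : HasWeakDeriv g g') :
    HasWeakDeriv (fun x => (f x : ℂ) + Complex.I * (g x : ℂ))
      (fun x => (f' x : ℂ) + Complex.I * (g' x : ℂ)) :=
  (hf.clm Complex.ofRealCLM).add (hg.clm (Complex.I • Complex.ofRealCLM))

/-- `a` and `b` are representatives of `u` and `v` that are continuously differentiable with
absolutely continuous derivatives. -/
structure IsRep (u v a da dda b db ddb : ℝ → ℝ) : Prop where
  u_ae : u =ᵐ[volume] a
  v_ae : v =ᵐ[volume] b
  a_ac : IsAC a da
  da_ac : IsAC da dda
  b_ac : IsAC b db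
  db_ac : IsAC db ddb

theorem HasWeakDeriv.exists_isAC₂ {f g h : ℝ → ℝ} (hf : HasWeakDeriv f g) (hg : HasWeakDeriv g h) :
    ∃ F G : ℝ → ℝ, f =ᵐ[volume] F ∧ IsAC F G ∧ IsAC G h := by
  obtain ⟨F, h1, h2⟩ := hf.exists_isAC
  obtain ⟨G, h3, h4⟩ := hg.exists_isAC
  exact ⟨F, G, h1, h2.congr_deriv h3, h4⟩

theorem isAC_u₀' : IsAC (fun x => √2 / 2 * wt x) (fun x => -(wt x * u₀ x)) := by
  refine (isAC_wt.const_mul (√2 / 2)).congr (fun x => rfl) fun x => ?_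
  linear_combination (-1 / 2 * u₀ x * wt x) * sqrt_two_sq

theorem perturbed_eq (u v : ℝ → ℝ) :
    perturbed u v = fun x => ((u₀ x + u x : ℝ) : ℂ) + Complex.I * (v x : ℂ) := by
  ext x; simp [perturbed]

theorem normSq_aux (a b : ℝ) : ‖(a : ℂ) + Complex.I * (b : ℂ)‖ ^ 2 = a ^ 2 + b ^ 2 := by
  rw [← Complex.normSq_eq_norm_sq, Complex.normSq_apply]
  simp; ring

theorem re_star_mul_aux (a b c d : ℝ) :
    (star ((a : ℂ) + Complex.I * (b : ℂ)) * ((c : ℂ) + Complex.I * (d : ℂ))).re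
      = a * c + b * d := by
  simp

theorem norm_sq_perturbed (u v : ℝ → ℝ) (x : ℝ) :
    ‖perturbed u v x‖ ^ 2 = (u₀ x + u x) ^ 2 + v x ^ 2 := by
  rw [perturbed_eq, normSq_aux]

theorem norm_sq_solitonC (x : ℝ) : ‖solitonC x‖ ^ 2 = u₀ x ^ 2 := by
  rw [solitonC, Complex.norm_real, Real.norm_eq_abs, sq_abs]

theorem eta_eq (u v : ℝ → ℝ) (x : ℝ) :
    eta u v x = 2 * u₀ x * u x + (u x ^ 2 + v x ^ 2) := by
  rw [eta, norm_sq_perturbed]; ring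

/-- The functions u and v are the real and imaginary parts of ψ − u₀, and in one dimension two weak
derivatives already give a continuously differentiable representative with absolutely continuous
derivative. -/
theorem MemH2loc.exists_isRep {u v : ℝ → ℝ} (h : MemH2loc (perturbed u v)) :
    ∃ a da dda b db ddb, IsRep u v a da dda b db ddb := by
  obtain ⟨ψ₁, ψ₂, h1, h2, -⟩ := h
  have r1 := (h1.clm Complex.reCLM).add isAC_u₀.neg.hasWeakDeriv
  have r2 := (h2.clm Complex.reCLM).add isAC_u₀'.neg.hasWeakDeriv
  obtain ⟨a, da, e1, e2, e3⟩ := r1.exists_isAC₂ r2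
  obtain ⟨b, db, f1, f2, f3⟩ := (h1.clm Complex.imCLM).exists_isAC₂ (h2.clm Complex.imCLM)
  refine ⟨a, da, _, b, db, _, ?_, ?_, e2, e3, f2, f3⟩
  · refine .trans (.of_forall fun x => ?_) e1
    simp [perturbed]
  · refine .trans (.of_forall fun x => ?_) f1
    simp [perturbed]

variable {u v a da dda b db ddb : ℝ → ℝ}

theorem IsRep.weakDeriv_u (h : IsRep u v a da dda b db ddb) : weakDeriv u =ᵐ[volume] da :=
  (h.a_ac.hasWeakDeriv.congr h.u_ae.symm (by rfl)).weakDeriv_ae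

theorem IsRep.weakDeriv_v (h : IsRep u v a da dda b db ddb) : weakDeriv v =ᵐ[volume] db :=
  (h.b_ac.hasWeakDeriv.congr h.v_ae.symm (by rfl)).weakDeriv_ae

theorem IsRep.weakDeriv_weakDeriv_u (h : IsRep u v a da dda b db ddb) :
    weakDeriv (weakDeriv u) =ᵐ[volume] dda :=
  (h.da_ac.hasWeakDeriv.congr h.weakDeriv_u.symm (by rfl)).weakDeriv_ae

theorem IsRep.weakDeriv_weakDeriv_v (h : IsRep u v a da dda b db ddb) :
    weakDeriv (weakDeriv v) =ᵐ[volume] ddb :=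
  (h.db_ac.hasWeakDeriv.congr h.weakDeriv_v.symm (by rfl)).weakDeriv_ae

/-- The derivative of `eta a b`. -/
noncomputable def deta (a da b db : ℝ → ℝ) (x : ℝ) : ℝ :=
  √2 * wt x * a x + 2 * u₀ x * da x + 2 * (a x * da x + b x * db x)

theorem isAC_eta (ha : IsAC a da) (hb : IsAC b db) : IsAC (eta a b) (deta a da b db) := by
  refine (((isAC_u₀.mul ha).const_mul 2).add ((ha.mul ha).add (hb.mul hb))).congr
    (fun x => ?_) (fun x => ?_)
  · rw [eta_eq]; ring
  · rw [deta]; ring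

theorem IsRep.eta_ae (h : IsRep u v a da dda b db ddb) : eta u v =ᵐ[volume] eta a b := by
  filter_upwards [h.u_ae, h.v_ae] with x h1 h2
  rw [eta_eq, eta_eq, h1, h2]

theorem IsRep.weakDeriv_eta (h : IsRep u v a da dda b db ddb) :
    weakDeriv (eta u v) =ᵐ[volume] deta a da b db :=
  ((isAC_eta h.a_ac h.b_ac).hasWeakDeriv.congr h.eta_ae.symm (by rfl)).weakDeriv_ae

theorem IsRep.eRhoSq_eq (h : IsRep u v a da dda b db ddb) (R : ℝ) :
    eRhoSq R u v =
      (∫⁻ x, ENNReal.ofReal (dda x ^ 2 + ddb x ^ 2 + da x ^ 2 + db x ^ 2))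
      + (∫⁻ x in {x : ℝ | |x| ≤ R}, ENNReal.ofReal (a x ^ 2 + (R ^ 2)⁻¹ * b x ^ 2))
      + ∫⁻ x in {x : ℝ | R ≤ |x|}, ENNReal.ofReal (deta a da b db x ^ 2 + eta a b x ^ 2) := by
  rw [eRhoSq]
  congr 1
  · congr 1
    · refine lintegral_congr_ae ?_
      filter_upwards [h.weakDeriv_u, h.weakDeriv_v, h.weakDeriv_weakDeriv_u,
        h.weakDeriv_weakDeriv_v] with x h1 h2 h3 h4
      rw [h1, h2, h3, h4]
    · refine lintegral_congr_ae (ae_restrict_of_ae ?_)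
      filter_upwards [h.u_ae, h.v_ae] with x h1 h2
      rw [h1, h2]
  · refine lintegral_congr_ae (ae_restrict_of_ae ?_)
    filter_upwards [h.eta_ae, h.weakDeriv_eta] with x h1 h2
    rw [h1, h2]

theorem IsRep.hasWeakDeriv_perturbed (h : IsRep u v a da dda b db ddb) :
    HasWeakDeriv (perturbed u v)
      (fun x => ((√2 / 2 * wt x + da x : ℝ) : ℂ) + Complex.I * (db x : ℂ)) := by
  rw [perturbed_eq]
  refine (HasWeakDeriv.complex (isAC_u₀.add h.a_ac).hasWeakDeriv h.b_ac.hasWeakDeriv).congr ?_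
    (by rfl)
  filter_upwards [h.u_ae, h.v_ae] with x h1 h2
  rw [h1, h2]

theorem IsRep.weakDeriv_weakDeriv_perturbed (h : IsRep u v a da dda b db ddb) :
    weakDeriv (weakDeriv (perturbed u v)) =ᵐ[volume]
      (fun x => ((-(wt x * u₀ x) + dda x : ℝ) : ℂ) + Complex.I * (ddb x : ℂ)) :=
  ((HasWeakDeriv.complex (isAC_u₀'.add h.da_ac).hasWeakDeriv h.db_ac.hasWeakDeriv).congr
    h.hasWeakDeriv_perturbed.weakDeriv_ae.symm (by rfl)).weakDeriv_ae

/-- The energy density of the perturbation `(a, b)` of the soliton. -/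
noncomputable def energyExpr (a da b db : ℝ → ℝ) (x : ℝ) : ℝ :=
  (√2 / 2 * wt x + da x) ^ 2 + db x ^ 2 + 1 / 2 * (wt x - eta a b x) ^ 2

/-- The density of the higher-order functional at the perturbation `(a, b)` of the soliton. -/
noncomputable def higherExpr (a da dda b db ddb : ℝ → ℝ) (x : ℝ) : ℝ :=
    (-(wt x * u₀ x) + dda x) ^ 2 + ddb x ^ 2
      + 3 * (u₀ x ^ 2 + eta a b x) * ((√2 / 2 * wt x + da x) ^ 2 + db x ^ 2)
      + 1 / 2 * (√2 * u₀ x * wt x + deta a da b db x) ^ 2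
      + (wt x - eta a b x) ^ 2 * (1 + 1 / 2 * (u₀ x ^ 2 + eta a b x))

theorem IsRep.energyDensity_ae (h : IsRep u v a da dda b db ddb) :
    energyDensity (perturbed u v) =ᵐ[volume] energyExpr a da b db := by
  filter_upwards [h.u_ae, h.v_ae, h.hasWeakDeriv_perturbed.weakDeriv_ae] with x h1 h2 h3
  rw [energyDensity, energyExpr, h3, normSq_aux, norm_sq_perturbed, h1, h2, eta_eq, wt]
  ring

theorem IsRep.higherDensity_ae (h : IsRep u v a da dda b db ddb) :
    higherDensity (perturbed u v) =ᵐ[volume] higherExpr a da dda b db ddb := by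
  filter_upwards [h.u_ae, h.v_ae, h.hasWeakDeriv_perturbed.weakDeriv_ae,
    h.weakDeriv_weakDeriv_perturbed] with x h1 h2 h3 h4
  have hp : perturbed u v x = ((u₀ x + a x : ℝ) : ℂ) + Complex.I * (b x : ℂ) := by
    simp only [perturbed_eq, h1, h2]
  rw [higherDensity, higherExpr, h4, h3, hp, normSq_aux, normSq_aux, normSq_aux, re_star_mul_aux,
    eta_eq, deta, wt]
  ring

theorem isRep_zero : IsRep (fun _ => 0) (fun _ => 0) (fun _ => 0) (fun _ => 0) (fun _ => 0)
    (fun _ => 0) (fun _ => 0) (fun _ => 0) := by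
  have : IsAC (fun _ => 0) (fun _ => 0) :=
    .of_hasDerivAt (fun x => hasDerivAt_const x 0) continuous_const
  exact ⟨by rfl, by rfl, this, this, this, this⟩

theorem perturbed_zero : perturbed (fun _ => 0) (fun _ => 0) = solitonC := by
  ext x; simp [perturbed, solitonC]

theorem eLpNorm_complex_sq {μ : Measure ℝ} {f g : ℝ → ℝ} (hf : AEStronglyMeasurable f μ)
    (hg : AEStronglyMeasurable g μ)
    (h : eLpNorm (fun x => (f x : ℂ) + Complex.I * (g x : ℂ)) 2 μ < ⊤) :
    MemLp f 2 μ ∧ MemLp g 2 μ ∧ eLpNorm (fun x => (f x : ℂ) + Complex.I * (g x : ℂ)) 2 μ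
      = ENNReal.ofReal (√(∫ x, (f x ^ 2 + g x ^ 2) ∂μ)) := by
  have hm : MemLp (fun x => (f x : ℂ) + Complex.I * (g x : ℂ)) 2 μ :=
    ⟨(Complex.continuous_ofReal.comp_aestronglyMeasurable hf).add
      ((Complex.continuous_ofReal.comp_aestronglyMeasurable hg).const_mul _), h⟩
  refine ⟨?_, ?_, ?_⟩
  · refine hm.mono hf (.of_forall fun x => ?_)
    have := Complex.abs_re_le_norm ((f x : ℂ) + Complex.I * (g x : ℂ))
    simpa using this
  · refine hm.mono hg (.of_forall fun x => ?_)
    have := Complex.abs_im_le_norm ((f x : ℂ) + Complex.I * (g x : ℂ))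
    simpa using this
  · rw [hm.eLpNorm_eq_integral_rpow_norm (by simp) (by simp)]
    simp only [ENNReal.toReal_ofNat, Real.rpow_ofNat, normSq_aux]
    rw [Real.sqrt_eq_rpow]; norm_num

theorem eLpNorm_real {μ : Measure ℝ} {f : ℝ → ℝ} (hm : MemLp f 2 μ) :
    eLpNorm f 2 μ = ENNReal.ofReal (√(∫ x, f x ^ 2 ∂μ)) := by
  rw [hm.eLpNorm_eq_integral_rpow_norm (by simp) (by simp)]
  simp only [ENNReal.toReal_ofNat, Real.rpow_ofNat, Real.norm_eq_abs, sq_abs]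
  rw [Real.sqrt_eq_rpow]; norm_num

/-- A finite sum in [0, ∞] has finite terms, so each norm in the distance is a genuine L² norm and
may be written as the square root of a real integral. -/
theorem IsRep.of_eDist_lt_top (h : IsRep u v a da dda b db ddb) {R : ℝ}
    (hd : eDist R (perturbed u v) solitonC < ⊤) :
    MemLp da 2 ∧ MemLp dda 2 ∧ MemLp db 2 ∧ MemLp ddb 2 ∧ MemLp (eta a b) 2 ∧
    eDist R (perturbed u v) solitonC = ENNReal.ofReal
      (√((∫ x, (da x ^ 2 + db x ^ 2)) + ∫ x, (dda x ^ 2 + ddb x ^ 2))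
        + √(∫ x, eta a b x ^ 2) + √(∫ x in Ioo (-R) R, (a x ^ 2 + b x ^ 2))) := by
  have e0 : (fun x => perturbed u v x - solitonC x) =ᵐ[volume]
      fun x => (a x : ℂ) + Complex.I * (b x : ℂ) := by
    filter_upwards [h.u_ae, h.v_ae] with x h1 h2
    simp only [perturbed, solitonC, h1, h2]
    ring
  have w1 := ((h.a_ac.hasWeakDeriv.complex h.b_ac.hasWeakDeriv).congr e0.symm
    (by rfl)).weakDeriv_ae
  have w2 := ((h.da_ac.hasWeakDeriv.complex h.db_ac.hasWeakDeriv).congr w1.symm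
    (by rfl)).weakDeriv_ae
  have e3 : (fun x => ‖perturbed u v x‖ ^ 2 - ‖solitonC x‖ ^ 2) =ᵐ[volume] eta a b := by
    filter_upwards [h.eta_ae] with x h1
    rw [← h1, norm_sq_solitonC, eta]
  rw [eDist, eH1Norm, eLpNorm_congr_ae w1, eLpNorm_congr_ae w2, eLpNorm_congr_ae e3,
    eLpNorm_congr_ae (ae_restrict_of_ae e0)] at hd ⊢
  rw [ENNReal.add_lt_top, ENNReal.add_lt_top, ENNReal.rpow_lt_top_iff_of_pos (by norm_num),
    ENNReal.add_lt_top] at hd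
  obtain ⟨⟨⟨d1, d2⟩, d3⟩, d4⟩ := hd
  obtain ⟨m1, m2, q1⟩ := eLpNorm_complex_sq h.da_ac.continuous.aestronglyMeasurable
    h.db_ac.continuous.aestronglyMeasurable (by
      simpa using d1)
  obtain ⟨m3, m4, q2⟩ := eLpNorm_complex_sq h.da_ac.locallyIntegrable_deriv.aestronglyMeasurable
    h.db_ac.locallyIntegrable_deriv.aestronglyMeasurable (by
      simpa using d2)
  have m5 : MemLp (eta a b) 2 volume :=
    ⟨(isAC_eta h.a_ac h.b_ac).continuous.aestronglyMeasurable, d3⟩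
  obtain ⟨-, -, q4⟩ := eLpNorm_complex_sq h.a_ac.continuous.aestronglyMeasurable
    h.b_ac.continuous.aestronglyMeasurable d4
  refine ⟨m1, m3, m2, m4, m5, ?_⟩
  have n1 : 0 ≤ ∫ x, (da x ^ 2 + db x ^ 2) := integral_nonneg fun x => by positivity
  have n2 : 0 ≤ ∫ x, (dda x ^ 2 + ddb x ^ 2) := integral_nonneg fun x => by positivity
  rw [q1, q2, q4, eLpNorm_real m5, ← ENNReal.ofReal_pow (by positivity),
    ← ENNReal.ofReal_pow (by positivity), Real.sq_sqrt n1, Real.sq_sqrt n2,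
    ← ENNReal.ofReal_add n1 n2, ENNReal.ofReal_rpow_of_nonneg (by positivity) (by norm_num),
    ← Real.sqrt_eq_rpow, ← ENNReal.ofReal_add (by positivity) (by positivity),
    ← ENNReal.ofReal_add (by positivity) (by positivity)]

theorem IsRep.orthogonality (h : IsRep u v a da dda b db ddb) (ho : Orthogonality u v) :
    ∫ x, wt x * a x = 0 ∧ ∫ x, wt x * u₀ x * b x = 0 := by
  obtain ⟨h1, h2⟩ := ho
  rw [deriv_deriv_u₀] at h2
  rw [deriv_u₀] at h1
  constructor
  · rw [integral_congr_ae (g := fun x => (√2)⁻¹ * (wt x * a x)) (by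
      filter_upwards [h.u_ae] with x hx; rw [hx]; ring), integral_const_mul] at h1
    simpa using h1
  · rw [integral_congr_ae (g := fun x => - (wt x * u₀ x * b x)) (by
      filter_upwards [h.v_ae] with x hx; rw [hx]; ring), integral_neg] at h2
    simpa using h2

end Representatives

/-! ### Cauchy–Schwarz and elementary L² estimates -/

section SquareIntegrable

/-- The polynomial s ↦ ∫ (f + s g)² is nonnegative, so its discriminant is at most zero. -/
theorem sq_integral_mul_le {μ : Measure ℝ} {f g : ℝ → ℝ} (hf : MemLp f 2 μ) (hg : MemLp g 2 μ) :
    (∫ x, f x * g x ∂μ) ^ 2 ≤ (∫ x, f x ^ 2 ∂μ) * ∫ x, g x ^ 2 ∂μ := by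
  have i1 := hf.integrable_sq
  have i2 := hg.integrable_sq
  have i3 : Integrable (fun x => f x * g x) μ := hf.integrable_mul hg
  have key : ∀ s : ℝ, 0 ≤ (∫ x, g x ^ 2 ∂μ) * (s * s) + (2 * ∫ x, f x * g x ∂μ) * s
      + ∫ x, f x ^ 2 ∂μ := by
    intro s
    have h : ∫ x, (f x + s * g x) ^ 2 ∂μ = (∫ x, g x ^ 2 ∂μ) * (s * s)
        + (2 * ∫ x, f x * g x ∂μ) * s + ∫ x, f x ^ 2 ∂μ := by
      rw [← integral_const_mul, ← integral_mul_const, ← integral_mul_const, ← integral_add,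
        ← integral_add]
      · congr 1; ext x; ring
      · exact (i2.mul_const _).add ((i3.const_mul _).mul_const _)
      · exact i1
      · exact i2.mul_const _
      · exact (i3.const_mul _).mul_const _
    rw [← h]
    exact integral_nonneg fun x => sq_nonneg _
  have := discrim_le_zero key
  rw [discrim] at this
  linarith

theorem MemLp.continuous_mul {c f : ℝ → ℝ} {C : ℝ} (hf : MemLp f 2 volume) (hc : Continuous c)
    (hb : ∀ x, |c x| ≤ C) : MemLp (fun x => c x * f x) 2 volume := by
  refine (hf.const_mul C).mono (hc.aestronglyMeasurable.mul hf.1) (.of_forall fun x => ?_)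
  simp only [Real.norm_eq_abs, abs_mul]
  exact mul_le_mul_of_nonneg_right ((hb x).trans (le_abs_self C)) (abs_nonneg _)

theorem Integrable.continuous_mul {c f : ℝ → ℝ} {C : ℝ} (hf : Integrable f volume)
    (hc : Continuous c) (hb : ∀ x, |c x| ≤ C) : Integrable (fun x => c x * f x) volume :=
  hf.bdd_mul hc.aestronglyMeasurable (.of_forall hb)

theorem IsAC.sq_sub_le {f f' : ℝ → ℝ} (hf : IsAC f f') (hf' : MemLp f' 2 volume) (x y : ℝ) :
    (f x - f y) ^ 2 ≤ |x - y| * ∫ z, f' z ^ 2 := by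
  wlog hxy : y ≤ x generalizing x y
  · rw [← neg_sq, neg_sub, abs_sub_comm]
    exact this y x (le_of_not_ge hxy)
  have h1 := sq_integral_mul_le (μ := volume.restrict (Ioc y x)) (f := fun _ => (1 : ℝ))
    (memLp_const 1) (hf'.restrict _)
  rw [← hf.integral_eq y x, intervalIntegral.integral_of_le hxy, abs_of_nonneg (by linarith)]
  simp only [one_mul, one_pow, integral_const, smul_eq_mul, mul_one] at h1
  refine h1.trans ?_
  simp only [measureReal_restrict_apply_univ, Real.volume_real_Ioc_of_le hxy]
  refine mul_le_mul_of_nonneg_left ?_ (by linarith)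
  exact setIntegral_le_integral hf'.integrable_sq (.of_forall fun x => sq_nonneg _)

/-- Some value is at most the mean. Together with Hölder continuity from `IsAC.sq_sub_le`, this
turns local L² bounds into pointwise ones. -/
theorem exists_mem_Icc_sq_le {f : ℝ → ℝ} (hf : Continuous f) {a b : ℝ} (hab : a < b) :
    ∃ y ∈ Icc a b, (b - a) * f y ^ 2 ≤ ∫ x in Icc a b, f x ^ 2 := by
  obtain ⟨y, hy, h⟩ := exists_le_setAverage (μ := volume) (s := Icc a b) (f := fun x => f x ^ 2)
    (by simp [hab]) (by simp) ((hf.pow 2).integrableOn_Icc)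
  refine ⟨y, hy, ?_⟩
  rw [setAverage_eq, Real.volume_real_Icc_of_le hab.le, smul_eq_mul, inv_mul_eq_div,
    le_div_iff₀ (by linarith)] at h
  linarith

theorem integrable_wt : Integrable wt volume := by
  obtain ⟨C, hC, h⟩ := exists_wt_mul_le
  refine (integrable_inv_one_add_sq.const_mul C).mono' continuous_wt.aestronglyMeasurable
    (.of_forall fun x => ?_)
  rw [Real.norm_eq_abs, abs_of_pos (wt_pos x), ← div_eq_mul_inv, le_div_iff₀ (by positivity)]
  refine le_trans ?_ (h x)
  gcongr
  · exact (wt_pos x).le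
  · exact le_self_pow₀ (by nlinarith) (by norm_num)

theorem memLp_wt : MemLp wt 2 volume := by
  rw [memLp_two_iff_integrable_sq continuous_wt.aestronglyMeasurable]
  refine integrable_wt.mono' (continuous_wt.pow 2).aestronglyMeasurable (.of_forall fun x => ?_)
  rw [Real.norm_eq_abs, abs_of_nonneg (sq_nonneg _)]
  nlinarith [wt_pos x, wt_le_one x]

theorem abs_wt_le (x : ℝ) : |wt x| ≤ 1 := by
  rw [abs_of_pos (wt_pos x)]; exact wt_le_one x

end SquareIntegrable

/-! ### Small perturbations: uniform bounds and integrability -/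

/-- A perturbation `(u, v)` with derivatives up to order two, at distance at most one from the
soliton in the part of the distance which does not depend on the radius. -/
structure SmallPair (u du ddu v dv ddv : ℝ → ℝ) : Prop where
  u_ac : IsAC u du
  du_ac : IsAC du ddu
  v_ac : IsAC v dv
  dv_ac : IsAC dv ddv
  du_mem : MemLp du 2 volume
  ddu_mem : MemLp ddu 2 volume
  dv_mem : MemLp dv 2 volume
  ddv_mem : MemLp ddv 2 volume
  eta_mem : MemLp (eta u v) 2 volume
  sobolev_le : (∫ x, (du x ^ 2 + dv x ^ 2)) + ∫ x, (ddu x ^ 2 + ddv x ^ 2) ≤ 1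
  eta_le : ∫ x, eta u v x ^ 2 ≤ 1

/-- The integrand of `Λ(ψ) - Λ(u₀)`. -/
noncomputable def lamDensity (u du ddu v dv ddv : ℝ → ℝ) (x : ℝ) : ℝ :=
  ddu x ^ 2 + ddv x ^ 2 + (3 * (u₀ x ^ 2 + eta u v x) - 2) * (du x ^ 2 + dv x ^ 2)
    + wt x * (u x ^ 2 + v x ^ 2) + 1 / 2 * deta u du v dv x ^ 2
    + 1 / 2 * (3 * u₀ x ^ 2 - 2) * eta u v x ^ 2 + 3 * √2 * wt x * eta u v x * du x
    + 1 / 2 * eta u v x ^ 3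

namespace SmallPair

variable {u du ddu v dv ddv : ℝ → ℝ}

theorem integral_du_le (h : SmallPair u du ddu v dv ddv) : ∫ x, du x ^ 2 ≤ 1 := by
  have h1 := h.sobolev_le
  rw [integral_add h.du_mem.integrable_sq h.dv_mem.integrable_sq] at h1
  have h2 : 0 ≤ ∫ x, dv x ^ 2 := integral_nonneg fun x => by positivity
  have h3 : 0 ≤ ∫ x, (ddu x ^ 2 + ddv x ^ 2) := integral_nonneg fun x => by positivity
  linarith

theorem integral_dv_le (h : SmallPair u du ddu v dv ddv) : ∫ x, dv x ^ 2 ≤ 1 := by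
  have h1 := h.sobolev_le
  rw [integral_add h.du_mem.integrable_sq h.dv_mem.integrable_sq] at h1
  have h2 : 0 ≤ ∫ x, du x ^ 2 := integral_nonneg fun x => by positivity
  have h3 : 0 ≤ ∫ x, (ddu x ^ 2 + ddv x ^ 2) := integral_nonneg fun x => by positivity
  linarith

theorem continuous_eta (h : SmallPair u du ddu v dv ddv) : Continuous (eta u v) :=
  (isAC_eta h.u_ac h.v_ac).continuous

/-- Each unit interval contains a point where η² ≤ 1, hence |ψ|² ≤ 2, and u and v vary by at most
one over the interval. The bound involves neither R nor the local L² term of the distance. -/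
theorem bounds (h : SmallPair u du ddu v dv ddv) (x : ℝ) : |u x| ≤ 4 ∧ |v x| ≤ 4 := by
  obtain ⟨y, hy, hle⟩ := exists_mem_Icc_sq_le h.continuous_eta (lt_add_one x)
  have h1 : eta u v y ^ 2 ≤ 1 := by
    have := setIntegral_le_integral h.eta_mem.integrable_sq (s := Icc x (x + 1))
      (.of_forall fun x => sq_nonneg _)
    have := h.eta_le
    linarith
  have h2 : |x - y| ≤ 1 := by rw [abs_le]; constructor <;> linarith [hy.1, hy.2]
  have h3 : (u x - u y) ^ 2 ≤ 1 := (h.u_ac.sq_sub_le h.du_mem x y).trans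
    (mul_le_one₀ h2 (integral_nonneg fun x => by positivity) h.integral_du_le)
  have h4 : (v x - v y) ^ 2 ≤ 1 := (h.v_ac.sq_sub_le h.dv_mem x y).trans
    (mul_le_one₀ h2 (integral_nonneg fun x => by positivity) h.integral_dv_le)
  have h5 : (u₀ y + u y) ^ 2 + v y ^ 2 ≤ 2 := by
    have h6 := eta_eq u v y
    have h7 : eta u v y ≤ 1 := by nlinarith
    nlinarith [u₀_sq_le y]
  have e1 := abs_le_of_sq_le_sq' (show (u x - u y) ^ 2 ≤ 1 ^ 2 by linarith) zero_le_one
  have e2 := abs_le_of_sq_le_sq' (show (v x - v y) ^ 2 ≤ 1 ^ 2 by linarith) zero_le_one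
  have e3 := abs_le.1 (abs_u₀_le y)
  have e4 := abs_le_of_sq_le_sq' (show (u₀ y + u y) ^ 2 ≤ 2 ^ 2 by nlinarith) zero_le_two
  have e5 := abs_le_of_sq_le_sq' (show (v y) ^ 2 ≤ 2 ^ 2 by nlinarith) zero_le_two
  constructor <;> rw [abs_le] <;> constructor <;> linarith [e1.1, e1.2, e2.1, e2.2, e3.1, e3.2,
    e4.1, e4.2, e5.1, e5.2]

theorem abs_eta_le (h : SmallPair u du ddu v dv ddv) (x : ℝ) : |eta u v x| ≤ 40 := by
  obtain ⟨h1, h2⟩ := h.bounds x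
  have h3 := abs_u₀_le x
  rw [eta_eq]
  have e1 : |2 * u₀ x * u x| ≤ 8 := by
    rw [abs_mul, abs_mul, abs_two]
    nlinarith [abs_nonneg (u x), abs_nonneg (u₀ x)]
  have e2 : u x ^ 2 ≤ 16 := by nlinarith [sq_abs (u x), abs_nonneg (u x)]
  have e3 : v x ^ 2 ≤ 16 := by nlinarith [sq_abs (v x), abs_nonneg (v x)]
  have := abs_le.1 e1
  rw [abs_le]; constructor <;> nlinarith [sq_nonneg (u x), sq_nonneg (v x)]

theorem continuous_u (h : SmallPair u du ddu v dv ddv) : Continuous u := h.u_ac.continuous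

theorem continuous_v (h : SmallPair u du ddu v dv ddv) : Continuous v := h.v_ac.continuous

theorem wt_mul_u_mem (h : SmallPair u du ddu v dv ddv) :
    MemLp (fun x => wt x * u x) 2 volume := by
  simpa only [mul_comm] using MemLp.continuous_mul memLp_wt h.continuous_u fun x => (h.bounds x).1

theorem wt_mul_v_mem (h : SmallPair u du ddu v dv ddv) :
    MemLp (fun x => wt x * v x) 2 volume := by
  simpa only [mul_comm] using MemLp.continuous_mul memLp_wt h.continuous_v fun x => (h.bounds x).2

theorem deta_mem (h : SmallPair u du ddu v dv ddv) : MemLp (deta u du v dv) 2 volume := by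
  have h1 := h.wt_mul_u_mem.const_mul √2
  have h2 := (MemLp.continuous_mul h.du_mem continuous_u₀ abs_u₀_le).const_mul 2
  have h3 := (MemLp.continuous_mul h.du_mem h.continuous_u fun x => (h.bounds x).1).const_mul 2
  have h4 := (MemLp.continuous_mul h.dv_mem h.continuous_v fun x => (h.bounds x).2).const_mul 2
  refine (((h1.add h2).add h3).add h4).ae_eq (.of_forall fun x => ?_)
  simp only [Pi.add_apply, deta]
  ring

theorem integrable_energy (h : SmallPair u du ddu v dv ddv) :
    Integrable (energyExpr u du v dv) volume :=
  ((((memLp_wt.const_mul (√2 / 2)).add h.du_mem).integrable_sq).add h.dv_mem.integrable_sq).add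
    ((memLp_wt.sub h.eta_mem).integrable_sq.const_mul _)

theorem integrable_higher (h : SmallPair u du ddu v dv ddv) :
    Integrable (higherExpr u du ddu v dv ddv) volume := by
  have m0 : MemLp (fun x => u₀ x * wt x) 2 volume :=
    MemLp.continuous_mul memLp_wt continuous_u₀ abs_u₀_le
  have cc : Continuous fun x => u₀ x ^ 2 + eta u v x := (continuous_u₀.pow 2).add h.continuous_eta
  have cb : ∀ x, |u₀ x ^ 2 + eta u v x| ≤ 41 := fun x => by
    have := abs_le.1 (h.abs_eta_le x)
    rw [abs_le]; constructor <;> nlinarith [u₀_sq_le x, sq_nonneg (u₀ x)]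
  have i1 : Integrable (fun x => (-(wt x * u₀ x) + ddu x) ^ 2) volume := by
    refine ((m0.neg.add h.ddu_mem).integrable_sq).congr (.of_forall fun x => ?_)
    simp only [Pi.add_apply, Pi.neg_apply]; ring
  have i2 := h.ddv_mem.integrable_sq
  have i3 := Integrable.continuous_mul
    ((((memLp_wt.const_mul (√2 / 2)).add h.du_mem).integrable_sq).add h.dv_mem.integrable_sq) cc cb
  have i4 := ((m0.const_mul √2).add h.deta_mem).integrable_sq
  have i5 := (memLp_wt.sub h.eta_mem).integrable_sq
  have i6 := Integrable.continuous_mul i5 cc cb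
  refine ((((i1.add i2).add (i3.const_mul 3)).add (i4.const_mul (1 / 2))).add
    (i5.add (i6.const_mul (1 / 2)))).congr (.of_forall fun x => ?_)
  simp only [Pi.add_apply, Pi.sub_apply, higherExpr]
  ring

theorem integrable_lamDensity (h : SmallPair u du ddu v dv ddv) :
    Integrable (lamDensity u du ddu v dv ddv) volume := by
  have i1 := h.ddu_mem.integrable_sq
  have i2 := h.ddv_mem.integrable_sq
  have i3 := Integrable.continuous_mul (h.du_mem.integrable_sq.add h.dv_mem.integrable_sq)
    (c := fun x => (3 * (u₀ x ^ 2 + eta u v x) - 2)) (C := 200)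
    ((continuous_const.mul ((continuous_u₀.pow 2).add h.continuous_eta)).sub continuous_const)
    (fun x => by
      have := abs_le.1 (h.abs_eta_le x)
      rw [abs_le]; constructor <;> nlinarith [u₀_sq_le x, sq_nonneg (u₀ x)])
  have i4 : Integrable (fun x => wt x * (u x ^ 2 + v x ^ 2)) volume := by
    simpa only [mul_comm] using Integrable.continuous_mul integrable_wt (C := 40)
      (c := fun x => u x ^ 2 + v x ^ 2) ((h.continuous_u.pow 2).add (h.continuous_v.pow 2))
      fun x => by
        obtain ⟨h1, h2⟩ := h.bounds x
        rw [abs_of_nonneg (by positivity)]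
        nlinarith [sq_abs (u x), abs_nonneg (u x), sq_abs (v x), abs_nonneg (v x)]
  have i5 := h.deta_mem.integrable_sq.const_mul (1 / 2)
  have i6 := Integrable.continuous_mul h.eta_mem.integrable_sq
    (c := fun x => 1 / 2 * (3 * u₀ x ^ 2 - 2)) (C := 200)
    (continuous_const.mul ((continuous_const.mul (continuous_u₀.pow 2)).sub continuous_const))
    (fun x => by
      rw [abs_le]; constructor <;> nlinarith [u₀_sq_le x, sq_nonneg (u₀ x)])
  have i7 := Integrable.continuous_mul ((h.eta_mem.integrable_mul h.du_mem).const_mul (3 * √2))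
    continuous_wt abs_wt_le
  have i8 := (Integrable.continuous_mul h.eta_mem.integrable_sq h.continuous_eta
    h.abs_eta_le).const_mul (1 / 2)
  refine (((((((i1.add i2).add i3).add i4).add i5).add i6).add i7).add i8).congr
    (.of_forall fun x => ?_)
  simp only [Pi.add_apply, Pi.mul_apply, lamDensity]
  ring

theorem smallPair_zero : SmallPair (fun _ => 0) (fun _ => 0) (fun _ => 0) (fun _ => 0)
    (fun _ => 0) (fun _ => 0) := by
  have h := isRep_zero
  have e : eta (fun _ => 0) (fun _ => 0) = fun _ => 0 := by ext x; rw [eta_eq]; ring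
  have m : MemLp (fun _ : ℝ => (0 : ℝ)) 2 volume := MemLp.zero'
  exact ⟨h.a_ac, h.da_ac, h.b_ac, h.db_ac, m, m, m, m, by rwa [e], by simp, by simp [e]⟩

end SmallPair

/-! ### The difference Λ(ψ) − Λ(u₀) as an integral -/

theorem IsRep.integrable_energyDensity {u v a da dda b db ddb : ℝ → ℝ}
    (hr : IsRep u v a da dda b db ddb) (h : SmallPair a da dda b db ddb) :
    Integrable (energyDensity (perturbed u v)) volume :=
  h.integrable_energy.congr hr.energyDensity_ae.symm

theorem IsRep.integrable_higherDensity {u v a da dda b db ddb : ℝ → ℝ}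
    (hr : IsRep u v a da dda b db ddb) (h : SmallPair a da dda b db ddb) :
    Integrable (higherDensity (perturbed u v)) volume :=
  h.integrable_higher.congr hr.higherDensity_ae.symm

/-- The first variation at the soliton vanishes, so the linear terms form an exact derivative.
Keeping η as a variable makes the remaining density polynomial of degree three in (u, v, η) and
their derivatives. -/
theorem IsRep.Lam_eq {u v a da dda b db ddb : ℝ → ℝ}
    (hr : IsRep u v a da dda b db ddb) (h : SmallPair a da dda b db ddb) :
    Lam (perturbed u v) - Lam solitonC = ∫ x, lamDensity a da dda b db ddb x := by
  have hz := SmallPair.smallPair_zero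
  -- The three pieces cancel the terms in which soliton data multiply `dda`, `da` and `deta`
  -- linearly. What is left of the linear term in η is `wt` times η; the second piece also removes
  -- its part 2u₀u, leaving `wt` times u² + v².
  have hB : IsAC (fun x => -(2 * (wt x * u₀ x * da x)) - √2 * (wt x * a x)
        + √2 * (u₀ x * wt x * eta a b x)) _ :=
    ((((isAC_wt.mul isAC_u₀).mul h.du_ac).const_mul 2).neg.sub
      ((isAC_wt.mul h.u_ac).const_mul √2)).add
      (((isAC_u₀.mul isAC_wt).mul (isAC_eta h.u_ac h.v_ac)).const_mul √2)
  have iB : Integrable (fun x => -(2 * (wt x * u₀ x * da x)) - √2 * (wt x * a x)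
        + √2 * (u₀ x * wt x * eta a b x)) volume := by
    have m0 : MemLp (fun x => u₀ x * wt x) 2 volume :=
      MemLp.continuous_mul memLp_wt continuous_u₀ abs_u₀_le
    have i1 : Integrable (fun x => u₀ x * wt x * da x) volume := m0.integrable_mul h.du_mem
    have i2 : Integrable (fun x => u₀ x * wt x * eta a b x) volume := m0.integrable_mul h.eta_mem
    have i3 : Integrable (fun x => a x * wt x) volume :=
      Integrable.continuous_mul integrable_wt h.continuous_u fun x => (h.bounds x).1
    refine (((i1.const_mul (-2)).sub (i3.const_mul √2)).add (i2.const_mul √2)).congr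
      (.of_forall fun x => ?_)
    simp only [Pi.add_apply, Pi.sub_apply]; ring
  have i1 : Integrable (fun x => higherExpr a da dda b db ddb x - 2 * energyExpr a da b db x)
      volume := h.integrable_higher.sub (h.integrable_energy.const_mul 2)
  have i2 : Integrable (fun x => higherExpr (fun _ => 0) (fun _ => 0) (fun _ => 0) (fun _ => 0)
      (fun _ => 0) (fun _ => 0) x
        - 2 * energyExpr (fun _ => 0) (fun _ => 0) (fun _ => 0) (fun _ => 0) x) volume :=
    hz.integrable_higher.sub (hz.integrable_energy.const_mul 2)
  have e1 : Lam (perturbed u v)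
      = ∫ x, (higherExpr a da dda b db ddb x - 2 * energyExpr a da b db x) := by
    rw [Lam, higherEnergy, energy, integral_congr_ae hr.higherDensity_ae,
      integral_congr_ae hr.energyDensity_ae, ← integral_const_mul,
      ← integral_sub h.integrable_higher (h.integrable_energy.const_mul 2)]
  have e2 : Lam solitonC = ∫ x, (higherExpr (fun _ => 0) (fun _ => 0) (fun _ => 0) (fun _ => 0)
      (fun _ => 0) (fun _ => 0) x
        - 2 * energyExpr (fun _ => 0) (fun _ => 0) (fun _ => 0) (fun _ => 0) x) := by
    rw [← perturbed_zero, Lam, higherEnergy, energy, integral_congr_ae isRep_zero.higherDensity_ae,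
      integral_congr_ae isRep_zero.energyDensity_ae, ← integral_const_mul,
      ← integral_sub hz.integrable_higher (hz.integrable_energy.const_mul 2)]
  have e3 := (hB.congr (fun x => rfl) (g' := fun x =>
    (higherExpr a da dda b db ddb x - 2 * energyExpr a da b db x)
    - (higherExpr (fun _ => 0) (fun _ => 0) (fun _ => 0) (fun _ => 0)
      (fun _ => 0) (fun _ => 0) x
        - 2 * energyExpr (fun _ => 0) (fun _ => 0) (fun _ => 0) (fun _ => 0) x)
    - lamDensity a da dda b db ddb x) fun x => ?_).integral_eq_zero iB
      ((i1.sub i2).sub h.integrable_lamDensity)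
  · rw [e1, e2, ← integral_sub i1 i2, ← sub_eq_zero,
      ← integral_sub (f := fun x => _ - _) (i1.sub i2) h.integrable_lamDensity]
    exact e3
  · simp only [lamDensity, higherExpr, energyExpr, eta_eq, deta, wt]
    have h2 := sqrt_two_sq
    generalize √2 = s at *
    generalize u₀ x = t at *
    generalize a x = a at *
    generalize b x = b at *
    generalize da x = da at *
    generalize db x = db at *
    generalize dda x = dda at *
    generalize ddb x = ddb at *
    ring_nf
    simp only [h2]
    ring

/-! ### Algebraic weights and the second solution of y'' + (1 − u₀²) y = 0 -/

section Weights

/-- The algebraic weight `1 / (1 + x²)`. -/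
noncomputable def jb (x : ℝ) : ℝ := (1 + x ^ 2)⁻¹

theorem jb_pos (x : ℝ) : 0 < jb x := by rw [jb]; positivity

theorem jb_mul (x : ℝ) : jb x * (1 + x ^ 2) = 1 := inv_mul_cancel₀ (by positivity)

theorem jb_le_one (x : ℝ) : jb x ≤ 1 := inv_le_one_of_one_le₀ (by nlinarith)

theorem integrable_jb : Integrable jb volume := integrable_inv_one_add_sq

theorem continuous_jb : Continuous jb := by
  unfold jb
  exact Continuous.inv₀ (by fun_prop) fun x => by positivity

theorem exists_wt_le : ∃ C : ℝ, 1 ≤ C ∧ ∀ x, wt x ≤ C * jb x ^ 8 := by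
  obtain ⟨C, hC, h⟩ := exists_wt_mul_le
  refine ⟨max C 1, le_max_right _ _, fun x => ?_⟩
  rw [jb, inv_pow, ← div_eq_mul_inv, le_div_iff₀ (by positivity)]
  exact (h x).trans (le_max_left _ _)

theorem integral_jb_nonneg : 0 ≤ ∫ x, jb x := integral_nonneg fun x => (jb_pos x).le

theorem integral_pos_of_continuous {f : ℝ → ℝ} (hc : Continuous f) (h0 : ∀ x, 0 ≤ f x)
    (hi : Integrable f volume) {y : ℝ} (hy : f y ≠ 0) : 0 < ∫ x, f x := by
  rw [integral_pos_iff_support_of_nonneg h0 hi]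
  exact (hc.isOpen_support).measure_pos volume ⟨y, hy⟩

theorem u₀_one_ne_zero : u₀ 1 ≠ 0 := by
  intro h
  have h1 : wt 1 = 1 := by rw [wt, h]; ring
  rw [wt_eq, inv_eq_one] at h1
  have h2 := (Real.one_lt_cosh (x := 1 / √2)).2 (by positivity)
  nlinarith

theorem integral_wt_mul_sq_pos : 0 < ∫ x, wt x * u₀ x ^ 2 := by
  refine integral_pos_of_continuous (continuous_wt.mul (continuous_u₀.pow 2))
    (fun x => mul_nonneg (wt_pos x).le (sq_nonneg _)) ?_ (y := 1)
    (mul_ne_zero (wt_pos 1).ne' (pow_ne_zero 2 u₀_one_ne_zero))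
  simpa only [mul_comm] using Integrable.continuous_mul integrable_wt (C := 1)
    (c := fun x => u₀ x ^ 2) (continuous_u₀.pow 2) fun x => by simpa using abs_u₀_le x

/-- This is Cauchy–Schwarz between 0 and x. The majorant is only needed for |z| ≤ |x|, so it may
depend on x: a weight monotone in |z| can be frozen at its value at x. -/
theorem IsAC.sq_sub_le_of_le {f f' k : ℝ → ℝ} (hf : IsAC f f') (hk : Integrable k volume)
    (hk0 : ∀ z, 0 ≤ k z) (x : ℝ) (hle : ∀ z, |z| ≤ |x| → f' z ^ 2 ≤ k z) :
    (f x - f 0) ^ 2 ≤ |x| * ∫ z, k z := by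
  have key : ∀ a b : ℝ, a ≤ b → (∀ z ∈ Ioc a b, |z| ≤ |x|) →
      (∫ z in a..b, f' z) ^ 2 ≤ |b - a| * ∫ z, k z := by
    intro a b hab hz
    have hm : AEStronglyMeasurable f' (volume.restrict (Ioc a b)) :=
      hf.locallyIntegrable_deriv.aestronglyMeasurable.restrict
    have hle : ∀ᵐ z ∂(volume.restrict (Ioc a b)), f' z ^ 2 ≤ k z :=
      (ae_restrict_iff' measurableSet_Ioc).2 (.of_forall fun z h => hle z (hz z h))
    have i2 : Integrable (fun z => f' z ^ 2) (volume.restrict (Ioc a b)) := by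
      refine hk.integrableOn.mono' (hm.pow 2) ?_
      filter_upwards [hle] with z h
      rwa [Real.norm_eq_abs, abs_of_nonneg (sq_nonneg _)]
    have h1 := sq_integral_mul_le (μ := volume.restrict (Ioc a b)) (f := fun _ => (1 : ℝ))
      (memLp_const 1) ((memLp_two_iff_integrable_sq hm).2 i2)
    rw [intervalIntegral.integral_of_le hab, abs_of_nonneg (by linarith)]
    simp only [one_mul, one_pow, integral_const, smul_eq_mul, mul_one] at h1
    refine h1.trans ?_
    simp only [measureReal_restrict_apply_univ, Real.volume_real_Ioc_of_le hab]
    refine mul_le_mul_of_nonneg_left ?_ (by linarith)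
    exact (integral_mono_ae i2 hk.integrableOn hle).trans (setIntegral_le_integral
      hk (.of_forall hk0))
  rcases le_total 0 x with hx | hx
  · rw [← hf.integral_eq 0 x]
    simpa using key 0 x hx fun z hz => by
      rw [abs_of_nonneg hz.1.le, abs_of_nonneg hx]; exact hz.2
  · rw [← neg_sq, neg_sub, ← hf.integral_eq x 0]
    simpa using key x 0 hx fun z hz => by
      rw [abs_of_nonpos hz.2, abs_of_nonpos hx]; linarith [hz.1]

/-- The solution of `y'' + (1 - u₀²) y = 0` whose Wronskian with `u₀` is one. -/
noncomputable def secondSol (x : ℝ) : ℝ := x * u₀ x - √2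

/-- The derivative of `secondSol`. -/
noncomputable def secondSol' (x : ℝ) : ℝ := u₀ x + x * (√2 / 2 * wt x)

theorem isAC_id : IsAC (fun x => x) (fun _ => 1) := .of_hasDerivAt hasDerivAt_id' continuous_const

theorem isAC_const (c : ℝ) : IsAC (fun _ => c) (fun _ => 0) :=
  .of_hasDerivAt (fun x => hasDerivAt_const x c) continuous_const

theorem isAC_secondSol : IsAC secondSol secondSol' := by
  refine ((isAC_id.mul isAC_u₀).sub (isAC_const √2)).congr (fun x => rfl) fun x => ?_
  rw [secondSol']; ring

theorem isAC_secondSol' : IsAC secondSol' (fun x => -(wt x * secondSol x)) := by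
  refine (isAC_u₀.add (isAC_id.mul isAC_u₀')).congr (fun x => rfl) fun x => ?_
  rw [secondSol]; ring

theorem secondSol_wronskian (x : ℝ) :
    u₀ x * secondSol' x - √2 / 2 * wt x * secondSol x = 1 := by
  rw [secondSol, secondSol', wt]
  linear_combination (1 - u₀ x ^ 2) / 2 * sqrt_two_sq

theorem secondSol_sq_le (x : ℝ) : secondSol x ^ 2 ≤ 4 * (1 + x ^ 2) := by
  rw [secondSol]
  have h1 := mul_le_mul_of_nonneg_left (u₀_sq_le x) (sq_nonneg x)
  nlinarith [sqrt_two_sq, sq_nonneg (x * u₀ x + √2)]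

theorem exists_secondSol'_sq_le : ∃ C : ℝ, ∀ x, secondSol' x ^ 2 ≤ C := by
  obtain ⟨C, hC, h⟩ := exists_wt_le
  refine ⟨2 + C, fun x => ?_⟩
  have h1 : wt x ^ 2 * x ^ 2 ≤ C := by
    have h2 := h x
    have h3 : wt x * x ^ 2 ≤ C := by
      calc wt x * x ^ 2 ≤ C * jb x ^ 8 * (1 + x ^ 2) := by
            gcongr
            · linarith
        _ = C * jb x ^ 7 * (jb x * (1 + x ^ 2)) := by ring
        _ ≤ C := by
            rw [jb_mul, mul_one]
            exact mul_le_of_le_one_right (by linarith) (pow_le_one₀ (jb_pos x).le (jb_le_one x))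
    nlinarith [wt_pos x, wt_le_one x, sq_nonneg x, mul_nonneg (wt_pos x).le (sq_nonneg x)]
  rw [secondSol']
  nlinarith [u₀_sq_le x, sq_nonneg (u₀ x - x * (√2 / 2 * wt x)), sqrt_two_sq]

end Weights

/-! ### Coercivity of the quadratic form in v -/

section VCoercivity

/-- The quadratic form in `v` of the second variation is a sum of two squares. -/
theorem integral_vForm {v dv ddv : ℝ → ℝ} (hv : IsAC v dv) (hdv : IsAC dv ddv)
    (hb : ∀ x, |v x| ≤ 4) (m1 : MemLp dv 2 volume) (m2 : MemLp ddv 2 volume) :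
    ∫ x, (ddv x ^ 2 + (3 * u₀ x ^ 2 - 2) * dv x ^ 2 + wt x * v x ^ 2)
      = ∫ x, ((u₀ x * dv x - √2 / 2 * wt x * v x) ^ 2 + (ddv x + wt x * v x) ^ 2) := by
  have mw : MemLp (fun x => wt x * v x) 2 volume := by
    simpa only [mul_comm] using MemLp.continuous_mul memLp_wt hv.continuous hb
  have iw : Integrable (fun x => v x * wt x) volume :=
    Integrable.continuous_mul integrable_wt hv.continuous hb
  have iw2 : Integrable (fun x => v x * (v x * wt x)) volume :=
    Integrable.continuous_mul iw hv.continuous hb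
  have i1 : Integrable (fun x => ddv x ^ 2 + (3 * u₀ x ^ 2 - 2) * dv x ^ 2 + wt x * v x ^ 2)
      volume := by
    have c1 := Integrable.continuous_mul m1.integrable_sq (c := fun x => 3 * u₀ x ^ 2 - 2) (C := 2)
      ((continuous_const.mul (continuous_u₀.pow 2)).sub continuous_const) fun x => by
        rw [abs_le]; constructor <;> nlinarith [u₀_sq_le x, sq_nonneg (u₀ x)]
    refine ((m2.integrable_sq.add c1).add iw2).congr (.of_forall fun x => ?_)
    simp only [Pi.add_apply]; ring
  have i2 : Integrable (fun x => (u₀ x * dv x - √2 / 2 * wt x * v x) ^ 2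
      + (ddv x + wt x * v x) ^ 2) volume := by
    have m3 := (MemLp.continuous_mul m1 continuous_u₀ abs_u₀_le).sub (mw.const_mul (√2 / 2))
    refine (m3.integrable_sq.add (m2.add mw).integrable_sq).congr (.of_forall fun x => ?_)
    simp only [Pi.add_apply, Pi.sub_apply]; ring
  -- The two integrands differ exactly by the derivative of this function.
  have hB := (((isAC_wt.mul (hv.mul hdv)).const_mul 2).add
    ((isAC_u₀.mul (isAC_wt.mul (hv.mul hv))).const_mul (√2 / 2)))
  have iB : Integrable (fun x => 2 * (wt x * (v x * dv x)) +
      √2 / 2 * (u₀ x * (wt x * (v x * v x)))) volume := by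
    have a1 : Integrable (fun x => wt x * v x * dv x) volume := mw.integrable_mul m1
    have a2 := Integrable.continuous_mul iw2 continuous_u₀ abs_u₀_le
    refine ((a1.const_mul 2).add (a2.const_mul (√2 / 2))).congr (.of_forall fun x => ?_)
    simp only [Pi.add_apply]; ring
  have := (hB.congr (fun x => rfl) (g' := fun x => ((u₀ x * dv x - √2 / 2 * wt x * v x) ^ 2
      + (ddv x + wt x * v x) ^ 2) - (ddv x ^ 2 + (3 * u₀ x ^ 2 - 2) * dv x ^ 2 + wt x * v x ^ 2))
      fun x => ?_).integral_eq_zero iB (i2.sub i1)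
  · rw [integral_sub i2 i1] at this
    linarith
  · have h2 := sqrt_two_sq
    simp only [wt]
    ring_nf
    simp only [h2]
    ring

end VCoercivity

section VCoercivity

theorem sq_sub_le_two (a b : ℝ) : (a - b) ^ 2 ≤ 2 * a ^ 2 + 2 * b ^ 2 := by
  nlinarith [sq_nonneg (a + b)]

theorem sq_sub_sub_le_three (a b c : ℝ) :
    (a - b - c) ^ 2 ≤ 3 * (a ^ 2 + b ^ 2 + c ^ 2) := by
  nlinarith [sq_nonneg (a + b), sq_nonneg (a + c), sq_nonneg (b - c)]

theorem abs_le_one_add_sq (x : ℝ) : |x| ≤ 1 + x ^ 2 := by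
  nlinarith [sq_abs x, sq_nonneg (|x| - 1)]

set_option maxHeartbeats 800000 in
/-- Coercivity of the quadratic form in `v` under the orthogonality condition. -/
theorem exists_vForm_coercive : ∃ c : ℝ, 0 < c ∧ ∀ v dv ddv : ℝ → ℝ, IsAC v dv → IsAC dv ddv →
    (∀ x, |v x| ≤ 4) → MemLp dv 2 volume → MemLp ddv 2 volume → ∫ x, wt x * u₀ x * v x = 0 →
    c * ((∫ x, dv x ^ 2) + (∫ x, ddv x ^ 2) + ∫ x, jb x ^ 4 * v x ^ 2)
      ≤ ∫ x, (ddv x ^ 2 + (3 * u₀ x ^ 2 - 2) * dv x ^ 2 + wt x * v x ^ 2) := by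
  obtain ⟨W, hW1, hW⟩ := exists_wt_le
  obtain ⟨Y, hY⟩ := exists_secondSol'_sq_le
  set J := ∫ x, jb x with hJ
  have hJ0 : 0 ≤ J := integral_jb_nonneg
  set m₀ := ∫ x, wt x * u₀ x ^ 2 with hm₀
  have hm₀' : 0 < m₀ := integral_wt_mul_sq_pos
  have hY0 : 0 ≤ Y := (sq_nonneg _).trans (hY 0)
  -- With P and Q the integrals of the two squares, `K₁`, `K₂` and `K₃` are the multiples of P + Q
  -- that bound, respectively, the squared coefficient of u₀ (`hκ2`), the weighted norm of v (`hV`)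
  -- and the norm of v' (`hD1`).
  obtain ⟨K₁, hK₁⟩ : ∃ K, K = (W * J) * (8 + 8 * J) / m₀ ^ 2 := ⟨_, rfl⟩
  have hK₁0 : 0 ≤ K₁ := by rw [hK₁]; positivity
  obtain ⟨K₂, hK₂⟩ : ∃ K, K = 2 * (8 + 8 * J) + 2 * K₁ * J := ⟨_, rfl⟩
  obtain ⟨K₃, hK₃⟩ : ∃ K, K = 3 * Y + 8 * W * J + 2 * K₁ * W * J := ⟨_, rfl⟩
  have hK₂0 : 0 ≤ K₂ := by rw [hK₂]; positivity
  have hK₃0 : 0 ≤ K₃ := by rw [hK₃]; positivity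
  refine ⟨(K₃ + (2 + 2 * W * K₂) + K₂)⁻¹, by positivity, fun v dv ddv hv hdv hb m1 m2 ho => ?_⟩
  rw [integral_vForm hv hdv hb m1 m2, inv_mul_le_iff₀ (by positivity)]
  have mw : MemLp (fun x => wt x * v x) 2 volume := by
    simpa only [mul_comm] using MemLp.continuous_mul memLp_wt hv.continuous hb
  set p : ℝ → ℝ := fun x => u₀ x * dv x - √2 / 2 * wt x * v x with hp
  set q : ℝ → ℝ := fun x => ddv x + wt x * v x with hq
  have mp : MemLp p 2 volume := by
    refine ((MemLp.continuous_mul m1 continuous_u₀ abs_u₀_le).sub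
      (mw.const_mul (√2 / 2))).ae_eq (.of_forall fun x => ?_)
    simp only [Pi.sub_apply, hp]; ring
  have mq : MemLp q 2 volume := m2.add mw
  have ip := mp.integrable_sq
  have iq := mq.integrable_sq
  rw [integral_add ip iq]
  set P := ∫ x, p x ^ 2
  set Q := ∫ x, q x ^ 2
  have hP0 : 0 ≤ P := integral_nonneg fun x => sq_nonneg _
  have hQ0 : 0 ≤ Q := integral_nonneg fun x => sq_nonneg _
  -- The first square `p` is the Wronskian of u₀ and v; T is the Wronskian of the second solution
  -- and v, whose derivative is the second solution times v'' + (1 − u₀²) v. Since u₀ and the second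
  -- solution have Wronskian one, `p` and T determine v and v'.
  have hT : IsAC (fun x => secondSol x * dv x - secondSol' x * v x)
      (fun x => secondSol x * q x) :=
    ((isAC_secondSol.mul hdv).sub (isAC_secondSol'.mul hv)).congr (fun x => rfl) fun x => by
      simp only [hq]; ring
  set T : ℝ → ℝ := fun x => secondSol x * dv x - secondSol' x * v x with hTdef
  have hv_eq : ∀ x, v x = secondSol x * p x - u₀ x * T x := fun x => by
    simp only [hp, hTdef]
    linear_combination (-v x) * secondSol_wronskian x
  have hdv_eq : ∀ x, dv x = secondSol' x * p x - √2 / 2 * wt x * T x := fun x => by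
    simp only [hp, hTdef]
    linear_combination (-dv x) * secondSol_wronskian x
  -- The weight 4 (1 + x²) dominates the square of the second solution on the whole segment from 0
  -- to x.
  have hI : ∀ x, (T x - T 0) ^ 2 ≤ 4 * (1 + x ^ 2) ^ 2 * Q := fun x => by
    have h1 := hT.sq_sub_le_of_le (iq.const_mul (4 * (1 + x ^ 2))) (fun z => by positivity) x
      fun z hz => by
      rw [mul_pow]
      refine mul_le_mul_of_nonneg_right ((secondSol_sq_le z).trans ?_) (sq_nonneg _)
      have := sq_le_sq.2 hz
      linarith
    rw [integral_const_mul] at h1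
    linarith [mul_le_mul_of_nonneg_right (abs_le_one_add_sq x)
      (show 0 ≤ 4 * (1 + x ^ 2) * Q by positivity)]
  -- The constant κ is the free coefficient along the kernel, and r = v + κ u₀ is controlled by P
  -- and Q alone.
  set κ := T 0 with hκ
  set r : ℝ → ℝ := fun x => v x + u₀ x * κ with hr
  have hrc : Continuous r := hv.continuous.add (continuous_u₀.mul continuous_const)
  have hr2 : ∀ x, (jb x ^ 2 * r x) ^ 2 ≤ 8 * p x ^ 2 + 8 * Q * jb x := fun x => by
    have e : r x = secondSol x * p x - u₀ x * (T x - κ) := by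
      simp only [hr]; rw [hv_eq x]; ring
    have a1 : r x ^ 2 ≤ 8 * (1 + x ^ 2) * p x ^ 2 + 8 * (1 + x ^ 2) ^ 2 * Q := by
      have b1 : (secondSol x * p x) ^ 2 ≤ 4 * (1 + x ^ 2) * p x ^ 2 := by
        rw [mul_pow]; exact mul_le_mul_of_nonneg_right (secondSol_sq_le x) (sq_nonneg _)
      have b2 : (u₀ x * (T x - κ)) ^ 2 ≤ 4 * (1 + x ^ 2) ^ 2 * Q := by
        rw [mul_pow]
        exact (mul_le_of_le_one_left (sq_nonneg _) (u₀_sq_le x)).trans (hI x)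
      rw [e]
      linarith [sq_sub_le_two (secondSol x * p x) (u₀ x * (T x - κ))]
    have hj := jb_pos x
    calc (jb x ^ 2 * r x) ^ 2 = jb x ^ 4 * r x ^ 2 := by ring
      _ ≤ jb x ^ 4 * (8 * (1 + x ^ 2) * p x ^ 2 + 8 * (1 + x ^ 2) ^ 2 * Q) := by gcongr
      _ = 8 * jb x ^ 3 * (jb x * (1 + x ^ 2)) * p x ^ 2
          + 8 * jb x ^ 2 * (jb x * (1 + x ^ 2)) ^ 2 * Q := by ring
      _ ≤ _ := by
        rw [jb_mul]
        have c1 : jb x ^ 3 ≤ 1 := pow_le_one₀ hj.le (jb_le_one x)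
        have c2 : jb x ^ 2 ≤ jb x := pow_le_of_le_one hj.le (jb_le_one x) two_ne_zero
        linarith [mul_le_mul_of_nonneg_right c1 (sq_nonneg (p x)),
          mul_le_mul_of_nonneg_right c2 hQ0]
  have ibound : Integrable (fun x => 8 * p x ^ 2 + 8 * Q * jb x) volume :=
    (ip.const_mul 8).add (integrable_jb.const_mul _)
  have mjr : MemLp (fun x => jb x ^ 2 * r x) 2 volume := by
    have hc : Continuous fun x => jb x ^ 2 * r x := (continuous_jb.pow 2).mul hrc
    rw [memLp_two_iff_integrable_sq hc.aestronglyMeasurable]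
    refine ibound.mono' (hc.pow 2).aestronglyMeasurable (.of_forall fun x => ?_)
    rw [Real.norm_eq_abs, abs_of_nonneg (sq_nonneg _)]
    exact hr2 x
  have hA : ∫ x, (jb x ^ 2 * r x) ^ 2 ≤ (8 + 8 * J) * (P + Q) := by
    have := integral_mono mjr.integrable_sq ibound hr2
    rw [integral_add (ip.const_mul 8) (integrable_jb.const_mul _), integral_const_mul,
      integral_const_mul] at this
    linarith [mul_nonneg hJ0 hP0]
  have hκ2 : κ ^ 2 ≤ K₁ * (P + Q) := by
    have hg2 : ∀ x, (wt x * u₀ x * (1 + x ^ 2) ^ 2) ^ 2 ≤ W * jb x := fun x => by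
      have hj := jb_pos x
      have hw := wt_pos x
      calc (wt x * u₀ x * (1 + x ^ 2) ^ 2) ^ 2
          = wt x * (wt x * (1 + x ^ 2) ^ 4) * u₀ x ^ 2 := by ring
        _ ≤ 1 * ((W * jb x ^ 8) * (1 + x ^ 2) ^ 4) * 1 := by
          gcongr
          · exact wt_le_one x
          · exact hW x
          · exact u₀_sq_le x
        _ = W * jb x ^ 3 * jb x * (jb x * (1 + x ^ 2)) ^ 4 := by ring
        _ ≤ _ := by
          rw [jb_mul, one_pow, mul_one]
          refine mul_le_mul_of_nonneg_right ?_ hj.le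
          exact mul_le_of_le_one_right (by linarith) (pow_le_one₀ hj.le (jb_le_one x))
    have hgc : Continuous fun x => wt x * u₀ x * (1 + x ^ 2) ^ 2 :=
      (continuous_wt.mul continuous_u₀).mul (by fun_prop)
    have mg : MemLp (fun x => wt x * u₀ x * (1 + x ^ 2) ^ 2) 2 volume := by
      rw [memLp_two_iff_integrable_sq hgc.aestronglyMeasurable]
      refine (integrable_jb.const_mul W).mono' (hgc.pow 2).aestronglyMeasurable
        (.of_forall fun x => ?_)
      rw [Real.norm_eq_abs, abs_of_nonneg (sq_nonneg _)]
      exact hg2 x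
    have hgint : ∫ x, (wt x * u₀ x * (1 + x ^ 2) ^ 2) ^ 2 ≤ W * J := by
      rw [hJ, ← integral_const_mul]
      exact integral_mono mg.integrable_sq (integrable_jb.const_mul W) hg2
    have hcs := sq_integral_mul_le mg mjr
    -- Orthogonality removes v from the pairing of r with `wt` u₀, so the pairing computes κ. The
    -- weight (1 + x²)² and its inverse are split between the factors so that both are square
    -- integrable.
    have e1 : ∫ x, wt x * u₀ x * (1 + x ^ 2) ^ 2 * (jb x ^ 2 * r x) = κ * m₀ := by
      have i1 : Integrable (fun x => wt x * u₀ x * v x) volume := by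
        have := Integrable.continuous_mul (Integrable.continuous_mul integrable_wt hv.continuous hb)
          continuous_u₀ abs_u₀_le
        exact this.congr (.of_forall fun x => by ring)
      have i2 : Integrable (fun x => wt x * u₀ x ^ 2) volume := by
        have := Integrable.continuous_mul (Integrable.continuous_mul integrable_wt
          continuous_u₀ abs_u₀_le) continuous_u₀ abs_u₀_le
        exact this.congr (.of_forall fun x => by ring)
      have : ∀ x, wt x * u₀ x * (1 + x ^ 2) ^ 2 * (jb x ^ 2 * r x)
          = wt x * u₀ x * v x + κ * (wt x * u₀ x ^ 2) := fun x => by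
        have : wt x * u₀ x * (1 + x ^ 2) ^ 2 * (jb x ^ 2 * r x)
          = (jb x * (1 + x ^ 2)) ^ 2 * (wt x * u₀ x * r x) := by ring
        rw [this, jb_mul]; simp only [hr]; ring
      simp only [this]
      rw [integral_add i1 (i2.const_mul κ), ho, integral_const_mul, zero_add]
    rw [e1] at hcs
    rw [hK₁, div_mul_eq_mul_div, le_div_iff₀ (by positivity)]
    calc κ ^ 2 * m₀ ^ 2 = (κ * m₀) ^ 2 := by ring
      _ ≤ _ := hcs
      _ ≤ (W * J) * ((8 + 8 * J) * (P + Q)) := by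
        gcongr
      _ = _ := by ring
  have hjc : Continuous fun x => jb x ^ 4 * v x ^ 2 :=
    (continuous_jb.pow 4).mul (hv.continuous.pow 2)
  have hjv : ∀ x, jb x ^ 4 * v x ^ 2 ≤ 2 * (jb x ^ 2 * r x) ^ 2 + 2 * κ ^ 2 * jb x := fun x => by
    have e : v x = r x - u₀ x * κ := by simp only [hr]; ring
    have a1 : v x ^ 2 ≤ 2 * r x ^ 2 + 2 * κ ^ 2 := by
      have : (u₀ x * κ) ^ 2 ≤ κ ^ 2 := by
        rw [mul_pow]; exact mul_le_of_le_one_left (sq_nonneg _) (u₀_sq_le x)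
      rw [e]
      linarith [sq_sub_le_two (r x) (u₀ x * κ)]
    have hj := jb_pos x
    have hj4 : jb x ^ 4 ≤ jb x := by
      calc jb x ^ 4 = jb x ^ 3 * jb x := by ring
        _ ≤ 1 * jb x := by gcongr; exact pow_le_one₀ hj.le (jb_le_one x)
        _ = jb x := one_mul _
    calc jb x ^ 4 * v x ^ 2 ≤ jb x ^ 4 * (2 * r x ^ 2 + 2 * κ ^ 2) := by gcongr
      _ = 2 * (jb x ^ 2 * r x) ^ 2 + 2 * κ ^ 2 * jb x ^ 4 := by ring
      _ ≤ _ := by gcongr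
  have ibv : Integrable (fun x => 2 * (jb x ^ 2 * r x) ^ 2 + 2 * κ ^ 2 * jb x) volume :=
    (mjr.integrable_sq.const_mul 2).add (integrable_jb.const_mul _)
  have ijv : Integrable (fun x => jb x ^ 4 * v x ^ 2) volume := by
    refine ibv.mono' hjc.aestronglyMeasurable (.of_forall fun x => ?_)
    rw [Real.norm_eq_abs, abs_of_nonneg (mul_nonneg (pow_nonneg (jb_pos x).le _) (sq_nonneg _))]
    exact hjv x
  have hV : ∫ x, jb x ^ 4 * v x ^ 2 ≤ K₂ * (P + Q) := by
    have h1 := integral_mono ijv ibv hjv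
    rw [integral_add (mjr.integrable_sq.const_mul 2) (integrable_jb.const_mul _),
      integral_const_mul, integral_const_mul] at h1
    rw [hK₂]
    linarith [mul_le_mul_of_nonneg_right hκ2 hJ0]
  have hD1 : ∫ x, dv x ^ 2 ≤ K₃ * (P + Q) := by
    have hpt : ∀ x, dv x ^ 2 ≤ 3 * Y * p x ^ 2 + (8 * W * Q + 2 * κ ^ 2 * W) * jb x := fun x => by
      have hj := jb_pos x
      have hw := wt_pos x
      have e : dv x = secondSol' x * p x - √2 / 2 * wt x * (T x - κ) - √2 / 2 * wt x * κ := by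
        rw [hdv_eq x]; ring
      have b1 : (secondSol' x * p x) ^ 2 ≤ Y * p x ^ 2 := by
        rw [mul_pow]; exact mul_le_mul_of_nonneg_right (hY x) (sq_nonneg _)
      have hw8 : wt x ^ 2 ≤ W * jb x ^ 8 :=
        (pow_le_of_le_one hw.le (wt_le_one x) two_ne_zero).trans (hW x)
      have b2 : (√2 / 2 * wt x * (T x - κ)) ^ 2 ≤ 2 * W * Q * jb x := by
        calc (√2 / 2 * wt x * (T x - κ)) ^ 2 = √2 ^ 2 / 4 * wt x ^ 2 * (T x - κ) ^ 2 := by ring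
          _ ≤ 2 / 4 * (W * jb x ^ 8) * (4 * (1 + x ^ 2) ^ 2 * Q) := by
            rw [sqrt_two_sq]
            gcongr
            exact hI x
          _ = 2 * W * Q * jb x * (jb x ^ 5 * (jb x * (1 + x ^ 2)) ^ 2) := by ring
          _ ≤ _ := by
            rw [jb_mul, one_pow, mul_one]
            exact mul_le_of_le_one_right (by positivity) (pow_le_one₀ hj.le (jb_le_one x))
      have b3 : (√2 / 2 * wt x * κ) ^ 2 ≤ κ ^ 2 * W * jb x / 2 := by
        calc (√2 / 2 * wt x * κ) ^ 2 = √2 ^ 2 / 4 * wt x ^ 2 * κ ^ 2 := by ring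
          _ ≤ 2 / 4 * (W * jb x ^ 8) * κ ^ 2 := by
            rw [sqrt_two_sq]
            gcongr
          _ = κ ^ 2 * W * jb x / 2 * jb x ^ 7 := by ring
          _ ≤ _ := mul_le_of_le_one_right (by positivity) (pow_le_one₀ hj.le (jb_le_one x))
      have b4 : dv x ^ 2 ≤ 3 * ((secondSol' x * p x) ^ 2 + (√2 / 2 * wt x * (T x - κ)) ^ 2
          + (√2 / 2 * wt x * κ) ^ 2) := by
        rw [e]
        exact sq_sub_sub_le_three _ _ _
      have b5 : 0 ≤ W * Q * jb x := by positivity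
      have b6 : 0 ≤ κ ^ 2 * W * jb x := by positivity
      linarith
    have h1 := integral_mono m1.integrable_sq
      ((ip.const_mul (3 * Y)).add (integrable_jb.const_mul _)) hpt
    simp only [Pi.add_apply] at h1
    rw [integral_add (ip.const_mul (3 * Y)) (integrable_jb.const_mul _), integral_const_mul,
      integral_const_mul] at h1
    rw [hK₃]
    have hWJ : 0 ≤ W * J := by positivity
    linarith [mul_le_mul_of_nonneg_right hκ2 hWJ, mul_nonneg hY0 hQ0, mul_nonneg hWJ hP0]
  have hD2 : ∫ x, ddv x ^ 2 ≤ (2 + 2 * W * K₂) * (P + Q) := by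
    have hpt : ∀ x, ddv x ^ 2 ≤ 2 * q x ^ 2 + 2 * W * (jb x ^ 4 * v x ^ 2) := fun x => by
      have hj := jb_pos x
      have e : ddv x = q x - wt x * v x := by simp only [hq]; ring
      have hw : wt x ^ 2 ≤ W * jb x ^ 4 := by
        calc wt x ^ 2 = wt x * wt x := sq _
          _ ≤ 1 * (W * jb x ^ 8) := by
            gcongr
            · exact (wt_pos x).le
            · exact wt_le_one x
            · exact hW x
          _ = W * jb x ^ 4 * jb x ^ 4 := by ring
          _ ≤ _ := mul_le_of_le_one_right (by positivity) (pow_le_one₀ hj.le (jb_le_one x))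
      rw [e]
      linarith [sq_sub_le_two (q x) (wt x * v x), mul_le_mul_of_nonneg_right hw (sq_nonneg (v x))]
    have h1 := integral_mono m2.integrable_sq ((iq.const_mul 2).add (ijv.const_mul (2 * W))) hpt
    simp only [Pi.add_apply] at h1
    rw [integral_add (iq.const_mul 2) (ijv.const_mul _), integral_const_mul,
      integral_const_mul] at h1
    have h2 := mul_le_mul_of_nonneg_left hV (show 0 ≤ 2 * W by positivity)
    linarith
  linarith

end VCoercivity

/-! ### An algebraic cutoff at scale 1/ε -/

section Cutoff

/-- A slowly varying algebraic cutoff. -/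
noncomputable def cutoff (ε x : ℝ) : ℝ := ((1 + ε ^ 2 * x ^ 2) ^ 3)⁻¹

/-- The derivative of `cutoff ε`. -/
noncomputable def cutoff' (ε x : ℝ) : ℝ := -(6 * ε ^ 2 * x * ((1 + ε ^ 2 * x ^ 2) ^ 4)⁻¹)

variable {ε : ℝ}

theorem cutoff_pos (x : ℝ) : 0 < cutoff ε x := by rw [cutoff]; positivity

theorem cutoff_le_one (x : ℝ) : cutoff ε x ≤ 1 :=
  inv_le_one_of_one_le₀ (one_le_pow₀ (by nlinarith [sq_nonneg (ε * x)]))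

theorem hasDerivAt_cutoff (x : ℝ) : HasDerivAt (cutoff ε) (cutoff' ε x) x := by
  have h1 : HasDerivAt (fun x : ℝ => (1 + ε ^ 2 * x ^ 2) ^ 3)
      (3 * (1 + ε ^ 2 * x ^ 2) ^ 2 * (ε ^ 2 * (2 * x))) x := by
    have := (((hasDerivAt_pow 2 x).const_mul (ε ^ 2)).const_add 1).pow 3
    refine this.congr_deriv ?_
    simp
  refine (h1.inv (by positivity)).congr_deriv ?_
  rw [cutoff']
  have : (1 + ε ^ 2 * x ^ 2) ≠ 0 := by positivity
  field_simp
  ring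

theorem continuous_cutoff' : Continuous (cutoff' ε) := by
  unfold cutoff'
  exact (Continuous.mul (by fun_prop) (Continuous.inv₀ (by fun_prop) fun x => by positivity)).neg

theorem isAC_cutoff : IsAC (cutoff ε) (cutoff' ε) :=
  .of_hasDerivAt hasDerivAt_cutoff continuous_cutoff'

theorem continuous_cutoff : Continuous (cutoff ε) := isAC_cutoff.continuous

/-- The logarithmic derivative is of order ε because 2ε|x| ≤ 1 + ε²x². Boundedness by the cutoff
itself lets commutator errors be absorbed in the same weighted norm, which a compactly supported
cutoff would not allow. -/
theorem abs_cutoff'_le (hε : 0 ≤ ε) (x : ℝ) : |cutoff' ε x| ≤ 3 * ε * cutoff ε x := by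
  have h0 : 0 < 1 + ε ^ 2 * x ^ 2 := by positivity
  have e : cutoff' ε x = -(cutoff ε x * (3 * ε) * (2 * ε * x * (1 + ε ^ 2 * x ^ 2)⁻¹)) := by
    rw [cutoff', cutoff]; field_simp; ring
  rw [e, abs_neg, abs_mul, abs_of_nonneg (mul_nonneg (cutoff_pos x).le (by positivity))]
  have : |2 * ε * x * (1 + ε ^ 2 * x ^ 2)⁻¹| ≤ 1 := by
    rw [← div_eq_mul_inv, abs_div, abs_of_pos h0, div_le_one h0, abs_le]
    constructor <;> nlinarith [sq_nonneg (ε * x - 1), sq_nonneg (ε * x + 1)]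
  nlinarith [mul_le_mul_of_nonneg_left this (mul_nonneg (cutoff_pos (ε := ε) x).le
    (show 0 ≤ 3 * ε by positivity))]

/-- The cutoff decreases away from the origin and u₀ has the sign of x. The integration by parts in
`integral_cutoff_le` therefore produces a term of favourable sign. -/
theorem cutoff'_mul_u₀_nonpos (x : ℝ) : cutoff' ε x * u₀ x ≤ 0 := by
  have h0 : 0 < 1 + ε ^ 2 * x ^ 2 := by positivity
  have e : cutoff' ε x * u₀ x = -(6 * ε ^ 2 * ((1 + ε ^ 2 * x ^ 2) ^ 4)⁻¹ * (x * u₀ x)) := by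
    rw [cutoff']; ring
  rw [e, neg_nonpos]
  exact mul_nonneg (by positivity) (u₀_mul_nonneg x)

theorem cutoff_anti {x y : ℝ} (h : |y| ≤ |x|) : cutoff ε x ≤ cutoff ε y := by
  rw [cutoff, cutoff]
  have := sq_le_sq.2 h
  gcongr

theorem jb_pow_le_cutoff (hε : 0 ≤ ε) (hε1 : ε ≤ 1) (x : ℝ) : jb x ^ 3 ≤ cutoff ε x := by
  rw [cutoff, jb, inv_pow]
  have : ε ^ 2 ≤ 1 := pow_le_one₀ hε hε1
  gcongr
  nlinarith [sq_nonneg x]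

theorem cutoff_le (hε : 0 < ε) (hε1 : ε ≤ 1) (x : ℝ) : cutoff ε x ≤ (ε ^ 6)⁻¹ * jb x ^ 3 := by
  rw [cutoff, jb, inv_pow, ← mul_inv]
  have : ε ^ 2 ≤ 1 := pow_le_one₀ hε.le hε1
  have e : ε ^ 6 * (1 + x ^ 2) ^ 3 = (ε ^ 2 + ε ^ 2 * x ^ 2) ^ 3 := by ring
  rw [e]
  gcongr

/-- The factor ε² makes the product of 1 − θ, for the cutoff θ, with a rapidly decaying weight small
on the whole line. -/
theorem one_sub_cutoff_le (x : ℝ) : 1 - cutoff ε x ≤ 3 * ε ^ 2 * x ^ 2 := by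
  have h0 : 0 < (1 + ε ^ 2 * x ^ 2) ^ 3 := by positivity
  set y := ε ^ 2 * x ^ 2 with hy
  have hy0 : 0 ≤ y := by positivity
  have h : 1 - 3 * y ≤ cutoff ε x := by
    rw [cutoff, ← one_div, le_div_iff₀ h0]
    have := pow_nonneg hy0 3
    have := pow_nonneg hy0 4
    linarith [sq_nonneg y]
  linarith

theorem integrable_cutoff (hε : 0 < ε) (hε1 : ε ≤ 1) : Integrable (cutoff ε) volume := by
  refine (integrable_jb.const_mul (ε ^ 6)⁻¹).mono' continuous_cutoff.aestronglyMeasurable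
    (.of_forall fun x => ?_)
  rw [Real.norm_eq_abs, abs_of_pos (cutoff_pos x)]
  refine (cutoff_le hε hε1 x).trans ?_
  have := jb_pos x
  gcongr
  exact pow_le_of_le_one this.le (jb_le_one x) (by norm_num)

end Cutoff

/-! ### Coercivity of the localized quadratic form in u -/

section UCoercivity

theorem integral_wt_sq_pos : 0 < ∫ x, wt x ^ 2 :=
  integral_pos_of_continuous (continuous_wt.pow 2) (fun _ => sq_nonneg _) memLp_wt.integrable_sq
    (y := 0) (pow_ne_zero 2 (wt_pos 0).ne')

/-- The first-order operator whose kernel is spanned by the derivative of the soliton. -/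
noncomputable def firstOrd (u du : ℝ → ℝ) (x : ℝ) : ℝ := du x + √2 * u₀ x * u x

variable {u du ddu : ℝ → ℝ} {ε : ℝ}

theorem integrable_cutoff_mul {f : ℝ → ℝ} {C : ℝ} (hε : 0 < ε) (hε1 : ε ≤ 1) (hf : Continuous f)
    (hb : ∀ x, |f x| ≤ C) : Integrable (fun x => cutoff ε x * f x) volume := by
  simpa only [mul_comm] using Integrable.continuous_mul (integrable_cutoff hε hε1) hf hb

theorem integrable_mul_cutoff {f : ℝ → ℝ} (hf : Integrable f volume) :
    Integrable (fun x => cutoff ε x * f x) volume :=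
  Integrable.continuous_mul hf continuous_cutoff (C := 1) fun x => by
    rw [abs_of_pos (cutoff_pos x)]; exact cutoff_le_one x

theorem integrable_cutoff_mul_sq (hε : 0 < ε) (hε1 : ε ≤ 1) (hu : Continuous u)
    (hb : ∀ x, |u x| ≤ 4) : Integrable (fun x => cutoff ε x * u x ^ 2) volume := by
  refine integrable_cutoff_mul hε hε1 (C := 4 ^ 2) (hu.pow 2) fun x => ?_
  rw [abs_pow]
  exact pow_le_pow_left₀ (abs_nonneg _) (hb x) 2

theorem integrable_cutoff_mul_mul (hε : 0 < ε) (hε1 : ε ≤ 1) (hu : Continuous u)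
    (hb : ∀ x, |u x| ≤ 4) {f : ℝ → ℝ} (hf : MemLp f 2 volume) :
    Integrable (fun x => cutoff ε x * (u x * f x)) volume := by
  refine (((integrable_cutoff_mul_sq hε hε1 hu hb).add
    (integrable_mul_cutoff (ε := ε) hf.integrable_sq))).mono'
    (continuous_cutoff.aestronglyMeasurable.mul (hu.aestronglyMeasurable.mul hf.1))
    (.of_forall fun x => ?_)
  have := cutoff_pos (ε := ε) x
  rw [Real.norm_eq_abs, abs_mul, abs_of_pos this, Pi.add_apply, ← mul_add]
  gcongr
  rw [abs_le]
  constructor <;> nlinarith [sq_nonneg (u x + f x), sq_nonneg (u x - f x)]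

theorem integrable_cutoff_firstOrd_sq (hε : 0 < ε) (hε1 : ε ≤ 1) (hu : Continuous u)
    (hb : ∀ x, |u x| ≤ 4) (m1 : MemLp du 2 volume) :
    Integrable (fun x => cutoff ε x * firstOrd u du x ^ 2) volume := by
  have i1 := integrable_mul_cutoff (ε := ε) m1.integrable_sq
  have i2 := integrable_cutoff_mul_mul hε hε1 hu hb
    (MemLp.continuous_mul m1 continuous_u₀ abs_u₀_le)
  have i3 := Integrable.continuous_mul (integrable_cutoff_mul_sq hε hε1 hu hb)
    (c := fun x => u₀ x ^ 2) (C := 1) (continuous_u₀.pow 2) fun x => by simpa using abs_u₀_le x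
  refine ((i1.add (i2.const_mul (2 * √2))).add (i3.const_mul 2)).congr (.of_forall fun x => ?_)
  simp only [Pi.add_apply, firstOrd]
  linear_combination (-cutoff ε x * u₀ x ^ 2 * u x ^ 2) * sqrt_two_sq

/-- A Poincaré inequality for the first-order operator: its kernel is spanned by `wt`, and
orthogonality to `wt` controls the kernel component. The constant does not depend on ε because the
inverse of the cutoff is at most (1 + x²)³ when ε ≤ 1. -/
theorem exists_integral_wt_mul_sq_le : ∃ C : ℝ, 0 ≤ C ∧ ∀ ε, 0 < ε → ε ≤ 1 → ∀ u du : ℝ → ℝ,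
    IsAC u du → (∀ x, |u x| ≤ 4) → MemLp du 2 volume → ∫ x, wt x * u x = 0 →
    ∫ x, wt x * u x ^ 2 ≤ C * ∫ x, cutoff ε x * firstOrd u du x ^ 2 := by
  obtain ⟨W, hW1, hW⟩ := exists_wt_le
  set J := ∫ x, jb x with hJ
  have hJ0 : 0 ≤ J := integral_jb_nonneg
  set m₁ := ∫ x, wt x ^ 2 with hm₁
  have hm₁' : 0 < m₁ := integral_wt_sq_pos
  refine ⟨(2 * W + 2 * ((W * J) * J / m₁ ^ 2) * W) * J, by positivity,
    fun ε hε hε1 u du hu hb m1 ho => ?_⟩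
  set A := ∫ x, cutoff ε x * firstOrd u du x ^ 2 with hA
  have iA := integrable_cutoff_firstOrd_sq hε hε1 hu.continuous hb m1
  have hA0 : 0 ≤ A := integral_nonneg fun x => mul_nonneg (cutoff_pos x).le (sq_nonneg _)
  -- The integrating factor is 1/`wt`, because the logarithmic derivative of `wt` is −√2 u₀.
  have hh : IsAC (fun x => (wt x)⁻¹ * u x) (fun x => (wt x)⁻¹ * firstOrd u du x) := by
    have h1 : IsAC (fun x => (wt x)⁻¹) (fun x => √2 * u₀ x * (wt x)⁻¹) := by
      refine .of_hasDerivAt (fun x => ?_) ((continuous_const.mul continuous_u₀).mul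
        (continuous_wt.inv₀ fun x => (wt_pos x).ne'))
      refine ((hasDerivAt_wt x).inv (wt_pos x).ne').congr_deriv ?_
      have := (wt_pos x).ne'
      field_simp
    refine (h1.mul hu).congr (fun x => rfl) fun x => ?_
    rw [firstOrd]; ring
  obtain ⟨c, hc⟩ : ∃ c, c = (wt 0)⁻¹ * u 0 := ⟨_, rfl⟩
  -- Both 1/`wt` and the inverse cutoff increase with |z|, so they are frozen at x. The
  -- exponentially large factor then cancels against the prefactor `wt x ^ 2`, leaving polynomial
  -- growth.
  have hr : ∀ x, (u x - c * wt x) ^ 2 ≤ (1 + x ^ 2) ^ 4 * A := fun x => by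
    have hw := wt_pos x
    have hθ := cutoff_pos (ε := ε) x
    have h1 := hh.sq_sub_le_of_le (iA.const_mul ((wt x ^ 2)⁻¹ * (cutoff ε x)⁻¹))
      (fun z => by have := cutoff_pos (ε := ε) z; positivity) x fun z hz => by
        have hwz := wt_pos z
        have a1 := wt_anti hz
        have a2 := cutoff_anti (ε := ε) hz
        have a3 : (wt z ^ 2)⁻¹ ≤ (wt x ^ 2)⁻¹ := by gcongr
        have a4 : 1 ≤ (cutoff ε x)⁻¹ * cutoff ε z := by
          rw [inv_mul_eq_div, le_div_iff₀ hθ]; linarith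
        calc ((wt z)⁻¹ * firstOrd u du z) ^ 2
            = (wt z ^ 2)⁻¹ * 1 * firstOrd u du z ^ 2 := by rw [mul_pow, inv_pow, mul_one]
          _ ≤ (wt x ^ 2)⁻¹ * ((cutoff ε x)⁻¹ * cutoff ε z) * firstOrd u du z ^ 2 := by gcongr
          _ = _ := by ring
    rw [integral_const_mul, ← hc, ← hA] at h1
    have h3 : (cutoff ε x)⁻¹ ≤ (1 + x ^ 2) ^ 3 := by
      have := jb_pow_le_cutoff hε.le hε1 x
      rw [jb, inv_pow] at this
      exact inv_le_of_inv_le₀ (by positivity) this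
    calc (u x - c * wt x) ^ 2 = wt x ^ 2 * ((wt x)⁻¹ * u x - c) ^ 2 := by
          field_simp
      _ ≤ wt x ^ 2 * (|x| * ((wt x ^ 2)⁻¹ * (cutoff ε x)⁻¹ * A)) := by gcongr
      _ = |x| * (cutoff ε x)⁻¹ * A := by field_simp
      _ ≤ (1 + x ^ 2) * (1 + x ^ 2) ^ 3 * A := by
        gcongr
        exact abs_le_one_add_sq x
      _ = _ := by ring
  have hrc : Continuous fun x => u x - c * wt x :=
    hu.continuous.sub (continuous_const.mul continuous_wt)
  have iwu : Integrable (fun x => wt x * u x) volume := by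
    simpa only [mul_comm] using Integrable.continuous_mul integrable_wt hu.continuous hb
  have hc2 : c ^ 2 ≤ (W * J) * J / m₁ ^ 2 * A := by
    have hfc : Continuous fun x => wt x * (1 + x ^ 2) ^ 3 := continuous_wt.mul (by fun_prop)
    have hf2 : ∀ x, (wt x * (1 + x ^ 2) ^ 3) ^ 2 ≤ W * jb x := fun x => by
      have hj := jb_pos x
      have hw := wt_pos x
      calc (wt x * (1 + x ^ 2) ^ 3) ^ 2 = wt x * wt x * (1 + x ^ 2) ^ 6 := by ring
        _ ≤ 1 * (W * jb x ^ 8) * (1 + x ^ 2) ^ 6 := by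
          gcongr
          · exact wt_le_one x
          · exact hW x
        _ = W * jb x * jb x * (jb x * (1 + x ^ 2)) ^ 6 := by ring
        _ ≤ W * jb x * 1 * 1 := by
          rw [jb_mul, one_pow]
          gcongr
          exact jb_le_one x
        _ = _ := by ring
    have hgc : Continuous fun x => jb x ^ 3 * (u x - c * wt x) := (continuous_jb.pow 3).mul hrc
    have hg2 : ∀ x, (jb x ^ 3 * (u x - c * wt x)) ^ 2 ≤ A * jb x := fun x => by
      have hj := jb_pos x
      calc (jb x ^ 3 * (u x - c * wt x)) ^ 2 = jb x ^ 6 * (u x - c * wt x) ^ 2 := by ring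
        _ ≤ jb x ^ 6 * ((1 + x ^ 2) ^ 4 * A) := by gcongr; exact hr x
        _ = A * jb x * jb x * (jb x * (1 + x ^ 2)) ^ 4 := by ring
        _ ≤ A * jb x * 1 * 1 := by
          rw [jb_mul, one_pow]
          gcongr
          exact jb_le_one x
        _ = _ := by ring
    have mf : MemLp (fun x => wt x * (1 + x ^ 2) ^ 3) 2 volume := by
      rw [memLp_two_iff_integrable_sq hfc.aestronglyMeasurable]
      refine (integrable_jb.const_mul W).mono' (hfc.pow 2).aestronglyMeasurable
        (.of_forall fun x => ?_)
      rw [Real.norm_eq_abs, abs_of_nonneg (sq_nonneg _)]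
      exact hf2 x
    have mg : MemLp (fun x => jb x ^ 3 * (u x - c * wt x)) 2 volume := by
      rw [memLp_two_iff_integrable_sq hgc.aestronglyMeasurable]
      refine (integrable_jb.const_mul A).mono' (hgc.pow 2).aestronglyMeasurable
        (.of_forall fun x => ?_)
      rw [Real.norm_eq_abs, abs_of_nonneg (sq_nonneg _)]
      exact hg2 x
    -- Pairing with `wt` isolates the kernel coefficient c, since u itself pairs to zero.
    have e1 : ∫ x, wt x * (1 + x ^ 2) ^ 3 * (jb x ^ 3 * (u x - c * wt x)) = -(c * m₁) := by
      have : ∀ x, wt x * (1 + x ^ 2) ^ 3 * (jb x ^ 3 * (u x - c * wt x))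
          = wt x * u x - c * wt x ^ 2 := fun x => by
        have : wt x * (1 + x ^ 2) ^ 3 * (jb x ^ 3 * (u x - c * wt x))
          = (jb x * (1 + x ^ 2)) ^ 3 * (wt x * (u x - c * wt x)) := by ring
        rw [this, jb_mul]; ring
      simp only [this]
      rw [integral_sub iwu (memLp_wt.integrable_sq.const_mul c), ho, integral_const_mul, zero_sub]
    have hcs := sq_integral_mul_le mf mg
    have b1 := integral_mono mf.integrable_sq (integrable_jb.const_mul W) hf2
    have b2 := integral_mono mg.integrable_sq (integrable_jb.const_mul A) hg2
    rw [integral_const_mul] at b1 b2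
    rw [e1] at hcs
    rw [div_mul_eq_mul_div, le_div_iff₀ (by positivity)]
    calc c ^ 2 * m₁ ^ 2 = (-(c * m₁)) ^ 2 := by ring
      _ ≤ _ := hcs
      _ ≤ (W * J) * (A * J) := by gcongr
      _ = _ := by ring
  have hpt : ∀ x, wt x * u x ^ 2 ≤ (2 * W * A + 2 * c ^ 2 * W) * jb x := fun x => by
    have hj := jb_pos x
    have hw := wt_pos x
    have b0 : u x ^ 2 ≤ 2 * (u x - c * wt x) ^ 2 + 2 * (c * wt x) ^ 2 := by
      linarith [sq_nonneg (u x - 2 * c * wt x)]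
    have b1 : wt x * (u x - c * wt x) ^ 2 ≤ W * A * jb x := by
      calc wt x * (u x - c * wt x) ^ 2 ≤ (W * jb x ^ 8) * ((1 + x ^ 2) ^ 4 * A) := by
            gcongr
            · exact hW x
            · exact hr x
        _ = W * A * jb x * jb x ^ 3 * (jb x * (1 + x ^ 2)) ^ 4 := by ring
        _ ≤ W * A * jb x * 1 * 1 := by
          rw [jb_mul, one_pow]
          gcongr
          exact pow_le_one₀ hj.le (jb_le_one x)
        _ = _ := by ring
    have b2 : wt x * (c * wt x) ^ 2 ≤ c ^ 2 * W * jb x := by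
      calc wt x * (c * wt x) ^ 2 = c ^ 2 * wt x * wt x ^ 2 := by ring
        _ ≤ c ^ 2 * (W * jb x ^ 8) * 1 := by
          gcongr
          · exact hW x
          · exact pow_le_one₀ hw.le (wt_le_one x)
        _ = c ^ 2 * W * jb x * jb x ^ 7 := by ring
        _ ≤ c ^ 2 * W * jb x * 1 := by
          gcongr
          exact pow_le_one₀ hj.le (jb_le_one x)
        _ = _ := by ring
    linarith [mul_le_mul_of_nonneg_left b0 hw.le]
  have iwu2 : Integrable (fun x => wt x * u x ^ 2) volume := by
    refine (integrable_jb.const_mul (2 * W * A + 2 * c ^ 2 * W)).mono' (continuous_wt.mul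
      (hu.continuous.pow 2)).aestronglyMeasurable (.of_forall fun x => ?_)
    rw [Real.norm_eq_abs, abs_of_nonneg (mul_nonneg (wt_pos x).le (sq_nonneg _))]
    exact hpt x
  have h1 := integral_mono iwu2 (integrable_jb.const_mul _) hpt
  rw [integral_const_mul] at h1
  have h2 := mul_le_mul_of_nonneg_right hc2 (show 0 ≤ W * J by positivity)
  linarith

end UCoercivity

section UCoercivity

variable {u du ddu : ℝ → ℝ} {ε : ℝ}

/-- The derivative of `firstOrd u du`. -/
noncomputable def firstOrd' (u du ddu : ℝ → ℝ) (x : ℝ) : ℝ :=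
  ddu x + √2 * u₀ x * du x + wt x * u x

/-- The density of the quadratic form in `u` of the second variation. -/
noncomputable def uForm (u du ddu : ℝ → ℝ) (x : ℝ) : ℝ :=
  ddu x ^ 2 + (3 * u₀ x ^ 2 - 2) * du x ^ 2 + wt x * u x ^ 2
    + 1 / 2 * (√2 * wt x * u x + 2 * u₀ x * du x) ^ 2
    + 1 / 2 * (3 * u₀ x ^ 2 - 2) * (2 * u₀ x * u x) ^ 2
    + 3 * √2 * wt x * (2 * u₀ x * u x) * du x

/-- Expand the square of u' + √2 u₀ u and integrate the cross term by parts. The derivative of the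
cutoff has the good sign, and the derivative of u₀, together with the replacement of u₀² by 1 −
`wt`, costs only multiples of `wt` u². -/
theorem integral_cutoff_le (hε : 0 < ε) (hε1 : ε ≤ 1) (hu : IsAC u du)
    (hb : ∀ x, |u x| ≤ 4) (m1 : MemLp du 2 volume) :
    ∫ x, cutoff ε x * (du x ^ 2 + u x ^ 2)
      ≤ (∫ x, cutoff ε x * firstOrd u du x ^ 2) + 3 * ∫ x, wt x * u x ^ 2 := by
  have iG := integrable_cutoff_firstOrd_sq hε hε1 hu.continuous hb m1
  have i1 := integrable_mul_cutoff (ε := ε) m1.integrable_sq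
  have i2 := integrable_cutoff_mul_sq hε hε1 hu.continuous hb
  have i3 : Integrable (fun x => wt x * u x ^ 2) volume := by
    have := Integrable.continuous_mul (Integrable.continuous_mul integrable_wt hu.continuous hb)
      hu.continuous hb
    exact this.congr (.of_forall fun x => by ring)
  have i4 : Integrable (fun x => √2 * (cutoff ε x * (u₀ x * (u x * u x)))) volume := by
    refine ((Integrable.continuous_mul i2 continuous_u₀ abs_u₀_le).const_mul √2).congr
      (.of_forall fun x => ?_)
    ring
  have hB := (isAC_cutoff (ε := ε).mul (isAC_u₀.mul (hu.mul hu))).const_mul √2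
  have i5 : Integrable (fun x => √2 * (cutoff' ε x * (u₀ x * (u x * u x)))) volume := by
    refine ((i2.const_mul (3 * √2))).mono' ((continuous_const.mul (continuous_cutoff'.mul
      (continuous_u₀.mul (hu.continuous.mul hu.continuous))))).aestronglyMeasurable
      (.of_forall fun x => ?_)
    have h1 := abs_cutoff'_le hε.le x
    have h2 := abs_u₀_le x
    have h3 := cutoff_pos (ε := ε) x
    rw [Real.norm_eq_abs, abs_mul, abs_mul, abs_mul, abs_of_pos sqrt_two_pos, ← sq,
      abs_of_nonneg (sq_nonneg (u x))]
    calc √2 * (|cutoff' ε x| * (|u₀ x| * u x ^ 2))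
        ≤ √2 * ((3 * 1 * cutoff ε x) * (1 * u x ^ 2)) := by
          gcongr
          exact h1.trans (by gcongr)
      _ = _ := by ring
  have i6 : Integrable (fun x => cutoff ε x * (u x * (u₀ x * du x))) volume :=
    integrable_cutoff_mul_mul hε hε1 hu.continuous hb
      (MemLp.continuous_mul m1 continuous_u₀ abs_u₀_le)
  have i7 : Integrable (fun x => wt x * (cutoff ε x * u x ^ 2)) volume :=
    Integrable.continuous_mul i2 continuous_wt abs_wt_le
  have hB' : IsAC (fun x => √2 * (cutoff ε x * (u₀ x * (u x * u x))))
      (fun x => √2 * (cutoff' ε x * (u₀ x * (u x * u x))) + wt x * (cutoff ε x * u x ^ 2)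
        + 2 * √2 * (cutoff ε x * (u x * (u₀ x * du x)))) := by
    refine hB.congr (fun x => rfl) fun x => ?_
    linear_combination (wt x * cutoff ε x * u x ^ 2 / 2) * sqrt_two_sq
  have iB' : Integrable (fun x => √2 * (cutoff' ε x * (u₀ x * (u x * u x)))
      + wt x * (cutoff ε x * u x ^ 2) + 2 * √2 * (cutoff ε x * (u x * (u₀ x * du x)))) volume :=
    (i5.add i7).add (i6.const_mul (2 * √2))
  have h0 := hB'.integral_eq_zero i4 iB'
  have hle : ∀ x, cutoff ε x * (du x ^ 2 + u x ^ 2)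
      + (√2 * (cutoff' ε x * (u₀ x * (u x * u x))) + wt x * (cutoff ε x * u x ^ 2)
        + 2 * √2 * (cutoff ε x * (u x * (u₀ x * du x))))
      ≤ cutoff ε x * firstOrd u du x ^ 2 + 3 * (wt x * u x ^ 2) := fun x => by
    have h1 : √2 * (cutoff' ε x * (u₀ x * (u x * u x))) ≤ 0 := by
      have := mul_nonneg sqrt_two_pos.le (mul_nonneg (neg_nonneg.2 (cutoff'_mul_u₀_nonpos
        (ε := ε) x)) (sq_nonneg (u x)))
      linarith
    have h2 : wt x * (cutoff ε x * u x ^ 2) ≤ wt x * u x ^ 2 := by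
      refine mul_le_mul_of_nonneg_left ?_ (wt_pos x).le
      exact mul_le_of_le_one_left (sq_nonneg _) (cutoff_le_one x)
    have h3 : cutoff ε x * firstOrd u du x ^ 2 = cutoff ε x * du x ^ 2
        + 2 * √2 * (cutoff ε x * (u x * (u₀ x * du x)))
        + 2 * (cutoff ε x * u x ^ 2) - 2 * (wt x * (cutoff ε x * u x ^ 2)) := by
      rw [firstOrd, wt]
      linear_combination (cutoff ε x * u₀ x ^ 2 * u x ^ 2) * sqrt_two_sq
    have h4 := mul_nonneg (cutoff_pos (ε := ε) x).le (sq_nonneg (u x))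
    rw [h3]
    linarith
  have iL : Integrable (fun x => cutoff ε x * (du x ^ 2 + u x ^ 2)) volume :=
    (i1.add i2).congr (.of_forall fun x => (mul_add _ _ _).symm)
  have h1 := integral_mono (iL.add iB') (iG.add (i3.const_mul 3)) hle
  simp only [Pi.add_apply] at h1
  rw [integral_add iL iB', integral_add iG (i3.const_mul 3), integral_const_mul, h0] at h1
  linarith

theorem integrable_cutoff_firstOrd'_sq (hu : Continuous u)
    (hb : ∀ x, |u x| ≤ 4) (m1 : MemLp du 2 volume) (m2 : MemLp ddu 2 volume) :
    Integrable (fun x => cutoff ε x * firstOrd' u du ddu x ^ 2) volume := by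
  have mw : MemLp (fun x => wt x * u x) 2 volume := by
    simpa only [mul_comm] using MemLp.continuous_mul memLp_wt hu hb
  refine (integrable_mul_cutoff (ε := ε) ((m2.add ((MemLp.continuous_mul m1 continuous_u₀
    abs_u₀_le).const_mul √2)).add mw).integrable_sq).congr (.of_forall fun x => ?_)
  simp only [Pi.add_apply, firstOrd']
  ring

theorem integrable_cutoff_uForm (hε : 0 < ε) (hε1 : ε ≤ 1) (hu : Continuous u)
    (hb : ∀ x, |u x| ≤ 4) (m1 : MemLp du 2 volume) (m2 : MemLp ddu 2 volume) :
    Integrable (fun x => cutoff ε x * uForm u du ddu x) volume := by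
  have c1 : Continuous fun x => 3 * u₀ x ^ 2 - 2 :=
    (continuous_const.mul (continuous_u₀.pow 2)).sub continuous_const
  have b1 : ∀ x, |3 * u₀ x ^ 2 - 2| ≤ 2 := fun x => by
    rw [abs_le]; constructor <;> nlinarith [u₀_sq_le x, sq_nonneg (u₀ x)]
  have mw : MemLp (fun x => wt x * u x) 2 volume := by
    simpa only [mul_comm] using MemLp.continuous_mul memLp_wt hu hb
  have i2 := integrable_cutoff_mul_sq hε hε1 hu hb
  have a1 := integrable_mul_cutoff (ε := ε) (m2.integrable_sq.add
    (Integrable.continuous_mul m1.integrable_sq c1 b1))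
  have a2 := Integrable.continuous_mul i2 continuous_wt abs_wt_le
  have a3 := integrable_mul_cutoff (ε := ε) ((mw.const_mul √2).add ((MemLp.continuous_mul m1
    continuous_u₀ abs_u₀_le).const_mul 2)).integrable_sq
  have a4 := Integrable.continuous_mul (Integrable.continuous_mul (Integrable.continuous_mul i2
    continuous_u₀ abs_u₀_le) continuous_u₀ abs_u₀_le) c1 b1
  have a5 := integrable_mul_cutoff (ε := ε) (mw.integrable_mul (MemLp.continuous_mul m1
    continuous_u₀ abs_u₀_le))
  refine ((((a1.add a2).add (a3.const_mul (1 / 2))).add (a4.const_mul 2)).add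
    (a5.const_mul (6 * √2))).congr (.of_forall fun x => ?_)
  simp only [Pi.add_apply, Pi.mul_apply, uForm]
  ring

/-- The form equals the sum of the squares of G = u' + √2 u₀ u and of G' minus an exact derivative
β'. Against the cutoff, β' leaves the cutoff derivative times β, and 30ε is the product of 3ε for
the cutoff and 10 for β. -/
theorem integral_cutoff_uForm_ge (hε : 0 < ε) (hε1 : ε ≤ 1) (hu : IsAC u du) (hdu : IsAC du ddu)
    (hb : ∀ x, |u x| ≤ 4) (m1 : MemLp du 2 volume) (m2 : MemLp ddu 2 volume) :
    (∫ x, cutoff ε x * firstOrd' u du ddu x ^ 2) + (∫ x, cutoff ε x * firstOrd u du x ^ 2)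
      - 30 * ε * ∫ x, cutoff ε x * (du x ^ 2 + u x ^ 2)
      ≤ ∫ x, cutoff ε x * uForm u du ddu x := by
  have iG := integrable_cutoff_firstOrd_sq hε hε1 hu.continuous hb m1
  have iG' := integrable_cutoff_firstOrd'_sq (ε := ε) hu.continuous hb m1 m2
  have iF := integrable_cutoff_uForm hε hε1 hu.continuous hb m1 m2
  have i1 := integrable_mul_cutoff (ε := ε) m1.integrable_sq
  have i2 := integrable_cutoff_mul_sq hε hε1 hu.continuous hb
  have iL : Integrable (fun x => cutoff ε x * (du x ^ 2 + u x ^ 2)) volume :=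
    (i1.add i2).congr (.of_forall fun x => (mul_add _ _ _).symm)
  have hβ := ((isAC_u₀.mul (hdu.mul hdu)).const_mul √2).add (((isAC_wt.mul
    (hu.mul hdu)).const_mul 2).add ((isAC_u₀.mul (hu.mul hu)).const_mul √2 |>.sub
      ((isAC_u₀.mul (isAC_wt.mul (hu.mul hu))).const_mul (2 * √2))))
  set β : ℝ → ℝ := fun x => √2 * (u₀ x * (du x * du x)) + (2 * (wt x * (u x * du x))
    + (√2 * (u₀ x * (u x * u x)) - 2 * √2 * (u₀ x * (wt x * (u x * u x))))) with hβdef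
  have hβ' : IsAC β (fun x => firstOrd' u du ddu x ^ 2 + firstOrd u du x ^ 2
      - uForm u du ddu x) := by
    refine hβ.congr (fun x => rfl) fun x => ?_
    have h2 := sqrt_two_sq
    simp only [firstOrd, firstOrd', uForm, wt]
    ring_nf
    simp only [h2]
    ring
  have hβb : ∀ x, |β x| ≤ 10 * (du x ^ 2 + u x ^ 2) := fun x => by
    have ht := abs_u₀_le x
    have hw := abs_wt_le x
    have hs : √2 ≤ 2 := by nlinarith [sqrt_two_sq, sqrt_two_pos]
    have e1 : |√2 * (u₀ x * (du x * du x))| ≤ 2 * du x ^ 2 := by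
      rw [abs_mul, abs_mul, ← sq, abs_of_pos sqrt_two_pos, abs_of_nonneg (sq_nonneg (du x))]
      exact mul_le_mul hs (mul_le_of_le_one_left (sq_nonneg _) ht) (by positivity) (by norm_num)
    have e2 : |2 * (wt x * (u x * du x))| ≤ u x ^ 2 + du x ^ 2 := by
      rw [abs_mul, abs_mul, abs_two]
      have : |u x * du x| ≤ (u x ^ 2 + du x ^ 2) / 2 := by
        rw [abs_le]; constructor <;> nlinarith [sq_nonneg (u x + du x), sq_nonneg (u x - du x)]
      have := (mul_le_of_le_one_left (abs_nonneg _) hw).trans this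
      linarith
    have e3 : |√2 * (u₀ x * (u x * u x))| ≤ 2 * u x ^ 2 := by
      rw [abs_mul, abs_mul, ← sq, abs_of_pos sqrt_two_pos, abs_of_nonneg (sq_nonneg (u x))]
      exact mul_le_mul hs (mul_le_of_le_one_left (sq_nonneg _) ht) (by positivity) (by norm_num)
    have e4 : |2 * √2 * (u₀ x * (wt x * (u x * u x)))| ≤ 4 * u x ^ 2 := by
      rw [abs_mul (2 * √2), abs_mul (u₀ x), abs_mul (wt x), ← sq, abs_of_nonneg (sq_nonneg (u x)),
        abs_of_pos (show 0 < 2 * √(2 : ℝ) by positivity)]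
      have := mul_le_of_le_one_left (mul_nonneg (abs_nonneg (wt x)) (sq_nonneg (u x))) ht
      refine mul_le_mul (by linarith) (this.trans (mul_le_of_le_one_left (sq_nonneg _) hw))
        (by positivity) (by norm_num)
    have := abs_le.1 e1
    have := abs_le.1 e2
    have := abs_le.1 e3
    have := abs_le.1 e4
    have := sq_nonneg (u x)
    have := sq_nonneg (du x)
    simp only [hβdef]
    rw [abs_le]; constructor <;> linarith
  have hθβ := (isAC_cutoff (ε := ε)).mul hβ'
  have hb2 : ∀ x, |cutoff' ε x * β x| ≤ 30 * ε * (cutoff ε x * (du x ^ 2 + u x ^ 2)) := fun x => by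
    rw [abs_mul]
    calc |cutoff' ε x| * |β x| ≤ (3 * ε * cutoff ε x) * (10 * (du x ^ 2 + u x ^ 2)) :=
          mul_le_mul (abs_cutoff'_le hε.le x) (hβb x) (abs_nonneg _)
            (by have := cutoff_pos (ε := ε) x; positivity)
      _ = _ := by ring
  have i3 : Integrable (fun x => cutoff' ε x * β x) volume :=
    (iL.const_mul (30 * ε)).mono' (continuous_cutoff'.mul hβ'.continuous).aestronglyMeasurable
      (.of_forall hb2)
  have i4 : Integrable (fun x => cutoff ε x * β x) volume := by
    refine (iL.const_mul 10).mono' (continuous_cutoff.mul hβ'.continuous).aestronglyMeasurable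
      (.of_forall fun x => ?_)
    have := cutoff_pos (ε := ε) x
    rw [Real.norm_eq_abs, abs_mul, abs_of_pos this]
    linarith [mul_le_mul_of_nonneg_left (hβb x) this.le]
  have i5 : Integrable (fun x => cutoff ε x * (firstOrd' u du ddu x ^ 2 + firstOrd u du x ^ 2
      - uForm u du ddu x)) volume :=
    ((iG'.add iG).sub iF).congr (.of_forall fun x => by
      simp only [Pi.add_apply, Pi.sub_apply]; ring)
  have h0 := hθβ.integral_eq_zero i4 (i3.add i5)
  rw [integral_add i3 i5] at h0
  have h1 : ∫ x, cutoff ε x * (firstOrd' u du ddu x ^ 2 + firstOrd u du x ^ 2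
      - uForm u du ddu x) = (∫ x, cutoff ε x * firstOrd' u du ddu x ^ 2)
        + (∫ x, cutoff ε x * firstOrd u du x ^ 2) - ∫ x, cutoff ε x * uForm u du ddu x := by
    rw [← integral_add iG' iG, ← integral_sub (f := fun x => _ + _) (iG'.add iG) iF]
    congr 1; ext x; ring
  have h2 := integral_mono (iL.const_mul (30 * ε)).neg i3 fun x => (abs_le.1 (hb2 x)).1
  simp only [Pi.neg_apply] at h2
  rw [integral_neg, integral_const_mul] at h2
  linarith

/-- Coercivity of the localized quadratic form in `u` under the orthogonality condition. -/
theorem exists_uForm_coercive : ∃ c : ℝ, 0 < c ∧ ∀ ε, 0 < ε → ε ≤ 1 → ∀ u du ddu : ℝ → ℝ,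
    IsAC u du → IsAC du ddu → (∀ x, |u x| ≤ 4) → MemLp du 2 volume → MemLp ddu 2 volume →
    ∫ x, wt x * u x = 0 →
    (c - 30 * ε) * ∫ x, cutoff ε x * (ddu x ^ 2 + du x ^ 2 + u x ^ 2)
      ≤ ∫ x, cutoff ε x * uForm u du ddu x := by
  obtain ⟨C, hC0, hC⟩ := exists_integral_wt_mul_sq_le
  -- With X, L, A and A' the weighted integrals named below, X ≤ 3A' + 6L and L ≤ (1 + 3C)A, so X +
  -- L is at most 3A' + 7(1 + 3C)A.
  refine ⟨(7 * (1 + 3 * C) + 3)⁻¹, by positivity, fun ε hε hε1 u du ddu hu hdu hb m1 m2 ho => ?_⟩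
  have hge := integral_cutoff_uForm_ge hε hε1 hu hdu hb m1 m2
  have h1 := integral_cutoff_le hε hε1 hu hb m1
  have h2 := hC ε hε hε1 u du hu hb m1 ho
  have i0 := integrable_mul_cutoff (ε := ε) m2.integrable_sq
  have i1 := integrable_mul_cutoff (ε := ε) m1.integrable_sq
  have i2 := integrable_cutoff_mul_sq hε hε1 hu.continuous hb
  have iL : Integrable (fun x => cutoff ε x * (du x ^ 2 + u x ^ 2)) volume :=
    (i1.add i2).congr (.of_forall fun x => (mul_add _ _ _).symm)
  have iG' := integrable_cutoff_firstOrd'_sq (ε := ε) hu.continuous hb m1 m2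
  have e : ∫ x, cutoff ε x * (ddu x ^ 2 + du x ^ 2 + u x ^ 2)
      = (∫ x, cutoff ε x * ddu x ^ 2) + ∫ x, cutoff ε x * (du x ^ 2 + u x ^ 2) := by
    rw [← integral_add i0 iL]; congr 1; ext x; ring
  have h3 : ∫ x, cutoff ε x * ddu x ^ 2 ≤ 3 * (∫ x, cutoff ε x * firstOrd' u du ddu x ^ 2)
      + 6 * ∫ x, cutoff ε x * (du x ^ 2 + u x ^ 2) := by
    rw [← integral_const_mul, ← integral_const_mul, ← integral_add (iG'.const_mul 3)
      (iL.const_mul 6)]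
    refine integral_mono i0 ((iG'.const_mul 3).add (iL.const_mul 6)) fun x => ?_
    have hθ := cutoff_pos (ε := ε) x
    have a1 := sq_sub_sub_le_three (firstOrd' u du ddu x) (√2 * u₀ x * du x) (wt x * u x)
    have a2 : firstOrd' u du ddu x - √2 * u₀ x * du x - wt x * u x = ddu x := by
      rw [firstOrd']; ring
    have a3 : (√2 * u₀ x * du x) ^ 2 ≤ 2 * du x ^ 2 := by
      rw [mul_pow, mul_pow, sqrt_two_sq]
      have := mul_le_of_le_one_left (sq_nonneg (du x)) (u₀_sq_le x)
      linarith
    have a4 : (wt x * u x) ^ 2 ≤ u x ^ 2 := by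
      rw [mul_pow]
      exact mul_le_of_le_one_left (sq_nonneg _) (pow_le_one₀ (wt_pos x).le (wt_le_one x))
    rw [a2] at a1
    have a5 : ddu x ^ 2 ≤ 3 * firstOrd' u du ddu x ^ 2 + 6 * (du x ^ 2 + u x ^ 2) := by
      linarith [sq_nonneg (u x)]
    have := mul_le_mul_of_nonneg_left a5 hθ.le
    simp only
    linarith
  have n0 : 0 ≤ ∫ x, cutoff ε x * ddu x ^ 2 :=
    integral_nonneg fun x => mul_nonneg (cutoff_pos x).le (sq_nonneg _)
  have n1 : 0 ≤ ∫ x, cutoff ε x * firstOrd' u du ddu x ^ 2 :=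
    integral_nonneg fun x => mul_nonneg (cutoff_pos x).le (sq_nonneg _)
  rw [e, sub_mul]
  set X := ∫ x, cutoff ε x * ddu x ^ 2
  set L := ∫ x, cutoff ε x * (du x ^ 2 + u x ^ 2)
  set A := ∫ x, cutoff ε x * firstOrd u du x ^ 2
  set A' := ∫ x, cutoff ε x * firstOrd' u du ddu x ^ 2
  have h4 : L ≤ (1 + 3 * C) * A := by linarith
  have h5 : (7 * (1 + 3 * C) + 3)⁻¹ * (X + L) ≤ A' + A := by
    rw [inv_mul_le_iff₀ (by positivity)]
    have : 0 ≤ C * A' := mul_nonneg hC0 n1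
    have n2 : 0 ≤ A := integral_nonneg fun x => mul_nonneg (cutoff_pos x).le (sq_nonneg _)
    linarith
  have h6 : 30 * ε * L ≤ 30 * ε * (X + L) := by
    gcongr; linarith
  linarith

end UCoercivity

/-! ### Pointwise comparison of the forms in u and in (u, η) -/

section Pointwise

/-- The error made by replacing `eta` by its linear part in the quadratic form. -/
noncomputable def uFormErr (u du v dv : ℝ → ℝ) (x : ℝ) : ℝ :=
  (√2 * wt x * u x + 2 * u₀ x * du x) * (2 * (u x * du x + v x * dv x))
    + 1 / 2 * (2 * (u x * du x + v x * dv x)) ^ 2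
    + 1 / 2 * (3 * u₀ x ^ 2 - 2)
      * (2 * (2 * u₀ x * u x) * (u x ^ 2 + v x ^ 2) + (u x ^ 2 + v x ^ 2) ^ 2)
    + 3 * √2 * wt x * (u x ^ 2 + v x ^ 2) * du x

/-- Every term of the error has degree at least three in (u, v, u', v'), so one factor ρ comes out
besides a quadratic expression. With j = (1 + x²)^(1/2) the hypotheses are the linear growth of u²
and v², and the powers of j are the price paid later by the cutoff. -/
theorem abs_uFormErr_le {u du v dv : ℝ → ℝ} {x R ρ j : ℝ} (hR : 1 ≤ R) (hρ : 0 ≤ ρ) (hj : 1 ≤ j)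
    (hu : u x ^ 2 ≤ 4 * j ^ 2 * ρ ^ 2) (hv : v x ^ 2 ≤ 4 * R * j ^ 2 * ρ ^ 2) :
    |uFormErr u du v dv x|
      ≤ 200 * R ^ 2 * (ρ + ρ ^ 2) * (j ^ 4 * ρ ^ 2 + j ^ 2 * (du x ^ 2 + dv x ^ 2)) := by
  rw [uFormErr]
  have ht := abs_u₀_le x
  have hw0 := wt_pos x
  have hw := wt_le_one x
  have hs0 := sqrt_two_pos
  have hs : √2 ≤ 2 := by nlinarith [sqrt_two_sq]
  have ht2 := u₀_sq_le x
  generalize u₀ x = t at *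
  generalize wt x = w at *
  generalize √2 = s at *
  generalize u x = a at *
  generalize v x = b at *
  generalize du x = da at *
  generalize dv x = db at *
  have hN0 : 0 ≤ a ^ 2 + b ^ 2 := by positivity
  have hN : a ^ 2 + b ^ 2 ≤ 8 * R * j ^ 2 * ρ ^ 2 := by
    have : 4 * j ^ 2 * ρ ^ 2 ≤ R * (4 * j ^ 2 * ρ ^ 2) := le_mul_of_one_le_left (by positivity) hR
    linarith
  have ha : |a| ≤ 2 * j * ρ := abs_le_of_sq_le_sq (by linarith) (by positivity)
  have hb : |b| ≤ 2 * R * j * ρ := by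
    refine abs_le_of_sq_le_sq (hv.trans ?_) (by positivity)
    have : 4 * R * j ^ 2 * ρ ^ 2 ≤ R * (4 * R * j ^ 2 * ρ ^ 2) :=
      le_mul_of_one_le_left (by positivity) hR
    linarith
  have ha' : |a| ≤ 2 * R * j * ρ := ha.trans (by
    have : 2 * j * ρ ≤ R * (2 * j * ρ) := le_mul_of_one_le_left (by positivity) hR
    linarith)
  have j2 : j ≤ j ^ 2 := by nlinarith
  have j3 : j ^ 3 ≤ j ^ 4 := pow_le_pow_right₀ hj (by norm_num)
  have j4 : j ^ 2 ≤ j ^ 4 := pow_le_pow_right₀ hj (by norm_num)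
  have R2 : R ≤ R ^ 2 := by nlinarith
  set D := da ^ 2 + db ^ 2 with hD
  have hD0 : 0 ≤ D := by positivity
  have e1 : |(s * w * a + 2 * t * da) * (2 * (a * da + b * db))|
      ≤ R ^ 2 * ρ * (32 * (j ^ 4 * ρ ^ 2) + 16 * (j ^ 2 * D)) := by
    have c1 : |s * w * a + 2 * t * da| ≤ 2 * (2 * j * ρ + |da|) := by
      refine (abs_add_le _ _).trans ?_
      rw [abs_mul, abs_mul, abs_mul, abs_mul, abs_of_pos hs0, abs_of_pos hw0, abs_two]
      have d1 : s * w * |a| ≤ 2 * 1 * (2 * j * ρ) := by gcongr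
      have d2 : 2 * |t| * |da| ≤ 2 * 1 * |da| := by gcongr
      linarith
    have c2 : |2 * (a * da + b * db)| ≤ 2 * ((2 * R * j * ρ) * (|da| + |db|)) := by
      rw [abs_mul, abs_two]
      refine mul_le_mul_of_nonneg_left ((abs_add_le _ _).trans ?_) zero_le_two
      rw [abs_mul, abs_mul, mul_add]
      gcongr
    have c3 : (2 * j * ρ + |da|) * (|da| + |db|) ≤ 4 * j ^ 2 * ρ ^ 2 + 2 * D := by
      have := sq_nonneg ((2 * j * ρ + |da|) - (|da| + |db|))
      have := sq_nonneg (2 * j * ρ - |da|)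
      have := sq_nonneg (|da| - |db|)
      rw [hD, ← sq_abs da, ← sq_abs db]
      linarith [sq_nonneg |db|]
    rw [abs_mul]
    calc |s * w * a + 2 * t * da| * |2 * (a * da + b * db)|
        ≤ (2 * (2 * j * ρ + |da|)) * (2 * ((2 * R * j * ρ) * (|da| + |db|))) :=
          mul_le_mul c1 c2 (abs_nonneg _) (by positivity)
      _ = 8 * R * ρ * j * ((2 * j * ρ + |da|) * (|da| + |db|)) := by ring
      _ ≤ 8 * R * ρ * j * (4 * j ^ 2 * ρ ^ 2 + 2 * D) := by gcongr
      _ = R * ρ * (32 * (j ^ 3 * ρ ^ 2) + 16 * (j * D)) := by ring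
      _ ≤ _ := by gcongr
  have e2 : |1 / 2 * (2 * (a * da + b * db)) ^ 2| ≤ R ^ 2 * ρ ^ 2 * (16 * (j ^ 2 * D)) := by
    rw [abs_of_nonneg (by positivity)]
    calc 1 / 2 * (2 * (a * da + b * db)) ^ 2 ≤ 2 * ((a ^ 2 + b ^ 2) * D) := by
          rw [hD]; linarith [sq_nonneg (a * db - b * da)]
      _ ≤ 2 * ((8 * R * j ^ 2 * ρ ^ 2) * D) := by gcongr
      _ = R * ρ ^ 2 * (16 * (j ^ 2 * D)) := by ring
      _ ≤ _ := by gcongr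
  have e3 : |1 / 2 * (3 * t ^ 2 - 2) * (2 * (2 * t * a) * (a ^ 2 + b ^ 2) + (a ^ 2 + b ^ 2) ^ 2)|
      ≤ R ^ 2 * (ρ + ρ ^ 2) * (64 * (j ^ 4 * ρ ^ 2)) := by
    rw [abs_mul]
    have c1 : |1 / 2 * (3 * t ^ 2 - 2)| ≤ 1 := by
      rw [abs_le]; constructor <;> linarith [sq_nonneg t]
    have c2 : |2 * (2 * t * a) * (a ^ 2 + b ^ 2) + (a ^ 2 + b ^ 2) ^ 2|
        ≤ 4 * (1 * (2 * j * ρ)) * (8 * R * j ^ 2 * ρ ^ 2) + (8 * R * j ^ 2 * ρ ^ 2) ^ 2 := by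
      refine (abs_add_le _ _).trans ?_
      rw [abs_mul, abs_of_nonneg hN0, abs_of_nonneg (sq_nonneg (a ^ 2 + b ^ 2))]
      have : |2 * (2 * t * a)| = 4 * (|t| * |a|) := by
        rw [abs_mul, abs_mul, abs_mul, abs_two]; ring
      rw [this]
      gcongr
    have c3 : (R * ρ) * (64 * (j ^ 3 * ρ ^ 2)) ≤ (R ^ 2 * ρ) * (64 * (j ^ 4 * ρ ^ 2)) := by
      gcongr
    have := mul_le_mul c1 c2 (abs_nonneg _) zero_le_one
    linarith
  have e4 : |3 * s * w * (a ^ 2 + b ^ 2) * da|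
      ≤ R ^ 2 * ρ * (24 * (j ^ 4 * ρ ^ 2) + 24 * (j ^ 2 * D)) := by
    rw [abs_mul, abs_of_nonneg (by positivity)]
    have c1 : ρ * |da| ≤ (ρ ^ 2 + D) / 2 := by
      rw [hD, ← sq_abs da]; linarith [sq_nonneg (ρ - |da|), sq_nonneg db]
    calc 3 * s * w * (a ^ 2 + b ^ 2) * |da|
        ≤ 3 * 2 * 1 * (8 * R * j ^ 2 * ρ ^ 2) * |da| := by gcongr
      _ = 48 * R * j ^ 2 * ρ * (ρ * |da|) := by ring
      _ ≤ 48 * R * j ^ 2 * ρ * ((ρ ^ 2 + D) / 2) := by gcongr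
      _ = R * ρ * (24 * (j ^ 2 * ρ ^ 2) + 24 * (j ^ 2 * D)) := by ring
      _ ≤ _ := by gcongr
  have h1 : 0 ≤ R ^ 2 * ρ * (j ^ 4 * ρ ^ 2) := by positivity
  have h2 : 0 ≤ R ^ 2 * ρ * (j ^ 2 * D) := by positivity
  have h3 : 0 ≤ R ^ 2 * ρ ^ 2 * (j ^ 4 * ρ ^ 2) := by positivity
  have h4 : 0 ≤ R ^ 2 * ρ ^ 2 * (j ^ 2 * D) := by positivity
  refine ((abs_add_le _ _).trans (add_le_add ((abs_add_le _ _).trans (add_le_add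
    ((abs_add_le _ _).trans (add_le_add e1 e2)) e3)) e4)).trans ?_
  linarith

/-- The density of the quadratic form in `(u, η)`, with `η` an independent variable. -/
noncomputable def uEtaForm (u du ddu v dv : ℝ → ℝ) (x : ℝ) : ℝ :=
  ddu x ^ 2 + (3 * u₀ x ^ 2 - 2) * du x ^ 2 + wt x * u x ^ 2
    + 1 / 2 * deta u du v dv x ^ 2 + 1 / 2 * (3 * u₀ x ^ 2 - 2) * eta u v x ^ 2
    + 3 * √2 * wt x * eta u v x * du x

theorem uEtaForm_eq (u du ddu v dv : ℝ → ℝ) (x : ℝ) :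
    uEtaForm u du ddu v dv x = uForm u du ddu x + uFormErr u du v dv x := by
  rw [uEtaForm, uForm, uFormErr, deta, eta_eq]; ring

theorem lamDensity_eq (u du ddu v dv ddv : ℝ → ℝ) (x : ℝ) :
    lamDensity u du ddu v dv ddv x
      = (ddv x ^ 2 + (3 * u₀ x ^ 2 - 2) * dv x ^ 2 + wt x * v x ^ 2) + uEtaForm u du ddu v dv x
        + (3 * eta u v x * (du x ^ 2 + dv x ^ 2) + 1 / 2 * eta u v x ^ 3) := by
  rw [lamDensity, uEtaForm]; ring

/-- Writing u₀² as 1 − `wt` leaves a constant-coefficient positive form plus terms carrying `wt`;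
the mixed term in η u' is handled by completing a square. -/
theorem uEtaForm_ge (u du ddu v dv : ℝ → ℝ) (x : ℝ) :
    1 / 2 * (ddu x ^ 2 + du x ^ 2 + deta u du v dv x ^ 2 + eta u v x ^ 2)
      - wt x * (6 * du x ^ 2 + 3 * eta u v x ^ 2) ≤ uEtaForm u du ddu v dv x := by
  have h : 0 ≤ 3 / 2 * wt x * (√2 * du x + eta u v x) ^ 2 := by
    have := wt_pos x; positivity
  have e : 3 / 2 * wt x * (√2 * du x + eta u v x) ^ 2 = 3 * wt x * du x ^ 2
      + 3 / 2 * wt x * eta u v x ^ 2 + 3 * √2 * wt x * eta u v x * du x := by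
    linear_combination (3 / 2 * wt x * du x ^ 2) * sqrt_two_sq
  have h2 := mul_nonneg (wt_pos x).le (sq_nonneg (u x))
  rw [uEtaForm, u₀_sq]
  rw [e] at h
  linarith [sq_nonneg (ddu x), sq_nonneg (du x)]

end Pointwise

/-! ### Nonlinear estimates in terms of ρ -/

/-- The quantities entering `ρ` that control the nonlinear terms are at most `ρ²`. -/
structure Controlled (R ρ : ℝ) (u du v dv : ℝ → ℝ) : Prop where
  one_le : 1 ≤ R
  nonneg : 0 ≤ ρ
  du_le : ∫ x, du x ^ 2 ≤ ρ ^ 2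
  dv_le : ∫ x, dv x ^ 2 ≤ ρ ^ 2
  u_le : ∫ x in Icc (-R) R, u x ^ 2 ≤ ρ ^ 2
  v_le : ∫ x in Icc (-R) R, v x ^ 2 ≤ R ^ 2 * ρ ^ 2
  eta_le : ∫ x in {x : ℝ | R ≤ |x|}, (deta u du v dv x ^ 2 + eta u v x ^ 2) ≤ ρ ^ 2

namespace Controlled

variable {u du ddu v dv ddv : ℝ → ℝ} {R ρ : ℝ}

theorem u_sq_le (h : SmallPair u du ddu v dv ddv) (k : Controlled R ρ u du v dv) (x : ℝ) :
    u x ^ 2 ≤ (3 + 2 * |x|) * ρ ^ 2 := by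
  obtain ⟨y, hy, hle⟩ := exists_mem_Icc_sq_le h.continuous_u (show (-1 : ℝ) < 1 by norm_num)
  have h1 : ∫ x in Icc (-1) 1, u x ^ 2 ≤ ∫ x in Icc (-R) R, u x ^ 2 :=
    setIntegral_mono_set (h.continuous_u.pow 2).integrableOn_Icc
      (.of_forall fun x => sq_nonneg _)
      (Icc_subset_Icc (by linarith [k.one_le]) k.one_le).eventuallyLE
  have h2 := h.u_ac.sq_sub_le h.du_mem x y
  have h3 : |x - y| ≤ |x| + 1 := (abs_sub x y).trans (by
    have : |y| ≤ 1 := abs_le.2 hy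
    linarith)
  have h4 : |x - y| * ∫ z, du z ^ 2 ≤ (|x| + 1) * ρ ^ 2 :=
    mul_le_mul h3 k.du_le (integral_nonneg fun x => sq_nonneg _) (by positivity)
  have h5 := k.u_le
  linarith [sq_nonneg (u x - 2 * u y)]

/-- The reference point is taken in [−R, R] rather than [−1, 1]: averaging over length 2R turns the
available bound R²ρ² into one of order Rρ². -/
theorem v_sq_le (h : SmallPair u du ddu v dv ddv) (k : Controlled R ρ u du v dv) (x : ℝ) :
    v x ^ 2 ≤ (3 * R + 2 * |x|) * ρ ^ 2 := by
  have hR := k.one_le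
  obtain ⟨y, hy, hle⟩ := exists_mem_Icc_sq_le h.continuous_v (show (-R : ℝ) < R by linarith)
  have h2 := h.v_ac.sq_sub_le h.dv_mem x y
  have h3 : |x - y| ≤ |x| + R := (abs_sub x y).trans (by
    have : |y| ≤ R := abs_le.2 hy
    linarith)
  have h4 : |x - y| * ∫ z, dv z ^ 2 ≤ (|x| + R) * ρ ^ 2 :=
    mul_le_mul h3 k.dv_le (integral_nonneg fun x => sq_nonneg _) (by positivity)
  have h5 : 2 * v y ^ 2 ≤ R * ρ ^ 2 := by
    have : R * (2 * v y ^ 2) ≤ R * (R * ρ ^ 2) := by linarith [k.v_le]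
    exact le_of_mul_le_mul_left this (by linarith)
  linarith [sq_nonneg (v x - 2 * v y)]

theorem abs_eta_le_of_le (h : SmallPair u du ddu v dv ddv) (k : Controlled R ρ u du v dv)
    {x : ℝ} (hx : |x| ≤ R) : |eta u v x| ≤ 6 * R * ρ + 10 * R * ρ ^ 2 := by
  have hR := k.one_le
  have hρ := k.nonneg
  have h1 := k.u_sq_le h x
  have h2 := k.v_sq_le h x
  have h3 : (3 + 2 * |x|) * ρ ^ 2 ≤ (5 * R) * ρ ^ 2 := by gcongr; linarith
  have h4 : (3 * R + 2 * |x|) * ρ ^ 2 ≤ (5 * R) * ρ ^ 2 := by gcongr; linarith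
  have h5 : |u x| ≤ 3 * R * ρ := by
    refine abs_le_of_sq_le_sq ?_ (by positivity)
    have : (5 * R) * ρ ^ 2 ≤ (5 * R) * ρ ^ 2 * R := le_mul_of_one_le_right (by positivity) hR
    linarith [sq_nonneg (R * ρ)]
  have h6 : |2 * u₀ x * u x| ≤ 2 * (3 * R * ρ) := by
    rw [abs_mul, abs_mul, abs_two]
    have := mul_le_of_le_one_left (abs_nonneg (u x)) (abs_u₀_le x)
    linarith
  rw [eta_eq]
  refine (abs_add_le _ _).trans ?_
  rw [abs_of_nonneg (show 0 ≤ u x ^ 2 + v x ^ 2 by positivity)]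
  linarith

/-- For |x| ≤ R the bound comes from u and v. Outside, η² differs from its value at ±R by at most
the outer integral of η'² + η², because 2|η η'| ≤ η'² + η²; no growth in |x| occurs. -/
theorem abs_eta_le (h : SmallPair u du ddu v dv ddv) (k : Controlled R ρ u du v dv) (x : ℝ) :
    |eta u v x| ≤ 7 * R * ρ + 10 * R * ρ ^ 2 := by
  have hR := k.one_le
  have hρ := k.nonneg
  rcases le_or_gt |x| R with hx | hx
  · have := k.abs_eta_le_of_le h hx
    have : 0 ≤ R * ρ := by positivity
    linarith
  · have hac := (isAC_eta h.u_ac h.v_ac).mul (isAC_eta h.u_ac h.v_ac)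
    have iE : Integrable (fun z => deta u du v dv z ^ 2 + eta u v z ^ 2) volume :=
      h.deta_mem.integrable_sq.add h.eta_mem.integrable_sq
    have key : ∀ a b : ℝ, a ≤ b → Ioc a b ⊆ {x : ℝ | R ≤ |x|} →
        |eta u v b ^ 2 - eta u v a ^ 2| ≤ ρ ^ 2 := by
      intro a b hab hsub
      have h1 := hac.integral_eq a b
      rw [← sq, ← sq] at h1
      rw [← h1, intervalIntegral.integral_of_le hab]
      refine (abs_integral_le_integral_abs).trans ?_
      refine le_trans ?_ k.eta_le
      refine le_trans ?_ (setIntegral_mono_set iE.integrableOn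
        (.of_forall fun x => by positivity) hsub.eventuallyLE)
      refine integral_mono_of_nonneg (.of_forall fun x => abs_nonneg _) iE.integrableOn
        (.of_forall fun z => ?_)
      simp only
      rw [abs_le]
      constructor <;> linarith [sq_nonneg (deta u du v dv z + eta u v z),
        sq_nonneg (deta u du v dv z - eta u v z)]
    have main : ∀ y, |y| ≤ R → |eta u v x ^ 2 - eta u v y ^ 2| ≤ ρ ^ 2 →
        |eta u v x| ≤ 7 * R * ρ + 10 * R * ρ ^ 2 := by
      intro y hy hle
      have h1 := k.abs_eta_le_of_le h hy
      have h2 : eta u v y ^ 2 ≤ (6 * R * ρ + 10 * R * ρ ^ 2) ^ 2 := sq_le_sq' (abs_le.1 h1).1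
        (abs_le.1 h1).2
      refine abs_le_of_sq_le_sq ?_ (by positivity)
      have h3 := (abs_le.1 hle).2
      have h4 : ρ ^ 2 ≤ (R * ρ) ^ 2 := by
        rw [mul_pow]; exact le_mul_of_one_le_left (sq_nonneg _) (one_le_pow₀ hR)
      have h5 : 0 ≤ (R * ρ) * (R * ρ ^ 2) := by positivity
      linarith [sq_nonneg (R * ρ)]
    rcases le_total 0 x with h0 | h0
    · rw [abs_of_nonneg h0] at hx
      refine main R (by rw [abs_of_nonneg]; linarith) (key R x hx.le fun z hz => ?_)
      exact hz.1.le.trans (le_abs_self z)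
    · rw [abs_of_nonpos h0] at hx
      refine main (-R) (by rw [abs_neg, abs_of_nonneg]; linarith) ?_
      rw [abs_sub_comm]
      refine key x (-R) (by linarith) fun z hz => ?_
      exact (by linarith [hz.2] : R ≤ -z).trans (neg_le_abs z)

end Controlled

theorem measurableSet_outer (R : ℝ) : MeasurableSet {x : ℝ | R ≤ |x|} :=
  measurableSet_le measurable_const continuous_abs.measurable

namespace Controlled

variable {u du ddu v dv ddv : ℝ → ℝ} {R ρ : ℝ}

/-- This is where the power R³ arises. On |x| ≤ R, η² is bounded by u² and (u² + v²)², and outside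
it is part of ρ² itself. -/
theorem integral_abs_eta_cube_le (h : SmallPair u du ddu v dv ddv)
    (k : Controlled R ρ u du v dv) {M : ℝ} (hM : 0 ≤ M) (hη : ∀ x, |eta u v x| ≤ M * R * ρ) :
    Integrable (fun x => |eta u v x| ^ 3) volume ∧
    ∫ x, |eta u v x| ^ 3 ≤ R ^ 3 * (9 * M * ρ ^ 3 + 1600 * ρ ^ 4) := by
  have hR := k.one_le
  have hρ := k.nonneg
  have hi : Integrable (fun x => |eta u v x| ^ 3) volume := by
    refine (Integrable.continuous_mul h.eta_mem.integrable_sq h.continuous_eta.abs (C := 40)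
      fun x => by rw [abs_abs]; exact h.abs_eta_le x).congr (.of_forall fun x => ?_)
    simp only
    rw [← sq_abs (eta u v x)]; ring
  refine ⟨hi, ?_⟩
  have iu : IntegrableOn (fun x => u x ^ 2) (Icc (-R) R) := (h.continuous_u.pow 2).integrableOn_Icc
  have iv : IntegrableOn (fun x => v x ^ 2) (Icc (-R) R) := (h.continuous_v.pow 2).integrableOn_Icc
  have h1 : ∫ x in Icc (-R) R, |eta u v x| ^ 3
      ≤ 8 * (M * R * ρ) * ρ ^ 2 + 800 * R * ρ ^ 2 * (ρ ^ 2 + R ^ 2 * ρ ^ 2) := by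
    have hle : ∀ x ∈ Icc (-R) R, |eta u v x| ^ 3
        ≤ 8 * (M * R * ρ) * u x ^ 2 + 800 * R * ρ ^ 2 * (u x ^ 2 + v x ^ 2) := by
      intro x hx
      have hx' : |x| ≤ R := abs_le.2 hx
      have a1 := k.u_sq_le h x
      have a2 := k.v_sq_le h x
      have a3 : (3 + 2 * |x|) * ρ ^ 2 ≤ (5 * R) * ρ ^ 2 := by gcongr; linarith
      have a4 : (3 * R + 2 * |x|) * ρ ^ 2 ≤ (5 * R) * ρ ^ 2 := by gcongr; linarith
      have a5 : (u x ^ 2 + v x ^ 2) ^ 2 ≤ 10 * R * ρ ^ 2 * (u x ^ 2 + v x ^ 2) := by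
        rw [sq]; gcongr; linarith
      have a6 : eta u v x ^ 2 ≤ 8 * u x ^ 2 + 2 * (u x ^ 2 + v x ^ 2) ^ 2 := by
        rw [eta_eq]
        have := mul_le_of_le_one_left (sq_nonneg (u x)) (u₀_sq_le x)
        linarith [sq_nonneg (2 * u₀ x * u x - (u x ^ 2 + v x ^ 2))]
      have e : |eta u v x| ^ 3 = |eta u v x| * eta u v x ^ 2 := by
        rw [← sq_abs (eta u v x)]; ring
      rw [e]
      calc |eta u v x| * eta u v x ^ 2
          ≤ |eta u v x| * (8 * u x ^ 2 + 2 * (10 * R * ρ ^ 2 * (u x ^ 2 + v x ^ 2))) := by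
            gcongr; linarith
        _ = |eta u v x| * (8 * u x ^ 2)
            + |eta u v x| * (20 * R * ρ ^ 2 * (u x ^ 2 + v x ^ 2)) := by ring
        -- The quartic part already carries ρ⁴ after integration, so the absolute bound 40 on η is
        -- used there; the bound `M * R * ρ` would cost one more power of R.
        _ ≤ (M * R * ρ) * (8 * u x ^ 2) + 40 * (20 * R * ρ ^ 2 * (u x ^ 2 + v x ^ 2)) := by
            gcongr
            · exact hη x
            · exact h.abs_eta_le x
        _ = _ := by ring
    have iuv : IntegrableOn (fun x => u x ^ 2 + v x ^ 2) (Icc (-R) R) := iu.add iv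
    refine (setIntegral_mono_on hi.integrableOn ((iu.const_mul _).add (iuv.const_mul _))
      measurableSet_Icc hle).trans ?_
    simp only [Pi.add_apply]
    rw [integral_add (iu.const_mul _) (iuv.const_mul _), integral_const_mul,
      integral_const_mul, integral_add iu iv]
    have := k.u_le
    have := k.v_le
    gcongr
  have h2 : ∫ x in (Icc (-R) R)ᶜ, |eta u v x| ^ 3 ≤ (M * R * ρ) * ρ ^ 2 := by
    have hsub : (Icc (-R) R)ᶜ ⊆ {x : ℝ | R ≤ |x|} := by
      intro x hx
      by_contra h'
      exact hx (abs_le.1 (not_le.1 h').le)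
    have iE : Integrable (fun z => deta u du v dv z ^ 2 + eta u v z ^ 2) volume :=
      h.deta_mem.integrable_sq.add h.eta_mem.integrable_sq
    refine (setIntegral_mono_set hi.integrableOn (.of_forall fun x => by positivity)
      hsub.eventuallyLE).trans ?_
    refine (setIntegral_mono hi.integrableOn (iE.const_mul (M * R * ρ)).integrableOn
      fun x => ?_).trans ?_
    · have e : |eta u v x| ^ 3 = |eta u v x| * eta u v x ^ 2 := by
        rw [← sq_abs (eta u v x)]; ring
      simp only
      rw [e]
      refine mul_le_mul (hη x) ?_ (sq_nonneg _) (by positivity)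
      linarith [sq_nonneg (deta u du v dv x)]
    · rw [integral_const_mul]
      have := k.eta_le
      gcongr
  rw [← integral_add_compl measurableSet_Icc hi]
  have r1 : R * (M * ρ ^ 3) ≤ R ^ 3 * (M * ρ ^ 3) := by
    gcongr
    exact le_self_pow₀ hR (by norm_num)
  have r2 : R * ρ ^ 4 ≤ R ^ 3 * ρ ^ 4 := by
    gcongr
    exact le_self_pow₀ hR (by norm_num)
  linarith

/-- The (u, η)-form is split as θ + (1 − θ), with θ the cutoff: the first part is linearised in η,
the second is bounded below by `uEtaForm_ge`. The terms with the wrong sign are either of size ε²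
against the inner norm or cubic. -/
theorem lamDensity_ge (h : SmallPair u du ddu v dv ddv)
    (k : Controlled R ρ u du v dv) {M W ε ρ₀ : ℝ} (hM : 0 ≤ M)
    (hη : ∀ x, |eta u v x| ≤ M * R * ρ) (hρ₀ : ρ ≤ ρ₀) (hW0 : 0 ≤ W)
    (hW : ∀ x, wt x ≤ W * jb x ^ 8) (hε : 0 < ε) (hε1 : ε ≤ 1) (x : ℝ) :
    (ddv x ^ 2 + (3 * u₀ x ^ 2 - 2) * dv x ^ 2 + wt x * v x ^ 2)
      + cutoff ε x * uForm u du ddu x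
      + 1 / 2 * ((1 - cutoff ε x)
        * (ddu x ^ 2 + du x ^ 2 + deta u du v dv x ^ 2 + eta u v x ^ 2))
      - 72 * W * ε ^ 2 * (cutoff ε x * (ddu x ^ 2 + du x ^ 2 + u x ^ 2))
      - ((200 * (ε ^ 6)⁻¹ * (1 + ρ₀) + 1152 * W * ρ₀ + 3 * M) * R ^ 2 * ρ
        * (jb x * ρ ^ 2 + (du x ^ 2 + dv x ^ 2)) + 1 / 2 * |eta u v x| ^ 3)
      ≤ lamDensity u du ddu v dv ddv x := by
  have hR := k.one_le
  have hρ := k.nonneg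
  have hj := jb_pos x
  have hj1 := jb_le_one x
  have hθ := cutoff_pos (ε := ε) x
  have hθ1 := cutoff_le_one (ε := ε) x
  have hw := wt_pos x
  have hD0 : 0 ≤ du x ^ 2 + dv x ^ 2 := by positivity
  obtain ⟨j, hjdef⟩ : ∃ j, j = √(1 + x ^ 2) := ⟨_, rfl⟩
  have hj2 : j ^ 2 = 1 + x ^ 2 := by rw [hjdef, Real.sq_sqrt (by positivity)]
  have hj0 : 1 ≤ j := by
    rw [hjdef]; exact Real.one_le_sqrt.2 (by linarith [sq_nonneg x])
  have hx1 : 2 * |x| ≤ 1 + x ^ 2 := by rw [← sq_abs x]; linarith [sq_nonneg (|x| - 1)]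
  have hu : u x ^ 2 ≤ 4 * j ^ 2 * ρ ^ 2 := (k.u_sq_le h x).trans (by
    gcongr; linarith [sq_nonneg x])
  have hv : v x ^ 2 ≤ 4 * R * j ^ 2 * ρ ^ 2 := (k.v_sq_le h x).trans (by
    rw [hj2]
    gcongr
    have := mul_nonneg (by linarith : 0 ≤ R) (sq_nonneg x)
    have : 2 * |x| ≤ R * (1 + x ^ 2) := hx1.trans (le_mul_of_one_le_left (by positivity) hR)
    linarith)
  have hjj : jb x * j ^ 2 = 1 := by rw [hj2, jb_mul]
  have hρ2 : ρ ^ 2 ≤ ρ₀ * ρ := by rw [sq]; gcongr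
  have hρ₀0 : 0 ≤ ρ₀ := hρ.trans hρ₀
  have hΘ : 0 ≤ (ε ^ 6)⁻¹ := by positivity
  have hθj := cutoff_le hε hε1 x
  have hE0 : 0 ≤ jb x * ρ ^ 2 + (du x ^ 2 + dv x ^ 2) := by positivity
  -- the quadratic error
  have q1 : cutoff ε x * |uFormErr u du v dv x| ≤ 200 * (ε ^ 6)⁻¹ * (1 + ρ₀) * R ^ 2 * ρ
      * (jb x * ρ ^ 2 + (du x ^ 2 + dv x ^ 2)) := by
    have a1 : cutoff ε x * j ^ 4 ≤ (ε ^ 6)⁻¹ * jb x := by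
      calc cutoff ε x * j ^ 4 ≤ ((ε ^ 6)⁻¹ * jb x ^ 3) * j ^ 4 := by gcongr
        _ = (ε ^ 6)⁻¹ * jb x * (jb x * j ^ 2) ^ 2 := by ring
        _ = _ := by rw [hjj]; ring
    have a2 : cutoff ε x * j ^ 2 ≤ (ε ^ 6)⁻¹ := by
      calc cutoff ε x * j ^ 2 ≤ ((ε ^ 6)⁻¹ * jb x ^ 3) * j ^ 2 := by gcongr
        _ = (ε ^ 6)⁻¹ * (jb x * j ^ 2) * jb x ^ 2 := by ring
        _ ≤ (ε ^ 6)⁻¹ * 1 * 1 := by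
          rw [hjj]; gcongr; exact pow_le_one₀ hj.le hj1
        _ = _ := by ring
    calc cutoff ε x * |uFormErr u du v dv x|
        ≤ cutoff ε x * (200 * R ^ 2 * (ρ + ρ ^ 2)
          * (j ^ 4 * ρ ^ 2 + j ^ 2 * (du x ^ 2 + dv x ^ 2))) := by
          gcongr
          exact abs_uFormErr_le hR hρ hj0 hu hv
      _ = 200 * R ^ 2 * (ρ + ρ ^ 2) * ((cutoff ε x * j ^ 4) * ρ ^ 2
          + (cutoff ε x * j ^ 2) * (du x ^ 2 + dv x ^ 2)) := by ring
      _ ≤ 200 * R ^ 2 * (ρ + ρ₀ * ρ) * (((ε ^ 6)⁻¹ * jb x) * ρ ^ 2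
          + (ε ^ 6)⁻¹ * (du x ^ 2 + dv x ^ 2)) := by gcongr
      _ = _ := by ring
  -- the indefinite part of the outer form
  have q2 : (1 - cutoff ε x) * (wt x * (6 * du x ^ 2 + 3 * eta u v x ^ 2))
      ≤ 72 * W * ε ^ 2 * (cutoff ε x * (ddu x ^ 2 + du x ^ 2 + u x ^ 2))
        + 1152 * W * ρ₀ * R ^ 2 * ρ * (jb x * ρ ^ 2 + (du x ^ 2 + dv x ^ 2)) := by
    -- Of the eight powers of `jb` that bound `wt`, one absorbs x², three become the cutoff, and
    -- four remain to compensate the growth of (u² + v²)².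
    have b1 : (1 - cutoff ε x) * wt x ≤ 3 * W * ε ^ 2 * (jb x ^ 4 * cutoff ε x) := by
      have c0 := one_sub_cutoff_le (ε := ε) x
      calc (1 - cutoff ε x) * wt x ≤ (3 * ε ^ 2 * x ^ 2) * (W * jb x ^ 8) := by
            gcongr
            exact hW x
        _ = 3 * W * ε ^ 2 * (jb x ^ 4 * jb x ^ 3) * (jb x * x ^ 2) := by ring
        _ ≤ 3 * W * ε ^ 2 * (jb x ^ 4 * cutoff ε x) * 1 := by
            gcongr
            · exact jb_pow_le_cutoff hε.le hε1 x
            · have := jb_mul x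
              linarith
        _ = _ := mul_one _
    have b2 : eta u v x ^ 2 ≤ 8 * u x ^ 2 + 2 * (u x ^ 2 + v x ^ 2) ^ 2 := by
      rw [eta_eq]
      have := mul_le_of_le_one_left (sq_nonneg (u x)) (u₀_sq_le x)
      linarith [sq_nonneg (2 * u₀ x * u x - (u x ^ 2 + v x ^ 2))]
    have b3 : u x ^ 2 + v x ^ 2 ≤ 8 * R * j ^ 2 * ρ ^ 2 := by
      have : 4 * j ^ 2 * ρ ^ 2 ≤ R * (4 * j ^ 2 * ρ ^ 2) := le_mul_of_one_le_left (by positivity) hR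
      linarith
    have b4 : (u x ^ 2 + v x ^ 2) ^ 2 ≤ 64 * R ^ 2 * j ^ 4 * ρ ^ 4 := by
      calc (u x ^ 2 + v x ^ 2) ^ 2 ≤ (8 * R * j ^ 2 * ρ ^ 2) ^ 2 := by gcongr
        _ = _ := by ring
    have b5 : jb x ^ 4 * cutoff ε x * (64 * R ^ 2 * j ^ 4 * ρ ^ 4) ≤ 64 * R ^ 2 * ρ ^ 4 * jb x := by
      calc jb x ^ 4 * cutoff ε x * (64 * R ^ 2 * j ^ 4 * ρ ^ 4)
          = 64 * R ^ 2 * ρ ^ 4 * jb x * (jb x * cutoff ε x) * (jb x * j ^ 2) ^ 2 := by ring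
        _ ≤ 64 * R ^ 2 * ρ ^ 4 * jb x * (1 * 1) * 1 := by
          rw [hjj, one_pow]; gcongr
        _ = _ := by ring
    have b6 : jb x ^ 4 * cutoff ε x ≤ 1 * cutoff ε x := by
      gcongr; exact pow_le_one₀ hj.le hj1
    have hε2 : ε ^ 2 ≤ 1 := pow_le_one₀ hε.le hε1
    calc (1 - cutoff ε x) * (wt x * (6 * du x ^ 2 + 3 * eta u v x ^ 2))
        = ((1 - cutoff ε x) * wt x) * (6 * du x ^ 2 + 3 * eta u v x ^ 2) := by ring
      _ ≤ (3 * W * ε ^ 2 * (jb x ^ 4 * cutoff ε x))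
          * (24 * (ddu x ^ 2 + du x ^ 2 + u x ^ 2) + 6 * (64 * R ^ 2 * j ^ 4 * ρ ^ 4)) := by
          refine mul_le_mul b1 ?_ (by positivity) (by positivity)
          linarith [sq_nonneg (ddu x), sq_nonneg (du x)]
      _ = 72 * W * ε ^ 2 * ((jb x ^ 4 * cutoff ε x) * (ddu x ^ 2 + du x ^ 2 + u x ^ 2))
          + 18 * W * ε ^ 2 * (jb x ^ 4 * cutoff ε x * (64 * R ^ 2 * j ^ 4 * ρ ^ 4)) := by ring
      _ ≤ 72 * W * ε ^ 2 * ((1 * cutoff ε x) * (ddu x ^ 2 + du x ^ 2 + u x ^ 2))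
          + 18 * W * 1 * (64 * R ^ 2 * ρ ^ 4 * jb x) := by gcongr
      _ = 72 * W * ε ^ 2 * (cutoff ε x * (ddu x ^ 2 + du x ^ 2 + u x ^ 2))
          + 1152 * W * R ^ 2 * ρ ^ 2 * (jb x * ρ ^ 2) := by ring
      _ ≤ 72 * W * ε ^ 2 * (cutoff ε x * (ddu x ^ 2 + du x ^ 2 + u x ^ 2))
          + 1152 * W * R ^ 2 * (ρ₀ * ρ) * (jb x * ρ ^ 2 + (du x ^ 2 + dv x ^ 2)) := by
          gcongr
          linarith
      _ = _ := by ring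
  have q3 : |3 * eta u v x * (du x ^ 2 + dv x ^ 2)|
      ≤ 3 * M * R ^ 2 * ρ * (jb x * ρ ^ 2 + (du x ^ 2 + dv x ^ 2)) := by
    rw [abs_mul, abs_mul, abs_of_nonneg hD0, abs_of_pos (by norm_num : (0 : ℝ) < 3)]
    have : M * R * ρ ≤ M * R ^ 2 * ρ := by
      gcongr; exact le_self_pow₀ hR (by norm_num)
    calc 3 * |eta u v x| * (du x ^ 2 + dv x ^ 2)
        ≤ 3 * (M * R ^ 2 * ρ) * (jb x * ρ ^ 2 + (du x ^ 2 + dv x ^ 2)) := by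
          refine mul_le_mul (mul_le_mul_of_nonneg_left ((hη x).trans this) (by norm_num)) ?_ hD0
            (by positivity)
          have : 0 ≤ jb x * ρ ^ 2 := by positivity
          linarith
      _ = _ := by ring
  have q4 : |1 / 2 * eta u v x ^ 3| = 1 / 2 * |eta u v x| ^ 3 := by
    rw [abs_mul, abs_pow, abs_of_pos (by norm_num : (0 : ℝ) < 1 / 2)]
  have q5 := mul_le_mul_of_nonneg_left (uEtaForm_ge u du ddu v dv x) (sub_nonneg.2 hθ1)
  have q6 := mul_le_mul_of_nonneg_left (neg_le_of_abs_le (le_refl |uFormErr u du v dv x|)) hθ.le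
  have q7 : uEtaForm u du ddu v dv x = cutoff ε x * (uForm u du ddu x + uFormErr u du v dv x)
      + (1 - cutoff ε x) * uEtaForm u du ddu v dv x := by
    rw [← uEtaForm_eq]; ring
  rw [lamDensity_eq, q7]
  have q8 := (abs_le.1 (le_of_eq q4)).1
  have q9 := (abs_le.1 q3).1
  linarith

end Controlled

/-! ### Coercivity in ρ up to a cubic error -/

theorem setOf_abs_le (R : ℝ) : {x : ℝ | |x| ≤ R} = Icc (-R) R := by
  ext x; simp [abs_le]

theorem setIntegral_le_mul_integral {f g : ℝ → ℝ} {s : Set ℝ} {C : ℝ} (hs : MeasurableSet s)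
    (hC : 0 ≤ C) (hf : IntegrableOn f s) (hg : Integrable g volume) (h0 : ∀ x, 0 ≤ g x)
    (h : ∀ x ∈ s, f x ≤ C * g x) : ∫ x in s, f x ≤ C * ∫ x, g x := by
  rw [← integral_const_mul]
  exact (setIntegral_mono_on hf (hg.const_mul C).integrableOn hs h).trans
    (setIntegral_le_integral (hg.const_mul C) (.of_forall fun x => mul_nonneg hC (h0 x)))

/-- The quantity `ρ²`, for absolutely continuous representatives. -/
noncomputable def rhoSq (R : ℝ) (u du ddu v dv ddv : ℝ → ℝ) : ℝ :=
  (∫ x, (ddu x ^ 2 + ddv x ^ 2 + du x ^ 2 + dv x ^ 2))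
    + (∫ x in Icc (-R) R, (u x ^ 2 + (R ^ 2)⁻¹ * v x ^ 2))
    + ∫ x in {x : ℝ | R ≤ |x|}, (deta u du v dv x ^ 2 + eta u v x ^ 2)

/-- A density whose integral dominates `ρ²`. -/
noncomputable def coerDensity (ε : ℝ) (u du ddu v dv ddv : ℝ → ℝ) (x : ℝ) : ℝ :=
  dv x ^ 2 + ddv x ^ 2 + jb x ^ 4 * v x ^ 2
    + cutoff ε x * (ddu x ^ 2 + du x ^ 2 + u x ^ 2)
    + (1 - cutoff ε x) * (ddu x ^ 2 + du x ^ 2 + deta u du v dv x ^ 2 + eta u v x ^ 2)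

theorem rhoSq_nonneg (R : ℝ) (u du ddu v dv ddv : ℝ → ℝ) : 0 ≤ rhoSq R u du ddu v dv ddv := by
  refine add_nonneg (add_nonneg ?_ ?_) ?_ <;> exact integral_nonneg fun x => by positivity

namespace SmallPair

variable {u du ddu v dv ddv : ℝ → ℝ} {R : ℝ}

theorem integrable_derivs (h : SmallPair u du ddu v dv ddv) :
    Integrable (fun x => ddu x ^ 2 + ddv x ^ 2 + du x ^ 2 + dv x ^ 2) volume :=
  ((h.ddu_mem.integrable_sq.add h.ddv_mem.integrable_sq).add h.du_mem.integrable_sq).add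
    h.dv_mem.integrable_sq

theorem integrable_deta_sq_add (h : SmallPair u du ddu v dv ddv) :
    Integrable (fun x => deta u du v dv x ^ 2 + eta u v x ^ 2) volume :=
  h.deta_mem.integrable_sq.add h.eta_mem.integrable_sq

theorem controlled (h : SmallPair u du ddu v dv ddv) (hR : 1 ≤ R) :
    Controlled R √(rhoSq R u du ddu v dv ddv) u du v dv := by
  have i1 := h.integrable_derivs
  have n2 : 0 ≤ ∫ x in Icc (-R) R, (u x ^ 2 + (R ^ 2)⁻¹ * v x ^ 2) :=
    integral_nonneg fun x => by positivity
  have n3 : 0 ≤ ∫ x in {x : ℝ | R ≤ |x|}, (deta u du v dv x ^ 2 + eta u v x ^ 2) :=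
    integral_nonneg fun x => by positivity
  have n1 : 0 ≤ ∫ x, (ddu x ^ 2 + ddv x ^ 2 + du x ^ 2 + dv x ^ 2) :=
    integral_nonneg fun x => by positivity
  have iu : IntegrableOn (fun x => u x ^ 2) (Icc (-R) R) := (h.continuous_u.pow 2).integrableOn_Icc
  have iv : IntegrableOn (fun x => v x ^ 2) (Icc (-R) R) := (h.continuous_v.pow 2).integrableOn_Icc
  have hs : ∫ x in Icc (-R) R, (u x ^ 2 + (R ^ 2)⁻¹ * v x ^ 2)
      = (∫ x in Icc (-R) R, u x ^ 2) + (R ^ 2)⁻¹ * ∫ x in Icc (-R) R, v x ^ 2 := by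
    rw [← integral_const_mul]; exact integral_add iu (iv.const_mul _)
  have nu : 0 ≤ ∫ x in Icc (-R) R, u x ^ 2 := integral_nonneg fun x => by positivity
  have nv : 0 ≤ (R ^ 2)⁻¹ * ∫ x in Icc (-R) R, v x ^ 2 :=
    mul_nonneg (by positivity) (integral_nonneg fun x => by positivity)
  have hsq := Real.sq_sqrt (rhoSq_nonneg R u du ddu v dv ddv)
  refine ⟨hR, Real.sqrt_nonneg _, ?_, ?_, ?_, ?_, ?_⟩ <;> rw [hsq, rhoSq]
  · have : ∫ x, du x ^ 2 ≤ ∫ x, (ddu x ^ 2 + ddv x ^ 2 + du x ^ 2 + dv x ^ 2) :=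
      integral_mono h.du_mem.integrable_sq i1 fun x => by
        simp only; linarith [sq_nonneg (ddu x), sq_nonneg (ddv x), sq_nonneg (dv x)]
    linarith
  · have : ∫ x, dv x ^ 2 ≤ ∫ x, (ddu x ^ 2 + ddv x ^ 2 + du x ^ 2 + dv x ^ 2) :=
      integral_mono h.dv_mem.integrable_sq i1 fun x => by
        simp only; linarith [sq_nonneg (ddu x), sq_nonneg (ddv x), sq_nonneg (du x)]
    linarith
  · linarith
  · rw [← inv_mul_le_iff₀ (by positivity)]
    linarith
  · linarith

theorem integrable_jb_mul_sq (h : SmallPair u du ddu v dv ddv) :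
    Integrable (fun x => jb x ^ 4 * v x ^ 2) volume := by
  refine (Integrable.continuous_mul integrable_jb (c := fun x => jb x ^ 3 * v x ^ 2) (C := 16)
    ((continuous_jb.pow 3).mul (h.continuous_v.pow 2)) fun x => ?_).congr (.of_forall fun x => ?_)
  · have hj := jb_pos x
    rw [abs_of_nonneg (by positivity)]
    have h1 : jb x ^ 3 ≤ 1 := pow_le_one₀ hj.le (jb_le_one x)
    have h2 : v x ^ 2 ≤ 16 := by
      have := pow_le_pow_left₀ (abs_nonneg _) (h.bounds x).2 2
      rw [sq_abs] at this
      linarith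
    calc jb x ^ 3 * v x ^ 2 ≤ 1 * 16 := by gcongr
      _ = 16 := by norm_num
  · simp only; ring

theorem integrable_vForm (h : SmallPair u du ddu v dv ddv) :
    Integrable (fun x => ddv x ^ 2 + (3 * u₀ x ^ 2 - 2) * dv x ^ 2 + wt x * v x ^ 2) volume := by
  have i2 := Integrable.continuous_mul h.dv_mem.integrable_sq
    (c := fun x => 3 * u₀ x ^ 2 - 2) (C := 2) (by have := continuous_u₀; fun_prop) (fun x => by
      rw [abs_le]; constructor <;> linarith [u₀_sq_le x, sq_nonneg (u₀ x)])
  have i4 : Integrable (fun x => wt x * v x ^ 2) volume := by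
    refine (Integrable.continuous_mul integrable_wt (c := fun x => v x ^ 2) (C := 4 ^ 2)
      (h.continuous_v.pow 2) fun x => ?_).congr (.of_forall fun x => mul_comm _ _)
    rw [abs_pow]
    exact pow_le_pow_left₀ (abs_nonneg _) (h.bounds x).2 2
  exact (h.ddv_mem.integrable_sq.add i2).add i4

theorem integrable_cutoff_uPart (h : SmallPair u du ddu v dv ddv) {ε : ℝ} (hε : 0 < ε)
    (hε1 : ε ≤ 1) :
    Integrable (fun x => cutoff ε x * (ddu x ^ 2 + du x ^ 2 + u x ^ 2)) volume := by
  refine ((integrable_mul_cutoff (ε := ε)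
    (h.ddu_mem.integrable_sq.add h.du_mem.integrable_sq)).add
    (integrable_cutoff_mul_sq hε hε1 h.continuous_u fun x => (h.bounds x).1)).congr
    (.of_forall fun x => ?_)
  simp only [Pi.add_apply]
  ring

theorem integrable_outerPart (h : SmallPair u du ddu v dv ddv) (ε : ℝ) :
    Integrable (fun x => (1 - cutoff ε x)
      * (ddu x ^ 2 + du x ^ 2 + deta u du v dv x ^ 2 + eta u v x ^ 2)) volume := by
  refine Integrable.continuous_mul (((h.ddu_mem.integrable_sq.add h.du_mem.integrable_sq).add
    h.deta_mem.integrable_sq).add h.eta_mem.integrable_sq) (C := 1)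
    (continuous_const.sub continuous_cutoff) fun x => ?_
  have := cutoff_pos (ε := ε) x
  have := cutoff_le_one (ε := ε) x
  rw [abs_le]; constructor <;> linarith

theorem integrable_coerDensity (h : SmallPair u du ddu v dv ddv) {ε : ℝ} (hε : 0 < ε)
    (hε1 : ε ≤ 1) : Integrable (coerDensity ε u du ddu v dv ddv) volume :=
  (((h.dv_mem.integrable_sq.add h.ddv_mem.integrable_sq).add h.integrable_jb_mul_sq).add
    (h.integrable_cutoff_uPart hε hε1)).add (h.integrable_outerPart ε)

/-- On |x| ≤ R the inner weights are bounded below by (1 + R²)⁻⁴; on |x| ≥ R ≥ 1 the outer weight is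
at least its value at 1. The two weights add up to one, which gives u' and u'' on the whole line. -/
theorem exists_rhoSq_le {ε : ℝ} (hR : 1 ≤ R) (hε : 0 < ε) (hε1 : ε ≤ 1) :
    ∃ C : ℝ, 0 < C ∧ ∀ u du ddu v dv ddv : ℝ → ℝ, SmallPair u du ddu v dv ddv →
      rhoSq R u du ddu v dv ddv ≤ C * ∫ x, coerDensity ε u du ddu v dv ddv x := by
  have hκ : 0 < 1 - cutoff ε 1 := by
    rw [cutoff, sub_pos]
    refine inv_lt_one_of_one_lt₀ (one_lt_pow₀ ?_ (by norm_num))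
    have : 0 < ε ^ 2 := by positivity
    linarith
  refine ⟨1 + (1 + R ^ 2) ^ 4 + (1 - cutoff ε 1)⁻¹, by positivity,
    fun u du ddu v dv ddv h => ?_⟩
  have iG := h.integrable_coerDensity hε hε1
  have hG : ∀ x, 0 ≤ coerDensity ε u du ddu v dv ddv x := fun x => by
    have := cutoff_pos (ε := ε) x
    have := sub_nonneg.2 (cutoff_le_one (ε := ε) x)
    have := jb_pos x
    rw [coerDensity]; positivity
  have p1 : ∫ x, (ddu x ^ 2 + ddv x ^ 2 + du x ^ 2 + dv x ^ 2)
      ≤ 1 * ∫ x, coerDensity ε u du ddu v dv ddv x := by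
    rw [one_mul]
    refine integral_mono h.integrable_derivs iG fun x => ?_
    have c1 := cutoff_pos (ε := ε) x
    have c2 := sub_nonneg.2 (cutoff_le_one (ε := ε) x)
    have := jb_pos x
    have e1 : 0 ≤ jb x ^ 4 * v x ^ 2 := by positivity
    have e2 : 0 ≤ cutoff ε x * u x ^ 2 := by positivity
    have e3 : 0 ≤ (1 - cutoff ε x) * (deta u du v dv x ^ 2 + eta u v x ^ 2) := by positivity
    simp only [coerDensity]
    linarith
  have p2 : ∫ x in Icc (-R) R, (u x ^ 2 + (R ^ 2)⁻¹ * v x ^ 2)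
      ≤ (1 + R ^ 2) ^ 4 * ∫ x, coerDensity ε u du ddu v dv ddv x := by
    refine setIntegral_le_mul_integral measurableSet_Icc (by positivity)
      (((h.continuous_u.pow 2).add
        (continuous_const.mul (h.continuous_v.pow 2))).integrableOn_Icc) iG hG fun x hx => ?_
    have hx2 : x ^ 2 ≤ R ^ 2 := sq_le_sq' hx.1 hx.2
    have hj := jb_pos x
    have s0 : 1 ≤ (1 + R ^ 2) * jb x := by
      have := jb_mul x
      have : x ^ 2 * jb x ≤ R ^ 2 * jb x := by gcongr
      linarith
    have s1 : 1 ≤ (1 + R ^ 2) ^ 4 * jb x ^ 4 := by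
      rw [← mul_pow]; exact one_le_pow₀ s0
    have s2 : 1 ≤ (1 + R ^ 2) ^ 4 * cutoff ε x := by
      refine s1.trans ?_
      gcongr
      exact (pow_le_pow_of_le_one hj.le (jb_le_one x) (by norm_num)).trans
        (jb_pow_le_cutoff hε.le hε1 x)
    have c1 := cutoff_pos (ε := ε) x
    have c2 := sub_nonneg.2 (cutoff_le_one (ε := ε) x)
    have t1 : u x ^ 2 ≤ (1 + R ^ 2) ^ 4 * (cutoff ε x * u x ^ 2) := by
      rw [← mul_assoc]; exact le_mul_of_one_le_left (sq_nonneg _) s2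
    have t2 : (R ^ 2)⁻¹ * v x ^ 2 ≤ (1 + R ^ 2) ^ 4 * (jb x ^ 4 * v x ^ 2) := by
      rw [← mul_assoc]
      gcongr
      exact (inv_le_one_of_one_le₀ (one_le_pow₀ hR)).trans s1
    have t3 : cutoff ε x * u x ^ 2 + jb x ^ 4 * v x ^ 2
        ≤ coerDensity ε u du ddu v dv ddv x := by
      have e1 : 0 ≤ cutoff ε x * (ddu x ^ 2 + du x ^ 2) := by positivity
      have e2 : 0 ≤ (1 - cutoff ε x)
        * (ddu x ^ 2 + du x ^ 2 + deta u du v dv x ^ 2 + eta u v x ^ 2) := by positivity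
      rw [coerDensity]
      linarith [sq_nonneg (dv x), sq_nonneg (ddv x)]
    refine le_trans ?_ (mul_le_mul_of_nonneg_left t3 (by positivity))
    linarith
  have p3 : ∫ x in {x : ℝ | R ≤ |x|}, (deta u du v dv x ^ 2 + eta u v x ^ 2)
      ≤ (1 - cutoff ε 1)⁻¹ * ∫ x, coerDensity ε u du ddu v dv ddv x := by
    refine setIntegral_le_mul_integral (measurableSet_outer R) (by positivity)
      h.integrable_deta_sq_add.integrableOn iG hG fun x hx => ?_
    have hθ : cutoff ε x ≤ cutoff ε 1 := cutoff_anti (by rw [abs_one]; exact hR.trans hx)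
    have c1 := cutoff_pos (ε := ε) x
    have hj := jb_pos x
    have c2 := sub_nonneg.2 (cutoff_le_one (ε := ε) x)
    rw [le_inv_mul_iff₀ hκ]
    calc (1 - cutoff ε 1) * (deta u du v dv x ^ 2 + eta u v x ^ 2)
        ≤ (1 - cutoff ε x) * (deta u du v dv x ^ 2 + eta u v x ^ 2) := by gcongr
      _ ≤ coerDensity ε u du ddu v dv ddv x := by
          have e1 : 0 ≤ cutoff ε x * (ddu x ^ 2 + du x ^ 2 + u x ^ 2) := by positivity
          have e2 : 0 ≤ (1 - cutoff ε x) * (ddu x ^ 2 + du x ^ 2) := by positivity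
          have e3 : 0 ≤ jb x ^ 4 * v x ^ 2 := by positivity
          rw [coerDensity]
          linarith [sq_nonneg (dv x), sq_nonneg (ddv x)]
  rw [rhoSq]
  linarith

/-- Coercivity of `∫ lamDensity`, up to a cubic error. -/
theorem exists_integral_lamDensity_ge (ρ₀ : ℝ) (hρ₀ : 0 ≤ ρ₀) :
    ∃ K : ℝ, 0 ≤ K ∧ ∀ R : ℝ, 1 ≤ R → ∃ C₂ : ℝ, 0 < C₂ ∧ ∀ u du ddu v dv ddv : ℝ → ℝ,
      SmallPair u du ddu v dv ddv → ∫ x, wt x * u x = 0 → ∫ x, wt x * u₀ x * v x = 0 →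
      √(rhoSq R u du ddu v dv ddv) ≤ ρ₀ →
      C₂ * √(rhoSq R u du ddu v dv ddv) ^ 2 - K * R ^ 3 * √(rhoSq R u du ddu v dv ddv) ^ 3
        ≤ ∫ x, lamDensity u du ddu v dv ddv x := by
  obtain ⟨W, hW1, hW⟩ := exists_wt_le
  obtain ⟨cv, hcv, Hv⟩ := exists_vForm_coercive
  obtain ⟨cu, hcu, Hu⟩ := exists_uForm_coercive
  -- The commutator error 30ε and the wrong-sign outer terms 72Wε² together use at most half of the
  -- coercivity of the u-form. The choice precedes R, which keeps K uniform.
  obtain ⟨ε, hε, hε1, hεc⟩ : ∃ ε : ℝ, 0 < ε ∧ ε ≤ 1 ∧ 30 * ε + 72 * W * ε ^ 2 ≤ cu / 2 := by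
    refine ⟨min 1 (cu / (2 * (30 + 72 * W))), by positivity, min_le_left _ _, ?_⟩
    set ε := min 1 (cu / (2 * (30 + 72 * W)))
    have h0 : 0 < ε := by positivity
    have h1 : ε ^ 2 ≤ ε := by
      rw [sq]; exact mul_le_of_le_one_left h0.le (min_le_left _ _)
    have h2 : ε * (2 * (30 + 72 * W)) ≤ cu :=
      (le_div_iff₀ (by positivity)).1 (min_le_right _ _)
    have h3 : W * ε ^ 2 ≤ W * ε := by gcongr
    linarith
  -- The bound 7Rρ + 10Rρ² on η becomes linear in ρ by means of ρ ≤ ρ₀.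
  obtain ⟨M, hM⟩ : ∃ M, M = 7 + 10 * ρ₀ := ⟨_, rfl⟩
  have hM0 : 0 ≤ M := by rw [hM]; positivity
  obtain ⟨K₁, hK₁⟩ : ∃ K₁, K₁ = 200 * (ε ^ 6)⁻¹ * (1 + ρ₀) + 1152 * W * ρ₀ + 3 * M := ⟨_, rfl⟩
  have hK₁0 : 0 ≤ K₁ := by rw [hK₁]; positivity
  set J := ∫ x, jb x with hJ
  have hJ0 : 0 ≤ J := integral_jb_nonneg
  refine ⟨K₁ * (J + 2) + 1 / 2 * (9 * M + 1600 * ρ₀), by positivity, fun R hR => ?_⟩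
  obtain ⟨C, hC, HC⟩ := exists_rhoSq_le hR hε hε1
  -- The three entries are the coercivity left in v, in the inner u-part and in the outer part.
  set c₀ := min cv (min (cu / 2) (1 / 2)) with hc₀
  have hc₀0 : 0 < c₀ := by positivity
  have b1 : c₀ ≤ cv := min_le_left _ _
  have b2 : c₀ ≤ cu / 2 := (min_le_right _ _).trans (min_le_left _ _)
  have b3 : c₀ ≤ 1 / 2 := (min_le_right _ _).trans (min_le_right _ _)
  refine ⟨c₀ / C, by positivity, fun u du ddu v dv ddv h ou ov hρ => ?_⟩
  have k := h.controlled hR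
  have hrho := HC u du ddu v dv ddv h
  have hsq := Real.sq_sqrt (rhoSq_nonneg R u du ddu v dv ddv)
  set ρ := √(rhoSq R u du ddu v dv ddv)
  have hρ0 : 0 ≤ ρ := k.nonneg
  have hη : ∀ x, |eta u v x| ≤ M * R * ρ := fun x => (k.abs_eta_le h x).trans (by
    have : R * ρ * ρ ≤ R * ρ * ρ₀ := by gcongr
    rw [hM]
    linarith)
  obtain ⟨i3, hη3⟩ := k.integral_abs_eta_cube_le h hM0 hη
  have hV := Hv v dv ddv h.v_ac h.dv_ac (fun x => (h.bounds x).2) h.dv_mem h.ddv_mem ov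
  have hU := Hu ε hε hε1 u du ddu h.u_ac h.du_ac (fun x => (h.bounds x).1) h.du_mem h.ddu_mem ou
  have iV := h.integrable_vForm
  have iU := integrable_cutoff_uForm hε hε1 h.continuous_u (fun x => (h.bounds x).1)
    h.du_mem h.ddu_mem
  have iA := h.integrable_cutoff_uPart hε hε1
  have iO := h.integrable_outerPart ε
  have iD : Integrable (fun x => du x ^ 2 + dv x ^ 2) volume :=
    h.du_mem.integrable_sq.add h.dv_mem.integrable_sq
  have iE : Integrable (fun x => jb x * ρ ^ 2 + (du x ^ 2 + dv x ^ 2)) volume :=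
    (integrable_jb.mul_const _).add iD
  have hint := integral_mono
    ((((iV.add iU).add (iO.const_mul (1 / 2))).sub (iA.const_mul (72 * W * ε ^ 2))).sub
      ((iE.const_mul (K₁ * R ^ 2 * ρ)).add (i3.const_mul (1 / 2))))
    h.integrable_lamDensity (fun x => by
      have := k.lamDensity_ge h hM0 hη hρ (by linarith : 0 ≤ W) hW hε hε1 x
      rw [← hK₁] at this
      exact this)
  rw [integral_sub' ((((iV.add iU).add (iO.const_mul (1 / 2))).sub (iA.const_mul (72 * W * ε ^ 2))))
      ((iE.const_mul (K₁ * R ^ 2 * ρ)).add (i3.const_mul (1 / 2))),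
    integral_sub' ((iV.add iU).add (iO.const_mul (1 / 2))) (iA.const_mul (72 * W * ε ^ 2)),
    integral_add' (iV.add iU) (iO.const_mul (1 / 2)), integral_add' iV iU,
    integral_add' (iE.const_mul (K₁ * R ^ 2 * ρ)) (i3.const_mul (1 / 2)),
    integral_const_mul, integral_const_mul, integral_const_mul, integral_const_mul,
    integral_add (integrable_jb.mul_const _) iD, integral_mul_const,
    integral_add h.du_mem.integrable_sq h.dv_mem.integrable_sq] at hint
  have hG : ∫ x, coerDensity ε u du ddu v dv ddv x
      = ((∫ x, dv x ^ 2) + (∫ x, ddv x ^ 2) + ∫ x, jb x ^ 4 * v x ^ 2)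
        + (∫ x, cutoff ε x * (ddu x ^ 2 + du x ^ 2 + u x ^ 2))
        + ∫ x, (1 - cutoff ε x)
          * (ddu x ^ 2 + du x ^ 2 + deta u du v dv x ^ 2 + eta u v x ^ 2) := by
    have i1 := h.dv_mem.integrable_sq
    have i2 := h.ddv_mem.integrable_sq
    have i3 := h.integrable_jb_mul_sq
    rw [← integral_add' i1 i2, ← integral_add' (i1.add i2) i3,
      ← integral_add' ((i1.add i2).add i3) iA, ← integral_add' (((i1.add i2).add i3).add iA) iO]
    rfl
  have nV : 0 ≤ (∫ x, dv x ^ 2) + (∫ x, ddv x ^ 2) + ∫ x, jb x ^ 4 * v x ^ 2 := by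
    refine add_nonneg (add_nonneg ?_ ?_) ?_ <;> exact integral_nonneg fun x => by positivity
  have nU : 0 ≤ ∫ x, cutoff ε x * (ddu x ^ 2 + du x ^ 2 + u x ^ 2) :=
    integral_nonneg fun x => mul_nonneg (cutoff_pos x).le (by positivity)
  have nO : 0 ≤ ∫ x, (1 - cutoff ε x)
      * (ddu x ^ 2 + du x ^ 2 + deta u du v dv x ^ 2 + eta u v x ^ 2) :=
    integral_nonneg fun x => mul_nonneg (sub_nonneg.2 (cutoff_le_one x)) (by positivity)
  rw [hG] at hrho
  have m1 := mul_le_mul_of_nonneg_right b1 nV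
  have m2 := mul_le_mul_of_nonneg_right b2 nU
  have m3 := mul_le_mul_of_nonneg_right b3 nO
  have m4 := mul_le_mul_of_nonneg_right hεc nU
  have main : c₀ / C * ρ ^ 2 ≤ c₀ * (((∫ x, dv x ^ 2) + (∫ x, ddv x ^ 2)
      + ∫ x, jb x ^ 4 * v x ^ 2)
        + (∫ x, cutoff ε x * (ddu x ^ 2 + du x ^ 2 + u x ^ 2))
        + ∫ x, (1 - cutoff ε x)
          * (ddu x ^ 2 + du x ^ 2 + deta u du v dv x ^ 2 + eta u v x ^ 2)) := by
    rw [hsq, div_mul_eq_mul_div, div_le_iff₀ hC]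
    calc c₀ * rhoSq R u du ddu v dv ddv ≤ c₀ * _ := mul_le_mul_of_nonneg_left hrho hc₀0.le
      _ = _ := by ring
  have err1 : K₁ * R ^ 2 * ρ * (J * ρ ^ 2 + ((∫ x, du x ^ 2) + ∫ x, dv x ^ 2))
      ≤ K₁ * (J + 2) * R ^ 3 * ρ ^ 3 := by
    have := k.du_le
    have := k.dv_le
    calc K₁ * R ^ 2 * ρ * (J * ρ ^ 2 + ((∫ x, du x ^ 2) + ∫ x, dv x ^ 2))
        ≤ K₁ * R ^ 3 * ρ * (J * ρ ^ 2 + (ρ ^ 2 + ρ ^ 2)) := by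
          have : 0 ≤ ∫ x, du x ^ 2 := integral_nonneg fun x => by positivity
          have : 0 ≤ ∫ x, dv x ^ 2 := integral_nonneg fun x => by positivity
          gcongr
          norm_num
      _ = _ := by ring
  have err2 : R ^ 3 * (9 * M * ρ ^ 3 + 1600 * ρ ^ 4)
      ≤ (9 * M + 1600 * ρ₀) * R ^ 3 * ρ ^ 3 := by
    calc R ^ 3 * (9 * M * ρ ^ 3 + 1600 * ρ ^ 4)
        = R ^ 3 * (9 * M * ρ ^ 3 + 1600 * (ρ * ρ ^ 3)) := by ring
      _ ≤ R ^ 3 * (9 * M * ρ ^ 3 + 1600 * (ρ₀ * ρ ^ 3)) := by gcongr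
      _ = _ := by ring
  linarith

end SmallPair

/-! ### Comparison of ρ with the distance, and the upper bound -/

/-- The sum of the squares of the three terms of the distance `d_R`. -/
noncomputable def distSq (R : ℝ) (u du ddu v dv ddv : ℝ → ℝ) : ℝ :=
  ((∫ x, (du x ^ 2 + dv x ^ 2)) + ∫ x, (ddu x ^ 2 + ddv x ^ 2))
    + (∫ x, eta u v x ^ 2) + ∫ x in Ioo (-R) R, (u x ^ 2 + v x ^ 2)

namespace SmallPair

variable {u du ddu v dv ddv : ℝ → ℝ} {R : ℝ}

theorem sq_add_sq_le (h : SmallPair u du ddu v dv ddv) (hR : 1 ≤ R) (x : ℝ) :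
    u x ^ 2 + v x ^ 2 ≤ 8 * (1 + x ^ 2)
      * ((∫ x, (du x ^ 2 + dv x ^ 2)) + ∫ x in Icc (-R) R, (u x ^ 2 + v x ^ 2)) := by
  have key : ∀ {f f' : ℝ → ℝ}, IsAC f f' → MemLp f' 2 volume →
      f x ^ 2 ≤ 4 * (1 + x ^ 2) * (∫ x, f' x ^ 2) + ∫ x in Icc (-R) R, f x ^ 2 := by
    intro f f' hf hf'
    obtain ⟨y, hy, hle⟩ := exists_mem_Icc_sq_le hf.continuous (show (-1 : ℝ) < 1 by norm_num)
    have h1 : ∫ x in Icc (-1) 1, f x ^ 2 ≤ ∫ x in Icc (-R) R, f x ^ 2 :=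
      setIntegral_mono_set (hf.continuous.pow 2).integrableOn_Icc
        (.of_forall fun x => sq_nonneg _)
        (Icc_subset_Icc (by linarith) hR).eventuallyLE
    have h2 := hf.sq_sub_le hf' x y
    have h3 : |x - y| ≤ 2 * (1 + x ^ 2) := (abs_sub x y).trans (by
      have : |y| ≤ 1 := abs_le.2 hy
      rw [← sq_abs x]
      linarith [sq_nonneg (|x| - 1), sq_nonneg |x|])
    have h4 : |x - y| * ∫ z, f' z ^ 2 ≤ (2 * (1 + x ^ 2)) * ∫ z, f' z ^ 2 :=
      mul_le_mul_of_nonneg_right h3 (integral_nonneg fun x => sq_nonneg _)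
    linarith [sq_nonneg (f x - 2 * f y)]
  have iu : IntegrableOn (fun x => u x ^ 2) (Icc (-R) R) := (h.continuous_u.pow 2).integrableOn_Icc
  have iv : IntegrableOn (fun x => v x ^ 2) (Icc (-R) R) := (h.continuous_v.pow 2).integrableOn_Icc
  rw [integral_add h.du_mem.integrable_sq h.dv_mem.integrable_sq, integral_add iu iv]
  have k1 := key h.u_ac h.du_mem
  have k2 := key h.v_ac h.dv_mem
  have n1 : 0 ≤ ∫ x, du x ^ 2 := integral_nonneg fun x => sq_nonneg _
  have n2 : 0 ≤ ∫ x, dv x ^ 2 := integral_nonneg fun x => sq_nonneg _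
  have n3 : 0 ≤ ∫ x in Icc (-R) R, u x ^ 2 := integral_nonneg fun x => sq_nonneg _
  have n4 : 0 ≤ ∫ x in Icc (-R) R, v x ^ 2 := integral_nonneg fun x => sq_nonneg _
  linarith [mul_nonneg (sq_nonneg x) (add_nonneg n1 n2),
    mul_nonneg (sq_nonneg x) (add_nonneg n3 n4)]

theorem integrable_wt_mul_sq_add_sq (h : SmallPair u du ddu v dv ddv) :
    Integrable (fun x => wt x * (u x ^ 2 + v x ^ 2)) volume := by
  simpa only [mul_comm] using Integrable.continuous_mul integrable_wt (C := 4 ^ 2 + 4 ^ 2)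
    (c := fun x => u x ^ 2 + v x ^ 2) ((h.continuous_u.pow 2).add (h.continuous_v.pow 2))
    fun x => by
      rw [abs_of_nonneg (by positivity), ← sq_abs (u x), ← sq_abs (v x)]
      exact add_le_add (pow_le_pow_left₀ (abs_nonneg _) (h.bounds x).1 2)
        (pow_le_pow_left₀ (abs_nonneg _) (h.bounds x).2 2)

/-- The squares of u and v grow at most quadratically, with a factor given by the distance, and `wt`
absorbs that growth. Anchoring at a point of [−1, 1] makes the constant independent of R. -/
theorem exists_integral_wt_mul_le : ∃ C : ℝ, 0 ≤ C ∧ ∀ R, 1 ≤ R → ∀ u du ddu v dv ddv : ℝ → ℝ,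
    SmallPair u du ddu v dv ddv → ∫ x, wt x * (u x ^ 2 + v x ^ 2)
      ≤ C * ((∫ x, (du x ^ 2 + dv x ^ 2)) + ∫ x in Icc (-R) R, (u x ^ 2 + v x ^ 2)) := by
  obtain ⟨W, hW1, hW⟩ := exists_wt_le
  refine ⟨8 * W * ∫ x, jb x, mul_nonneg (by positivity) integral_jb_nonneg,
    fun R hR u du ddu v dv ddv h => ?_⟩
  set B := (∫ x, (du x ^ 2 + dv x ^ 2)) + ∫ x in Icc (-R) R, (u x ^ 2 + v x ^ 2) with hB
  have hB0 : 0 ≤ B := add_nonneg (integral_nonneg fun x => by positivity)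
    (integral_nonneg fun x => by positivity)
  have : 8 * W * (∫ x, jb x) * B = ∫ x, (8 * W * B) * jb x := by
    rw [integral_const_mul]; ring
  rw [this]
  refine integral_mono h.integrable_wt_mul_sq_add_sq (integrable_jb.const_mul _) fun x => ?_
  have hj := jb_pos x
  calc wt x * (u x ^ 2 + v x ^ 2) ≤ (W * jb x ^ 8) * (8 * (1 + x ^ 2) * B) :=
        mul_le_mul (hW x) (h.sq_add_sq_le hR x) (by positivity) (by positivity)
    _ = 8 * W * B * (jb x ^ 6 * jb x) * (jb x * (1 + x ^ 2)) := by ring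
    _ ≤ 8 * W * B * (1 * jb x) * 1 := by
        rw [jb_mul]
        gcongr
        exact pow_le_one₀ hj.le (jb_le_one x)
    _ = _ := by ring

theorem deta_sq_le (h : SmallPair u du ddu v dv ddv) (x : ℝ) :
    deta u du v dv x ^ 2 ≤ 8 * (wt x * (u x ^ 2 + v x ^ 2)) + 272 * (du x ^ 2 + dv x ^ 2) := by
  have hw := wt_pos x
  have a1 : u x ^ 2 ≤ 16 := by
    rw [← sq_abs]; exact (pow_le_pow_left₀ (abs_nonneg _) (h.bounds x).1 2).trans (by norm_num)
  have a2 : v x ^ 2 ≤ 16 := by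
    rw [← sq_abs]; exact (pow_le_pow_left₀ (abs_nonneg _) (h.bounds x).2 2).trans (by norm_num)
  have b1 : (√2 * wt x * u x) ^ 2 ≤ 2 * (wt x * (u x ^ 2 + v x ^ 2)) := by
    calc (√2 * wt x * u x) ^ 2 = 2 * (wt x * (wt x * u x ^ 2)) := by
          rw [mul_pow, mul_pow, sqrt_two_sq]; ring
      _ ≤ 2 * (wt x * (1 * (u x ^ 2 + v x ^ 2))) := by
          gcongr
          · exact wt_le_one x
          · linarith [sq_nonneg (v x)]
      _ = _ := by ring
  have b2 : (2 * u₀ x * du x) ^ 2 ≤ 4 * du x ^ 2 := by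
    calc (2 * u₀ x * du x) ^ 2 = 4 * (u₀ x ^ 2 * du x ^ 2) := by ring
      _ ≤ 4 * (1 * du x ^ 2) := by
          gcongr
          exact u₀_sq_le x
      _ = _ := by ring
  have b3 : (2 * u x * du x) ^ 2 ≤ 64 * du x ^ 2 := by
    calc (2 * u x * du x) ^ 2 = 4 * (u x ^ 2 * du x ^ 2) := by ring
      _ ≤ 4 * (16 * du x ^ 2) := by gcongr
      _ = _ := by ring
  have b4 : (2 * v x * dv x) ^ 2 ≤ 64 * dv x ^ 2 := by
    calc (2 * v x * dv x) ^ 2 = 4 * (v x ^ 2 * dv x ^ 2) := by ring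
      _ ≤ 4 * (16 * dv x ^ 2) := by gcongr
      _ = _ := by ring
  have e : deta u du v dv x = √2 * wt x * u x + 2 * u₀ x * du x + 2 * u x * du x
      + 2 * v x * dv x := by
    rw [deta]; ring
  rw [e]
  generalize √2 * wt x * u x = p at *
  generalize 2 * u₀ x * du x = q at *
  generalize 2 * u x * du x = r at *
  generalize 2 * v x * dv x = s at *
  linarith [sq_nonneg (p - q), sq_nonneg (p - r), sq_nonneg (p - s), sq_nonneg (q - r),
    sq_nonneg (q - s), sq_nonneg (r - s), sq_nonneg (dv x)]

theorem integral_deta_sq_le (h : SmallPair u du ddu v dv ddv) :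
    ∫ x, deta u du v dv x ^ 2
      ≤ 8 * (∫ x, wt x * (u x ^ 2 + v x ^ 2)) + 272 * ∫ x, (du x ^ 2 + dv x ^ 2) := by
  have i1 := h.integrable_wt_mul_sq_add_sq
  have i2 : Integrable (fun x => du x ^ 2 + dv x ^ 2) volume :=
    h.du_mem.integrable_sq.add h.dv_mem.integrable_sq
  rw [← integral_const_mul, ← integral_const_mul, ← integral_add (i1.const_mul _) (i2.const_mul _)]
  exact integral_mono h.deta_mem.integrable_sq ((i1.const_mul _).add (i2.const_mul _))
    h.deta_sq_le

/-- The only term of ρ² absent from the distance is the integral of η'², which `deta_sq_le` reduces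
to u', v' and the weighted norm of u and v. Independence of R is essential: it gives the a priori
bound on ρ that fixes K. -/
theorem exists_rhoSq_le_distSq : ∃ C : ℝ, 1 ≤ C ∧ ∀ R, 1 ≤ R → ∀ u du ddu v dv ddv : ℝ → ℝ,
    SmallPair u du ddu v dv ddv →
      rhoSq R u du ddu v dv ddv ≤ C * distSq R u du ddu v dv ddv := by
  obtain ⟨C, hC, HC⟩ := exists_integral_wt_mul_le
  refine ⟨273 + 8 * C, by linarith, fun R hR u du ddu v dv ddv h => ?_⟩
  have hT := HC R hR u du ddu v dv ddv h
  have hD := h.integral_deta_sq_le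
  have i1 : Integrable (fun x => du x ^ 2 + dv x ^ 2) volume :=
    h.du_mem.integrable_sq.add h.dv_mem.integrable_sq
  have i2 : Integrable (fun x => ddu x ^ 2 + ddv x ^ 2) volume :=
    h.ddu_mem.integrable_sq.add h.ddv_mem.integrable_sq
  have p1 : ∫ x, (ddu x ^ 2 + ddv x ^ 2 + du x ^ 2 + dv x ^ 2)
      = (∫ x, (du x ^ 2 + dv x ^ 2)) + ∫ x, (ddu x ^ 2 + ddv x ^ 2) := by
    rw [← integral_add i1 i2]
    congr 1; ext x; ring
  have p2 : ∫ x in Icc (-R) R, (u x ^ 2 + (R ^ 2)⁻¹ * v x ^ 2)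
      ≤ ∫ x in Icc (-R) R, (u x ^ 2 + v x ^ 2) := by
    refine setIntegral_mono ((h.continuous_u.pow 2).add
      (continuous_const.mul (h.continuous_v.pow 2))).integrableOn_Icc
      ((h.continuous_u.pow 2).add (h.continuous_v.pow 2)).integrableOn_Icc fun x => ?_
    have : (R ^ 2)⁻¹ * v x ^ 2 ≤ v x ^ 2 := mul_le_of_le_one_left (sq_nonneg _)
      (inv_le_one_of_one_le₀ (one_le_pow₀ hR))
    simp only
    linarith
  have p3 : ∫ x in {x : ℝ | R ≤ |x|}, (deta u du v dv x ^ 2 + eta u v x ^ 2)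
      ≤ (∫ x, deta u du v dv x ^ 2) + ∫ x, eta u v x ^ 2 := by
    rw [← integral_add h.deta_mem.integrable_sq h.eta_mem.integrable_sq]
    exact setIntegral_le_integral h.integrable_deta_sq_add (.of_forall fun x => by positivity)
  have n1 : 0 ≤ ∫ x, (du x ^ 2 + dv x ^ 2) := integral_nonneg fun x => by positivity
  have n2 : 0 ≤ ∫ x, (ddu x ^ 2 + ddv x ^ 2) := integral_nonneg fun x => by positivity
  have n3 : 0 ≤ ∫ x, eta u v x ^ 2 := integral_nonneg fun x => by positivity
  have n4 : 0 ≤ ∫ x in Icc (-R) R, (u x ^ 2 + v x ^ 2) := integral_nonneg fun x => by positivity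
  rw [rhoSq, distSq, ← integral_Icc_eq_integral_Ioo]
  linarith [mul_nonneg hC n2, mul_nonneg hC n3]

/-- On |x| ≤ R, where ρ contains no η, the uniform bounds on u and v make η² at most 72 (u² + v²).
The factor R² undoes the weight of v in ρ. -/
theorem distSq_le (h : SmallPair u du ddu v dv ddv) (hR : 1 ≤ R) :
    distSq R u du ddu v dv ddv ≤ (75 * R ^ 2) * rhoSq R u du ddu v dv ddv := by
  have hR2 : 1 ≤ R ^ 2 := one_le_pow₀ hR
  have i1 : Integrable (fun x => du x ^ 2 + dv x ^ 2) volume :=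
    h.du_mem.integrable_sq.add h.dv_mem.integrable_sq
  have i2 : Integrable (fun x => ddu x ^ 2 + ddv x ^ 2) volume :=
    h.ddu_mem.integrable_sq.add h.ddv_mem.integrable_sq
  have p1 : ∫ x, (ddu x ^ 2 + ddv x ^ 2 + du x ^ 2 + dv x ^ 2)
      = (∫ x, (du x ^ 2 + dv x ^ 2)) + ∫ x, (ddu x ^ 2 + ddv x ^ 2) := by
    rw [← integral_add i1 i2]
    congr 1; ext x; ring
  have iN : IntegrableOn (fun x => u x ^ 2 + v x ^ 2) (Icc (-R) R) :=
    ((h.continuous_u.pow 2).add (h.continuous_v.pow 2)).integrableOn_Icc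
  have p2 : ∫ x in Icc (-R) R, (u x ^ 2 + v x ^ 2)
      ≤ R ^ 2 * ∫ x in Icc (-R) R, (u x ^ 2 + (R ^ 2)⁻¹ * v x ^ 2) := by
    rw [← integral_const_mul]
    refine setIntegral_mono iN (((h.continuous_u.pow 2).add
      (continuous_const.mul (h.continuous_v.pow 2))).integrableOn_Icc.const_mul _) fun x => ?_
    have e : R ^ 2 * (u x ^ 2 + (R ^ 2)⁻¹ * v x ^ 2) = R ^ 2 * u x ^ 2 + v x ^ 2 := by
      field_simp
    simp only
    rw [e]
    linarith [le_mul_of_one_le_left (sq_nonneg (u x)) hR2]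
  have p3 : ∫ x in Icc (-R) R, eta u v x ^ 2 ≤ 72 * ∫ x in Icc (-R) R, (u x ^ 2 + v x ^ 2) := by
    rw [← integral_const_mul]
    refine setIntegral_mono h.eta_mem.integrable_sq.integrableOn (iN.const_mul _) fun x => ?_
    have a1 : u x ^ 2 ≤ 16 := by
      rw [← sq_abs]; exact (pow_le_pow_left₀ (abs_nonneg _) (h.bounds x).1 2).trans (by norm_num)
    have a2 : v x ^ 2 ≤ 16 := by
      rw [← sq_abs]; exact (pow_le_pow_left₀ (abs_nonneg _) (h.bounds x).2 2).trans (by norm_num)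
    have a3 : (u x ^ 2 + v x ^ 2) ^ 2 ≤ 32 * (u x ^ 2 + v x ^ 2) := by
      rw [sq]; gcongr; linarith
    have a4 := mul_le_of_le_one_left (sq_nonneg (u x)) (u₀_sq_le x)
    simp only
    rw [eta_eq]
    linarith [sq_nonneg (2 * u₀ x * u x - (u x ^ 2 + v x ^ 2)), sq_nonneg (v x)]
  have p4 : ∫ x in (Icc (-R) R)ᶜ, eta u v x ^ 2
      ≤ ∫ x in {x : ℝ | R ≤ |x|}, (deta u du v dv x ^ 2 + eta u v x ^ 2) := by
    have hsub : (Icc (-R) R)ᶜ ⊆ {x : ℝ | R ≤ |x|} := by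
      intro x hx
      by_contra h'
      exact hx (abs_le.1 (not_le.1 h').le)
    refine (setIntegral_mono h.eta_mem.integrable_sq.integrableOn
      h.integrable_deta_sq_add.integrableOn fun x => ?_).trans
      (setIntegral_mono_set h.integrable_deta_sq_add.integrableOn
        (.of_forall fun x => by positivity) hsub.eventuallyLE)
    simp only
    linarith [sq_nonneg (deta u du v dv x)]
  have n1 : 0 ≤ ∫ x, (du x ^ 2 + dv x ^ 2) := integral_nonneg fun x => by positivity
  have n2 : 0 ≤ ∫ x, (ddu x ^ 2 + ddv x ^ 2) := integral_nonneg fun x => by positivity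
  have n3 : 0 ≤ ∫ x in {x : ℝ | R ≤ |x|}, (deta u du v dv x ^ 2 + eta u v x ^ 2) :=
    integral_nonneg fun x => by positivity
  have n4 : 0 ≤ ∫ x in Icc (-R) R, (u x ^ 2 + (R ^ 2)⁻¹ * v x ^ 2) :=
    integral_nonneg fun x => by positivity
  have p5 := integral_add_compl measurableSet_Icc (h.eta_mem.integrable_sq) (s := Icc (-R) R)
  have p6 := le_mul_of_one_le_left n3 hR2
  have p7 := le_mul_of_one_le_left (add_nonneg n1 n2) hR2
  have p8 := mul_nonneg (by positivity : 0 ≤ R ^ 2) n4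
  rw [rhoSq, distSq, ← integral_Icc_eq_integral_Ioo, p1]
  linarith

theorem lamDensity_le (h : SmallPair u du ddu v dv ddv) (x : ℝ) :
    lamDensity u du ddu v dv ddv x ≤ 360 * ((du x ^ 2 + dv x ^ 2) + (ddu x ^ 2 + ddv x ^ 2))
      + 5 * (wt x * (u x ^ 2 + v x ^ 2)) + 30 * eta u v x ^ 2 := by
  have hη := abs_le.1 (h.abs_eta_le x)
  have hu := u₀_sq_le x
  have hD0 : 0 ≤ du x ^ 2 + dv x ^ 2 := by positivity
  have a1 : (3 * (u₀ x ^ 2 + eta u v x) - 2) * (du x ^ 2 + dv x ^ 2)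
      ≤ 200 * (du x ^ 2 + dv x ^ 2) := by gcongr; linarith
  have a2 : 1 / 2 * (3 * u₀ x ^ 2 - 2) * eta u v x ^ 2 ≤ 1 * eta u v x ^ 2 := by
    gcongr; linarith
  have a3 : 3 * √2 * wt x * eta u v x * du x ≤ 5 * (eta u v x ^ 2 + du x ^ 2) := by
    have b1 : 3 * √2 * wt x ≤ 6 := by
      have : √2 ≤ 2 := by
        rw [Real.sqrt_le_left (by norm_num)]; norm_num
      calc 3 * √2 * wt x ≤ 3 * 2 * 1 := by
            have := wt_pos x
            gcongr
            exact wt_le_one x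
        _ = 6 := by norm_num
    have b2 : eta u v x * du x ≤ 1 / 2 * (eta u v x ^ 2 + du x ^ 2) := by
      linarith [sq_nonneg (eta u v x - du x)]
    calc 3 * √2 * wt x * eta u v x * du x = 3 * √2 * wt x * (eta u v x * du x) := by ring
      _ ≤ 3 * √2 * wt x * (1 / 2 * (eta u v x ^ 2 + du x ^ 2)) := by
          have := wt_pos x
          gcongr
      _ ≤ 6 * (1 / 2 * (eta u v x ^ 2 + du x ^ 2)) := by gcongr
      _ ≤ _ := by linarith [sq_nonneg (eta u v x), sq_nonneg (du x)]
  have a4 : 1 / 2 * eta u v x ^ 3 ≤ 20 * eta u v x ^ 2 := by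
    have : eta u v x * eta u v x ^ 2 ≤ 40 * eta u v x ^ 2 := by gcongr; exact hη.2
    linarith
  have a5 := h.deta_sq_le x
  rw [lamDensity]
  linarith [sq_nonneg (dv x), sq_nonneg (du x), sq_nonneg (ddu x), sq_nonneg (ddv x),
    sq_nonneg (eta u v x)]

theorem exists_integral_lamDensity_le : ∃ C : ℝ, 0 ≤ C ∧ ∀ R, 1 ≤ R →
    ∀ u du ddu v dv ddv : ℝ → ℝ, SmallPair u du ddu v dv ddv →
      ∫ x, lamDensity u du ddu v dv ddv x ≤ C * distSq R u du ddu v dv ddv := by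
  obtain ⟨C, hC, HC⟩ := exists_integral_wt_mul_le
  refine ⟨360 + 5 * C, by positivity, fun R hR u du ddu v dv ddv h => ?_⟩
  have hT := HC R hR u du ddu v dv ddv h
  have i1 : Integrable (fun x => du x ^ 2 + dv x ^ 2) volume :=
    h.du_mem.integrable_sq.add h.dv_mem.integrable_sq
  have i2 : Integrable (fun x => ddu x ^ 2 + ddv x ^ 2) volume :=
    h.ddu_mem.integrable_sq.add h.ddv_mem.integrable_sq
  have i3 := h.integrable_wt_mul_sq_add_sq
  have i4 := h.eta_mem.integrable_sq
  have hle := integral_mono h.integrable_lamDensity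
    ((((i1.add i2).const_mul 360).add (i3.const_mul 5)).add (i4.const_mul 30)) h.lamDensity_le
  rw [integral_add' (((i1.add i2).const_mul 360).add (i3.const_mul 5)) (i4.const_mul 30),
    integral_add' ((i1.add i2).const_mul 360) (i3.const_mul 5), integral_const_mul,
    integral_const_mul, integral_const_mul, integral_add' i1 i2] at hle
  have n1 : 0 ≤ ∫ x, (du x ^ 2 + dv x ^ 2) := integral_nonneg fun x => by positivity
  have n2 : 0 ≤ ∫ x, (ddu x ^ 2 + ddv x ^ 2) := integral_nonneg fun x => by positivity
  have n3 : 0 ≤ ∫ x, eta u v x ^ 2 := integral_nonneg fun x => by positivity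
  have n4 : 0 ≤ ∫ x in Icc (-R) R, (u x ^ 2 + v x ^ 2) := integral_nonneg fun x => by positivity
  rw [distSq, ← integral_Icc_eq_integral_Ioo]
  linarith [mul_nonneg hC n2, mul_nonneg hC n3]

end SmallPair

/-! ### Back to the original distance and ρ -/

namespace IsRep

variable {u v a da dda b db ddb : ℝ → ℝ} {R : ℝ}

theorem smallPair (hr : IsRep u v a da dda b db ddb)
    (hd : eDist R (perturbed u v) solitonC ≤ 1) : SmallPair a da dda b db ddb := by
  obtain ⟨m1, m2, m3, m4, m5, he⟩ := hr.of_eDist_lt_top (hd.trans_lt ENNReal.one_lt_top)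
  rw [he, ENNReal.ofReal_le_one] at hd
  have n1 := Real.sqrt_nonneg ((∫ x, (da x ^ 2 + db x ^ 2)) + ∫ x, (dda x ^ 2 + ddb x ^ 2))
  have n2 := Real.sqrt_nonneg (∫ x, eta a b x ^ 2)
  have n3 := Real.sqrt_nonneg (∫ x in Ioo (-R) R, (a x ^ 2 + b x ^ 2))
  refine ⟨hr.a_ac, hr.da_ac, hr.b_ac, hr.db_ac, m1, m2, m3, m4, m5, ?_, ?_⟩ <;>
    exact ((Real.sqrt_le_left zero_le_one).1 (by linarith)).trans_eq (one_pow 2)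

/-- The distance is a sum of three nonnegative terms and `distSq` is the sum of their squares. -/
theorem distSq_le_and_le (hr : IsRep u v a da dda b db ddb)
    (hd : eDist R (perturbed u v) solitonC ≤ 1) :
    distSq R a da dda b db ddb ≤ (eDist R (perturbed u v) solitonC).toReal ^ 2 ∧
      (eDist R (perturbed u v) solitonC).toReal ^ 2 ≤ 3 * distSq R a da dda b db ddb := by
  obtain ⟨-, -, -, -, -, he⟩ := hr.of_eDist_lt_top (hd.trans_lt ENNReal.one_lt_top)
  have p1 : 0 ≤ (∫ x, (da x ^ 2 + db x ^ 2)) + ∫ x, (dda x ^ 2 + ddb x ^ 2) :=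
    add_nonneg (integral_nonneg fun x => by positivity) (integral_nonneg fun x => by positivity)
  have p2 : 0 ≤ ∫ x, eta a b x ^ 2 := integral_nonneg fun x => by positivity
  have p3 : 0 ≤ ∫ x in Ioo (-R) R, (a x ^ 2 + b x ^ 2) := integral_nonneg fun x => by positivity
  rw [he, ENNReal.toReal_ofReal (by positivity), distSq]
  have s1 := Real.sq_sqrt p1
  have s2 := Real.sq_sqrt p2
  have s3 := Real.sq_sqrt p3
  have n1 := Real.sqrt_nonneg ((∫ x, (da x ^ 2 + db x ^ 2)) + ∫ x, (dda x ^ 2 + ddb x ^ 2))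
  have n2 := Real.sqrt_nonneg (∫ x, eta a b x ^ 2)
  have n3 := Real.sqrt_nonneg (∫ x in Ioo (-R) R, (a x ^ 2 + b x ^ 2))
  set p := √((∫ x, (da x ^ 2 + db x ^ 2)) + ∫ x, (dda x ^ 2 + ddb x ^ 2))
  set q := √(∫ x, eta a b x ^ 2)
  set r := √(∫ x in Ioo (-R) R, (a x ^ 2 + b x ^ 2))
  constructor
  · linarith [mul_nonneg n1 n2, mul_nonneg n1 n3, mul_nonneg n2 n3]
  · linarith [sq_nonneg (p - q), sq_nonneg (p - r), sq_nonneg (q - r)]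

theorem eRhoSq_eq_ofReal (hr : IsRep u v a da dda b db ddb) (h : SmallPair a da dda b db ddb) :
    eRhoSq R u v = ENNReal.ofReal (rhoSq R a da dda b db ddb) := by
  have n1 : 0 ≤ ∫ x, (dda x ^ 2 + ddb x ^ 2 + da x ^ 2 + db x ^ 2) :=
    integral_nonneg fun x => by positivity
  have n2 : 0 ≤ ∫ x in Icc (-R) R, (a x ^ 2 + (R ^ 2)⁻¹ * b x ^ 2) :=
    integral_nonneg fun x => by positivity
  have n3 : 0 ≤ ∫ x in {x : ℝ | R ≤ |x|}, (deta a da b db x ^ 2 + eta a b x ^ 2) :=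
    integral_nonneg fun x => by positivity
  have i2 : IntegrableOn (fun x => a x ^ 2 + (R ^ 2)⁻¹ * b x ^ 2) (Icc (-R) R) :=
    ((h.continuous_u.pow 2).add (continuous_const.mul (h.continuous_v.pow 2))).integrableOn_Icc
  rw [hr.eRhoSq_eq, rhoSq, setOf_abs_le, ENNReal.ofReal_add (add_nonneg n1 n2) n3,
    ENNReal.ofReal_add n1 n2,
    ofReal_integral_eq_lintegral_ofReal h.integrable_derivs (.of_forall fun x => by positivity),
    ofReal_integral_eq_lintegral_ofReal i2 (.of_forall fun x => by positivity),
    ofReal_integral_eq_lintegral_ofReal h.integrable_deta_sq_add.integrableOn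
      (.of_forall fun x => by positivity)]

theorem rho_eq (hr : IsRep u v a da dda b db ddb) (h : SmallPair a da dda b db ddb) :
    rho R u v = √(rhoSq R a da dda b db ddb) := by
  rw [rho, hr.eRhoSq_eq_ofReal h, ENNReal.toReal_ofReal (rhoSq_nonneg _ _ _ _ _ _ _)]

end IsRep

/-! ### The lower bound in ρ and the main theorem -/

/-- The lower bound in terms of `ρ`. -/
theorem exists_Lam_sub_ge : ∃ K : ℝ, 0 ≤ K ∧ ∀ R : ℝ, 1 ≤ R → ∃ C₂ : ℝ, 0 < C₂ ∧
    ∀ u v a da dda b db ddb : ℝ → ℝ, IsRep u v a da dda b db ddb →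
      eDist R (perturbed u v) solitonC ≤ 1 → Orthogonality u v →
      C₂ * rho R u v ^ 2 - K * R ^ 3 * rho R u v ^ 3
        ≤ Lam (perturbed u v) - Lam solitonC := by
  obtain ⟨C, hC, HC⟩ := SmallPair.exists_rhoSq_le_distSq
  obtain ⟨K, hK, H⟩ := SmallPair.exists_integral_lamDensity_ge C (by linarith)
  refine ⟨K, hK, fun R hR => ?_⟩
  obtain ⟨C₂, hC₂, H⟩ := H R hR
  refine ⟨C₂, hC₂, fun u v a da dda b db ddb hr hd ho => ?_⟩
  have h := hr.smallPair hd
  obtain ⟨ou, ov⟩ := hr.orthogonality ho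
  rw [hr.rho_eq h, hr.Lam_eq h]
  -- The a priori bound ρ ≤ C holds because ρ² ≤ C · 1 ≤ C², with C ≥ 1 independent of R.
  refine H a da dda b db ddb h ou ov ?_
  have h1 := (hr.distSq_le_and_le hd).1
  have h2 : (eDist R (perturbed u v) solitonC).toReal ≤ 1 :=
    ENNReal.toReal_le_of_le_ofReal zero_le_one (by simpa using hd)
  have h3 : (eDist R (perturbed u v) solitonC).toReal ^ 2 ≤ 1 :=
    pow_le_one₀ ENNReal.toReal_nonneg h2
  rw [Real.sqrt_le_left (by linarith)]
  calc rhoSq R a da dda b db ddb ≤ C * distSq R a da dda b db ddb := HC R hR a da dda b db ddb h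
    _ ≤ C * 1 := by gcongr; linarith
    _ ≤ C ^ 2 := by rw [mul_one]; exact le_self_pow₀ hC (by norm_num)

end BlackSoliton

theorem mainTheorem3 :
    -- the lower bound in terms of `ρ`; the constant `K` in the cubic error is uniform in `R`
    (∃ R₀ : ℝ, 1 ≤ R₀ ∧ ∃ K : ℝ, 0 ≤ K ∧ ∀ R : ℝ, R₀ ≤ R → ∃ C₂ : ℝ, 0 < C₂ ∧
      ∀ u v : ℝ → ℝ, BlackSoliton.MemH2loc (BlackSoliton.perturbed u v) →
        BlackSoliton.eDist R (BlackSoliton.perturbed u v) BlackSoliton.solitonC ≤ 1 →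
        BlackSoliton.Orthogonality u v →
          Integrable (BlackSoliton.higherDensity (BlackSoliton.perturbed u v)) volume ∧
          Integrable (BlackSoliton.energyDensity (BlackSoliton.perturbed u v)) volume ∧
          BlackSoliton.eRhoSq R u v < ⊤ ∧
          C₂ * BlackSoliton.rho R u v ^ 2 - K * R ^ 3 * BlackSoliton.rho R u v ^ 3
            ≤ BlackSoliton.Lam (BlackSoliton.perturbed u v)
              - BlackSoliton.Lam BlackSoliton.solitonC) ∧
    -- the two-sided bound in terms of the distance `d_R`
    (∀ R : ℝ, 1 ≤ R → ∃ ε₁ : ℝ, 0 < ε₁ ∧ ε₁ < 1 ∧ ∃ C₄ : ℝ, 1 ≤ C₄ ∧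
      ∀ u v : ℝ → ℝ, BlackSoliton.MemH2loc (BlackSoliton.perturbed u v) →
        BlackSoliton.eDist R (BlackSoliton.perturbed u v) BlackSoliton.solitonC
          ≤ ENNReal.ofReal ε₁ →
        BlackSoliton.Orthogonality u v →
          Integrable (BlackSoliton.higherDensity (BlackSoliton.perturbed u v)) volume ∧
          Integrable (BlackSoliton.energyDensity (BlackSoliton.perturbed u v)) volume ∧
          C₄⁻¹ * (BlackSoliton.eDist R (BlackSoliton.perturbed u v)
              BlackSoliton.solitonC).toReal ^ 2
            ≤ BlackSoliton.Lam (BlackSoliton.perturbed u v)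
              - BlackSoliton.Lam BlackSoliton.solitonC ∧
          BlackSoliton.Lam (BlackSoliton.perturbed u v)
              - BlackSoliton.Lam BlackSoliton.solitonC
            ≤ C₄ * (BlackSoliton.eDist R (BlackSoliton.perturbed u v)
              BlackSoliton.solitonC).toReal ^ 2) := by
  obtain ⟨K, hK, H⟩ := BlackSoliton.exists_Lam_sub_ge
  refine ⟨⟨1, le_rfl, K, hK, fun R hR => ?_⟩, fun R hR => ?_⟩
  · obtain ⟨C₂, hC₂, H⟩ := H R hR
    refine ⟨C₂, hC₂, fun u v hψ hd ho => ?_⟩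
    obtain ⟨a, da, dda, b, db, ddb, hr⟩ := hψ.exists_isRep
    have h := hr.smallPair hd
    refine ⟨hr.integrable_higherDensity h, hr.integrable_energyDensity h, ?_,
      H u v a da dda b db ddb hr hd ho⟩
    rw [hr.eRhoSq_eq_ofReal h]
    exact ENNReal.ofReal_lt_top
  · obtain ⟨C₂, hC₂, H⟩ := H R hR
    obtain ⟨C, hC, HC⟩ := BlackSoliton.SmallPair.exists_rhoSq_le_distSq
    obtain ⟨B, hB, HB⟩ := BlackSoliton.SmallPair.exists_integral_lamDensity_le
    have hε : 0 < C₂ / (2 * (K * R ^ 3 * C + 1)) := by positivity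
    -- Since ρ ≤ C d, the second entry of the minimum forces K R³ ρ ≤ C₂/2, so the cubic term takes
    -- at most half of the quadratic one. In the constant C₄, 450 = 2 · 3 · 75 collects that half,
    -- the comparison of d² with `distSq` and the one of `distSq` with ρ², while B serves the upper
    -- bound.
    refine ⟨min (1 / 2) (C₂ / (2 * (K * R ^ 3 * C + 1))), by positivity,
      (min_le_left _ _).trans_lt (by norm_num), 1 + (450 * R ^ 2) / C₂ + B,
      by linarith [show 0 ≤ (450 * R ^ 2) / C₂ by positivity], fun u v hψ hd' ho => ?_⟩
    have hd : BlackSoliton.eDist R (BlackSoliton.perturbed u v) BlackSoliton.solitonC ≤ 1 :=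
      hd'.trans (ENNReal.ofReal_le_one.2 ((min_le_left _ _).trans (by norm_num)))
    obtain ⟨a, da, dda, b, db, ddb, hr⟩ := hψ.exists_isRep
    have h := hr.smallPair hd
    have hge := H u v a da dda b db ddb hr hd ho
    have hle := HB R hR a da dda b db ddb h
    have hrho := HC R hR a da dda b db ddb h
    have hdist := h.distSq_le hR
    obtain ⟨d1, d2⟩ := hr.distSq_le_and_le hd
    have hdr := ENNReal.toReal_le_of_le_ofReal (by positivity) hd'
    rw [← hr.Lam_eq h] at hle
    have hρ := hr.rho_eq (R := R) h
    have hρ0 : 0 ≤ BlackSoliton.rho R u v := Real.sqrt_nonneg _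
    have hρ2 := Real.sq_sqrt (BlackSoliton.rhoSq_nonneg R a da dda b db ddb)
    rw [← hρ] at hρ2
    have hd0 : 0 ≤ (BlackSoliton.eDist R (BlackSoliton.perturbed u v)
      BlackSoliton.solitonC).toReal := ENNReal.toReal_nonneg
    refine ⟨hr.integrable_higherDensity h, hr.integrable_energyDensity h, ?_, ?_⟩
    all_goals
      generalize BlackSoliton.Lam (BlackSoliton.perturbed u v)
        - BlackSoliton.Lam BlackSoliton.solitonC = L at *
      generalize (BlackSoliton.eDist R (BlackSoliton.perturbed u v)
        BlackSoliton.solitonC).toReal = d at *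
      generalize BlackSoliton.rho R u v = ρ at *
    · have e1 : ρ ≤ C * d := by
        refine le_of_sq_le_sq ?_ (by positivity)
        rw [hρ2]
        calc _ ≤ C * d ^ 2 := hrho.trans (by gcongr)
          _ ≤ C ^ 2 * d ^ 2 := by gcongr; exact le_self_pow₀ hC (by norm_num)
          _ = _ := by ring
      have e2 : d * (2 * (K * R ^ 3 * C + 1)) ≤ C₂ :=
        (le_div_iff₀ (by positivity)).1 (hdr.trans (min_le_right _ _))
      have e3 : K * R ^ 3 * ρ ≤ C₂ / 2 := by
        have : K * R ^ 3 * ρ ≤ K * R ^ 3 * (C * d) := by gcongr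
        linarith
      have e4 : K * R ^ 3 * ρ * ρ ^ 2 ≤ C₂ / 2 * ρ ^ 2 := by gcongr
      have e5 : d ^ 2 ≤ 225 * R ^ 2 * ρ ^ 2 := by
        rw [hρ2]; linarith
      have e6 : C₂ / 2 * ρ ^ 2 ≤ L := by linarith
      rw [inv_mul_le_iff₀ (by positivity)]
      have hL : 0 ≤ L := le_trans (by positivity) e6
      calc d ^ 2 ≤ 225 * R ^ 2 * ρ ^ 2 := e5
        _ = (450 * R ^ 2) / C₂ * (C₂ / 2 * ρ ^ 2) := by field_simp; ring
        _ ≤ (450 * R ^ 2) / C₂ * L := by gcongr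
        _ ≤ (1 + (450 * R ^ 2) / C₂ + B) * L := by gcongr; linarith
    · calc L ≤ B * d ^ 2 := hle.trans (by gcongr)
        _ ≤ (1 + (450 * R ^ 2) / C₂ + B) * d ^ 2 := by
          gcongr
          linarith [show 0 ≤ (450 * R ^ 2) / C₂ by positivity]
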